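/- **Setting.** Let $f:\mathbb R^n\to\mathbb R$ be continuously differentiable, $\varphi:\mathbb R^n\to(-\infty,+\infty]$ convex, lower semicontinuous and proper, $\psi=f+\varphi$, and let $\Lambda\in\mathbb R^{n\times n}$ be symmetric positive definite. Put $\|x\|_A=\sqrt{\langle x,Ax\rangle}$, $\lambda_m=\|\Lambda^{-1}\|^{-1}$ (spectral norm), $\mathrm{prox}(z)=\arg\min_y \varphi(y)+\frac12\|z-y\|_\Lambda^2$, $$F(z)=\nabla f(\mathrm{prox}(z))+\Lambda(z-\mathrm{prox}(z)),\qquad \chi(z)=\|F(z)\|_{\Lambda^{-1}},\qquad H_\tau(z)=\psi(\mathrm{prox}(z))+\tfrac{\tau}{2}\chi(z)^2,$$ $$\mathrm{pred}(z,s,\Delta,\nu)=\tfrac{\tau}{2}\chi(z)\min\{1,\Delta,\chi(z)\}+\frac{\nu\,\chi(z)}{\min\{\Delta,\chi(z)\}}\|\mathrm{prox}(z+s)-\mathrm{prox}(z)\|_\Lambda^2 .$$ For a locally Lipschitz map $G:\mathbb R^n\to\mathbb R^n$, $\partial G$ is Clarke's generalized Jacobian. $G$ is *semismooth* at $z$ if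 it is Lipschitz near $z$, directionally differentiable at $z$, and $\sup_{A\in\partial G(z+h)}\|G(z+h)-G(z)-Ah\|=o(\|h\|)$ as $h\to0$; it is *$\beta$-order semismooth* if moreover this supremum is $O(\|h\|^{1+\beta})$. **Method.** Fix $\tau\in(0,1)$, $0<\eta_1\le\eta_2<1$, $0<\gamma_0<\gamma_1<1<\gamma_2$, $\Delta_{\min}\ge0$, $z_0\in\mathbb R^n$, $\Delta_0>0$, tolerances $\epsilon_k\ge0$, symmetric matrices $B_k$, and parameters $\nu_k$. While $F(z_k)\ne0$: 1. choose $D_k\in\partial\,\mathrm{prox}(z_k)$ and set $M_k=B_kD_k+\Lambda(I-D_k)$; 2. let $\bar q_k$ be the output of the Steihaug-CG method (below) with $S=D_k^\top M_k$, $g=D_k^\top F(z_k)$, $\Delta=\Delta_k$, $\epsilon=\epsilon_k$; 3. set $\bar s_k=\bar q_k-\Lambda^{-1}(F(z_k)+M_k\bar q_k)$, $s_k=\min\{1,\Delta_k/\|\bar s_k\|_\Lambda\}\,\bar s_k$ (with $s_k=0$ if $\bar s_k=0$) and $\rho_k=\dfrac{H_\tau(z_k)-H_\tau(z_k+s_k)}{\mathrm{pred}(z_k,s_k,\Delta_k,\nu_k)}$;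 4. if $\rho_k<\eta_1$, set $z_{k+1}=z_k$, $B_{k+1}=B_k$; otherwise set $z_{k+1}=z_k+s_k$ and choose any symmetric $B_{k+1}$; 5. choose $\Delta_{k+1}\in(\gamma_0\Delta_k,\gamma_1\Delta_k]$ if $\rho_k<\eta_1$; $\Delta_{k+1}\in[\gamma_1\Delta_k,\max\{\Delta_{\min},\Delta_k\}]\cap[\Delta_{\min},\infty)$ if $\eta_1\le\rho_k<\eta_2$; $\Delta_{k+1}\in(\Delta_k,\max\{\Delta_{\min},\gamma_2\Delta_k\}]\cap[\Delta_{\min},\infty)$ if $\rho_k\ge\eta_2$. *Steihaug-CG.* Start with $q_0=0$, $r_0=g$, $p_0=-g$; return $0$ if $\|r_0\|<\epsilon$ or $r_0=0$. For $i=0,\dots,n-1$: if $\langle p_i,Sp_i\rangle\le0$, return $q_i+\alpha p_i$, where $\alpha$ minimizes $m(q)=\langle g,q\rangle+\frac12\langle q,Sq\rangle$ at $q=q_i+\alpha p_i$ over all $\alpha$ with $\|q_i+\alpha p_i\|=\Delta$. Otherwise set $\alpha_i=\|r_i\|^2/\langle p_i,Sp_i\rangle$ and $q_{i+1}=q_i+\alpha_ip_i$;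 if $\|q_{i+1}\|\ge\Delta$, return $q_i+\alpha p_i$ with $\alpha\ge0$ and $\|q_i+\alpha p_i\|=\Delta$. Otherwise set $r_{i+1}=r_i+\alpha_iSp_i$; if $\|r_{i+1}\|<\epsilon$ or $r_{i+1}=0$, return $q_{i+1}$; else set $p_{i+1}=-r_{i+1}+\frac{\|r_{i+1}\|^2}{\|r_i\|^2}p_i$. If the loop is exhausted, return $q_n$. Let $x_k=\mathrm{prox}(z_k)$, $\mathcal S=\{k:\rho_k\ge\eta_1\}$ (the successful iterations) and $n_{\mathcal S}(k)=|\mathcal S\cap\{0,\dots,k-1\}|$. **Theorem.** Suppose the method does not terminate after finitely many steps, $\Delta_{\min}>0$, and: - $\nabla f$ is Lipschitz continuous on $\mathrm{dom}\,\varphi$ with modulus $L$, and $\psi$ is bounded below on $\mathrm{dom}\,\partial\varphi$; - $\nu\in[0,1)$, $0\le\nu_k\le\nu$ for all $k$, and $\tau(L^2+2\lambda_m^2)<2\lambda_m^2(1-\nu)$; - $\sup_k\|B_k\|<\infty$; - $z_k\to\bar z$; put $\bar x=\mathrm{prox}(\bar z)$; - $f$ is twice continuously differentiable on $\mathrm{dom}\,\varphi$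 (that is, $\nabla f$ is differentiable at every point of $\mathrm{dom}\,\varphi$ and $\nabla^2f$ is continuous on $\mathrm{dom}\,\varphi$); - $\mathrm{prox}$ is semismooth at $\bar z$; - there are $\kappa_M>0$ and $K\in\mathbb N$ such that for all $k\ge K$ the matrix $D_k^\top M_k$ is positive semidefinite and $M_k$ is invertible with $\|M_k^{-1}\|\le\kappa_M$; - $\displaystyle\lim_{k\to\infty}\frac{\|[B_k-\nabla^2f(x_k)](x_k-\bar x)\|}{\|z_k-\bar z\|}=0$; - $\epsilon_k\le\mathcal E(F(z_k))$ for all $k$, where $\mathcal E:\mathbb R^n\to[0,\infty)$ is continuous with $\mathcal E(0)=0$ and $\mathcal E(h)=o(\|h\|)$ as $h\to0$; - $\nu_k\le a_{n_{\mathcal S}(k)}^2\,\|\mathrm{prox}(z_k+s_k)-x_k\|_\Lambda^{2p}$ for all $k$, where $p>0$ and $(a_k)$ is a positive sequence with $\limsup_k a_k^2/k^{1+p}<\infty$ and $\limsup_k a_{k+1}/a_k<\infty$. Then: 1. there is $\bar K\in\mathbb N$ with $k\in\mathcal S$ for all $k\ge\bar K$, and $z_k\to\bar z$ q-superlinearly,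 i.e. $\|z_{k+1}-\bar z\|=o(\|z_k-\bar z\|)$; 2. if in addition, for some $\beta\in(0,1]$, $\mathrm{prox}$ is $\beta$-order semismooth at $\bar z$, $\mathcal E(h)=O(\|h\|^{1+\beta})$ as $h\to0$, $B_k=\nabla^2f(x_k)$ for all $k$, and $\nabla^2f$ is Lipschitz continuous on $U\cap\mathrm{dom}\,\varphi$ for some neighborhood $U$ of $\bar x$, then the convergence is of order $1+\beta$, i.e. $\|z_{k+1}-\bar z\|=O(\|z_k-\bar z\|^{1+\beta})$. -/

import Mathlib

open Filter Topology Set Asymptotics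
open scoped NNReal

noncomputable section

namespace TRSSN

/-- The space `ℝⁿ` with the Euclidean norm and inner product. -/
abbrev Vec (n : ℕ) := EuclideanSpace ℝ (Fin n)

/-- Real `n × n` matrices, seen as linear operators on Euclidean `ℝⁿ`. The operator norm is the
spectral norm, `ContinuousLinearMap.adjoint` is the transpose, and self-adjoint means symmetric. -/
abbrev Mat (n : ℕ) := Vec n →L[ℝ] Vec n

section Basics

variable {n : ℕ}

/-- Symmetric positive definite matrices. -/
def IsSPD (A : Mat n) : Prop :=
  IsSelfAdjoint A ∧ ∀ x : Vec n, x ≠ 0 → 0 < inner ℝ x (A x)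

/-- The weighted norm `‖x‖_A = √⟨x, A x⟩`. -/
def wnorm (A : Mat n) (x : Vec n) : ℝ := √(inner ℝ x (A x))

/-- The Hessian `∇²f(x)`: the derivative of the gradient of `f`. -/
def hess (f : Vec n → ℝ) (x : Vec n) : Mat n := fderiv ℝ (gradient f) x

/-! ### Extended-valued convex functions -/

/-- Effective domain. -/
def effDom (φ : Vec n → EReal) : Set (Vec n) := {x | φ x < ⊤}

/-- `φ : ℝⁿ → (-∞, +∞]` is convex (convex epigraph), lower semicontinuous and proper. -/
structure IsConvexLscProper (φ : Vec n → EReal) : Prop where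
  ne_bot : ∀ x, φ x ≠ ⊥
  proper : (effDom φ).Nonempty
  convex : Convex ℝ {p : Vec n × ℝ | φ p.1 ≤ (p.2 : EReal)}
  lsc : LowerSemicontinuous φ

/-- The convex subdifferential `∂φ(x)`. -/
def subdiff (φ : Vec n → EReal) (x : Vec n) : Set (Vec n) :=
  {v | x ∈ effDom φ ∧ ∀ y : Vec n, φ x + ((inner ℝ v (y - x) : ℝ) : EReal) ≤ φ y}

/-- The domain of `∂φ`. -/
def subdiffDom (φ : Vec n → EReal) : Set (Vec n) := {x | (subdiff φ x).Nonempty}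

/-- `x` minimizes `y ↦ φ(y) + ½ ‖z - y‖_Λ²`. -/
def IsProxPoint (φ : Vec n → EReal) (Λ : Mat n) (z x : Vec n) : Prop :=
  ∀ y : Vec n, φ x + ((wnorm Λ (z - x) ^ 2 / 2 : ℝ) : EReal)
    ≤ φ y + ((wnorm Λ (z - y) ^ 2 / 2 : ℝ) : EReal)

/-- The proximity operator `prox_φ^Λ`: the minimizer of `y ↦ φ(y) + ½ ‖z - y‖_Λ²`, which exists and
is unique for convex, lower semicontinuous, proper `φ` and symmetric positive definite `Λ`. -/
def prox (φ : Vec n → EReal) (Λ : Mat n) (z : Vec n) : Vec n :=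
  Classical.epsilon (IsProxPoint φ Λ z)

/-! ### Clarke's generalized Jacobian and semismoothness -/

/-- Limits of Jacobians of `F` at points of differentiability converging to `x`. -/
def bouligandSubdiff (F : Vec n → Vec n) (x : Vec n) : Set (Mat n) :=
  {A | ∃ u : ℕ → Vec n, (∀ k, DifferentiableAt ℝ F (u k)) ∧ Tendsto u atTop (𝓝 x) ∧
    Tendsto (fun k => fderiv ℝ F (u k)) atTop (𝓝 A)}

/-- Clarke's generalized Jacobian `∂F(x)` of a locally Lipschitz map `F`. -/
def clarke (F : Vec n → Vec n) (x : Vec n) : Set (Mat n) :=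
  convexHull ℝ (bouligandSubdiff F x)

/-- `F` is Lipschitz continuous near `x` and directionally differentiable at `x`. -/
def LipDirDiffAt (F : Vec n → Vec n) (x : Vec n) : Prop :=
  (∃ K : ℝ≥0, ∃ U ∈ 𝓝 x, LipschitzOnWith K F U) ∧
  ∀ h : Vec n, ∃ d : Vec n,
    Tendsto (fun t : ℝ => t⁻¹ • (F (x + t • h) - F x)) (𝓝[>] 0) (𝓝 d)

/-- Semismoothness at `x`: `sup_{A ∈ ∂F(x+h)} ‖F(x+h) - F(x) - A h‖ = o(‖h‖)` as `h → 0`. -/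
def SemismoothAt (F : Vec n → Vec n) (x : Vec n) : Prop :=
  LipDirDiffAt F x ∧
  ∀ c : ℝ, 0 < c → ∀ᶠ h in 𝓝 (0 : Vec n), ∀ A ∈ clarke F (x + h),
    ‖F (x + h) - F x - A h‖ ≤ c * ‖h‖

/-- `β`-order semismoothness at `x`:
`sup_{A ∈ ∂F(x+h)} ‖F(x+h) - F(x) - A h‖ = O(‖h‖^(1+β))` as `h → 0`. -/
def OrderSemismoothAt (β : ℝ) (F : Vec n → Vec n) (x : Vec n) : Prop :=
  LipDirDiffAt F x ∧
  ∃ c : ℝ, ∀ᶠ h in 𝓝 (0 : Vec n), ∀ A ∈ clarke F (x + h),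
    ‖F (x + h) - F x - A h‖ ≤ c * ‖h‖ ^ (1 + β)

/-! ### Normal map, criticality measure, merit function, predicted reduction -/

/-- The normal map `F_nor(z) = ∇f(prox(z)) + Λ(z - prox(z))`. -/
def normalMap (f : Vec n → ℝ) (φ : Vec n → EReal) (Λ : Mat n) (z : Vec n) : Vec n :=
  gradient f (prox φ Λ z) + Λ (z - prox φ Λ z)

/-- The criticality measure `χ(z) = ‖F_nor(z)‖_{Λ⁻¹}`. -/
def crit (f : Vec n → ℝ) (φ : Vec n → EReal) (Λ : Mat n) (z : Vec n) : ℝ :=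
  wnorm Λ.inverse (normalMap f φ Λ z)

/-- The merit function `H_τ(z) = ψ(prox(z)) + (τ/2) ‖F_nor(z)‖²_{Λ⁻¹}`, `ψ = f + φ`
(`φ` is finite at `prox(z)`). -/
def merit (f : Vec n → ℝ) (φ : Vec n → EReal) (Λ : Mat n) (τ : ℝ) (z : Vec n) : ℝ :=
  f (prox φ Λ z) + (φ (prox φ Λ z)).toReal + τ / 2 * crit f φ Λ z ^ 2

/-- The predicted reduction `pred(z, s, Δ, ν)`. -/
def pred (f : Vec n → ℝ) (φ : Vec n → EReal) (Λ : Mat n) (τ : ℝ) (z s : Vec n) (Δ ν : ℝ) : ℝ :=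
  τ / 2 * crit f φ Λ z * min 1 (min Δ (crit f φ Λ z))
    + ν * crit f φ Λ z / min Δ (crit f φ Λ z) * wnorm Λ (prox φ Λ (z + s) - prox φ Λ z) ^ 2

/-! ### The Steihaug-CG method -/

/-- The quadratic model `m(q) = ⟨g, q⟩ + ½ ⟨q, S q⟩`. -/
def cgModel (S : Mat n) (g q : Vec n) : ℝ := inner ℝ g q + inner ℝ q (S q) / 2

/-- Stopping test on the residual. A vanishing residual ends the method for every tolerance
(including tolerance zero). -/
def CGStop (ε : ℝ) (r : Vec n) : Prop := ‖r‖ < ε ∨ r = 0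

/-- The CG step length `‖r‖² / ⟨p, S p⟩`. -/
def cgStep (S : Mat n) (r p : Vec n) : ℝ := inner ℝ r r / inner ℝ p (S p)

/-- `CGLoop S g ε Δ i q r p out`: the main loop, entered with counter `i`, iterate `q`, residual `r`
and direction `p`, can return `out`. -/
inductive CGLoop (S : Mat n) (g : Vec n) (ε Δ : ℝ) : ℕ → Vec n → Vec n → Vec n → Vec n → Prop
  /-- The loop runs only while `i ≤ n - 1`. -/
  | exhausted (i : ℕ) (q r p : Vec n) (hi : n ≤ i) : CGLoop S g ε Δ i q r p q
  /-- Nonpositive curvature: minimize the model over the two boundary points on the line. -/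
  | negCurv (i : ℕ) (q r p : Vec n) (α : ℝ) (hi : i < n)
      (hcurv : inner ℝ p (S p) ≤ 0) (hα : ‖q + α • p‖ = Δ)
      (hmin : ∀ α' : ℝ, ‖q + α' • p‖ = Δ →
        cgModel S g (q + α • p) ≤ cgModel S g (q + α' • p)) :
      CGLoop S g ε Δ i q r p (q + α • p)
  /-- The CG step leaves the trust region: return the boundary point. -/
  | boundary (i : ℕ) (q r p : Vec n) (α : ℝ) (hi : i < n)
      (hcurv : 0 < inner ℝ p (S p)) (hout : Δ ≤ ‖q + cgStep S r p • p‖)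
      (hα₀ : 0 ≤ α) (hα : ‖q + α • p‖ = Δ) :
      CGLoop S g ε Δ i q r p (q + α • p)
  /-- The new residual is small enough. -/
  | converged (i : ℕ) (q r p : Vec n) (hi : i < n)
      (hcurv : 0 < inner ℝ p (S p)) (hin : ‖q + cgStep S r p • p‖ < Δ)
      (hsmall : CGStop ε (r + cgStep S r p • S p)) :
      CGLoop S g ε Δ i q r p (q + cgStep S r p • p)
  /-- Update residual and direction and continue. -/
  | next (i : ℕ) (q r p q' r' p' out : Vec n) (hi : i < n)
      (hcurv : 0 < inner ℝ p (S p))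
      (hq' : q' = q + cgStep S r p • p) (hr' : r' = r + cgStep S r p • S p)
      (hin : ‖q'‖ < Δ) (hgo : ¬ CGStop ε r')
      (hp' : p' = -r' + (‖r'‖ ^ 2 / ‖r‖ ^ 2) • p)
      (hrec : CGLoop S g ε Δ (i + 1) q' r' p' out) :
      CGLoop S g ε Δ i q r p out

/-- `out` is returned by the Steihaug-CG method with input `S`, `g`, `ε`, `Δ`. -/
def SteihaugCG (S : Mat n) (g : Vec n) (ε Δ : ℝ) (out : Vec n) : Prop :=
  (CGStop ε g ∧ out = 0) ∨ (¬ CGStop ε g ∧ CGLoop S g ε Δ 0 0 g (-g) out)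

end Basics

/-! ### The trust region method -/

/-- Scalar parameters of the trust region method. -/
structure Params where
  τ : ℝ
  η₁ : ℝ
  η₂ : ℝ
  γ₀ : ℝ
  γ₁ : ℝ
  γ₂ : ℝ
  Δmin : ℝ

/-- Admissible parameters. -/
structure Params.Admissible (P : Params) : Prop where
  τ_pos : 0 < P.τ
  τ_lt : P.τ < 1
  η₁_pos : 0 < P.η₁
  η₁_le : P.η₁ ≤ P.η₂
  η₂_lt : P.η₂ < 1
  γ₀_pos : 0 < P.γ₀
  γ₀_lt : P.γ₀ < P.γ₁
  γ₁_lt : P.γ₁ < 1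
  γ₂_gt : 1 < P.γ₂
  Δmin_nonneg : 0 ≤ P.Δmin

/-- The sequences chosen or produced by the method: iterates `z`, Hessian approximations `B`,
generalized derivatives `D`, CG outputs `q`, radii `Δ`, the parameters `ν` of the predicted
reduction and CG tolerances `ε`. -/
structure Trace (n : ℕ) where
  z : ℕ → Vec n
  B : ℕ → Mat n
  D : ℕ → Mat n
  q : ℕ → Vec n
  Δ : ℕ → ℝ
  ν : ℕ → ℝ
  ε : ℕ → ℝ

namespace Trace

variable {n : ℕ}

/-- `x_k = prox(z_k)`. -/
def x (φ : Vec n → EReal) (Λ : Mat n) (T : Trace n) (k : ℕ) : Vec n := prox φ Λ (T.z k)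

/-- `M_k = B_k D_k + Λ (I - D_k)`. -/
def M (Λ : Mat n) (T : Trace n) (k : ℕ) : Mat n :=
  T.B k ∘L T.D k + Λ ∘L (ContinuousLinearMap.id ℝ (Vec n) - T.D k)

/-- The lifted step `s̄_k = q_k - Λ⁻¹ (F_nor(z_k) + M_k q_k)`. -/
def sbar (f : Vec n → ℝ) (φ : Vec n → EReal) (Λ : Mat n) (T : Trace n) (k : ℕ) : Vec n :=
  T.q k - Λ.inverse (normalMap f φ Λ (T.z k) + T.M Λ k (T.q k))

/-- The scaled step `s_k = min {1, Δ_k / ‖s̄_k‖_Λ} s̄_k`. -/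
def s (f : Vec n → ℝ) (φ : Vec n → EReal) (Λ : Mat n) (T : Trace n) (k : ℕ) : Vec n :=
  min 1 (T.Δ k / wnorm Λ (T.sbar f φ Λ k)) • T.sbar f φ Λ k

/-- The reduction ratio `ρ_k`. -/
def rho (f : Vec n → ℝ) (φ : Vec n → EReal) (Λ : Mat n) (P : Params) (T : Trace n) (k : ℕ) : ℝ :=
  (merit f φ Λ P.τ (T.z k) - merit f φ Λ P.τ (T.z k + T.s f φ Λ k)) /
    pred f φ Λ P.τ (T.z k) (T.s f φ Λ k) (T.Δ k) (T.ν k)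

/-- The set of successful iterations. -/
def succSet (f : Vec n → ℝ) (φ : Vec n → EReal) (Λ : Mat n) (P : Params) (T : Trace n) : Set ℕ :=
  {k | P.η₁ ≤ T.rho f φ Λ P k}

/-- The number of successful iterations among `0, …, k - 1`. -/
def nSucc (f : Vec n → ℝ) (φ : Vec n → EReal) (Λ : Mat n) (P : Params) (T : Trace n) (k : ℕ) : ℕ :=
  (T.succSet f φ Λ P ∩ Set.Iio k).ncard

end Trace

/-- `Δ'` is an admissible update of the radius `Δ` for the reduction ratio `ρ`. -/
def RadiusUpdate (P : Params) (ρ Δ Δ' : ℝ) : Prop :=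
  (ρ < P.η₁ → P.γ₀ * Δ < Δ' ∧ Δ' ≤ P.γ₁ * Δ) ∧
  (P.η₁ ≤ ρ → ρ < P.η₂ → P.γ₁ * Δ ≤ Δ' ∧ Δ' ≤ max P.Δmin Δ ∧ P.Δmin ≤ Δ') ∧
  (P.η₂ ≤ ρ → Δ < Δ' ∧ Δ' ≤ max P.Δmin (P.γ₂ * Δ) ∧ P.Δmin ≤ Δ')

/-- `T` is an infinite (never terminating) run of the trust region-type normal map-based semismooth
Newton method. -/
structure IsRun {n : ℕ} (f : Vec n → ℝ) (φ : Vec n → EReal) (Λ : Mat n) (P : Params)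
    (T : Trace n) : Prop where
  noTermination : ∀ k, normalMap f φ Λ (T.z k) ≠ 0
  radius_pos : 0 < T.Δ 0
  tol_nonneg : ∀ k, 0 ≤ T.ε k
  symm : ∀ k, IsSelfAdjoint (T.B k)
  genDeriv : ∀ k, T.D k ∈ clarke (prox φ Λ) (T.z k)
  cg : ∀ k, SteihaugCG (ContinuousLinearMap.adjoint (T.D k) ∘L T.M Λ k)
    (ContinuousLinearMap.adjoint (T.D k) (normalMap f φ Λ (T.z k))) (T.ε k) (T.Δ k) (T.q k)
  reject : ∀ k, T.rho f φ Λ P k < P.η₁ → T.z (k + 1) = T.z k ∧ T.B (k + 1) = T.B k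
  accept : ∀ k, P.η₁ ≤ T.rho f φ Λ P k → T.z (k + 1) = T.z k + T.s f φ Λ k
  radius : ∀ k, RadiusUpdate P (T.rho f φ Λ P k) (T.Δ k) (T.Δ (k + 1))

end TRSSN

end

open TRSSN

/-! The proof shows that, for large `k` with `Δ_k ≥ Δmin`, the unscaled step `s̄_k` is an inexact
semismooth Newton step that contracts the error superlinearly, and that this step passes the ratio
test. An accepted step resets the radius to at least `Δmin`, so one late success propagates to all
later iterations (`eventually_success`).

Global part. If the radius is small compared with `χ`, the merit function decreases by at least the
predicted reduction (`exists_pred_le_merit_sub`). Hence successes occur infinitely often and the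
radius stays above `min{Δmin, cχ}`. Since the merit function is continuous and decreasing, its
decrements vanish, which forces `F(z̄) = 0`.

Newton part. Every `D ∈ ∂prox(z)` has `ΛD` symmetric, because `z - prox(z)` is, up to `Λ`, the
gradient of the Moreau envelope. So `S = DᵀM` is symmetric, and positive semidefiniteness of `S`
with invertibility of `M` makes it positive definite on its range, which contains `g`. CG then
behaves classically: iterates grow in norm and stay below `‖M⁻¹F‖`, so for small `F` no truncation
occurs and the residual is at most `ε_k`. The lifted step inherits this residual. Semismoothness,
the Dennis-Moré condition and Taylor expansion of `∇f` yield `M_k(z_k - z̄) = F(z_k) + o(‖z_k -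
z̄‖)`; bounded inverses finish the estimate.

Acceptance part. Although `ψ ∘ prox` need not be twice differentiable, it has a second-order
expansion at `z̄` whose quadratic term along the iterates is `½⟨v, DᵀMv⟩ ≥ 0` up to `o(‖v‖²)`, `v =
z_k - z̄`. So the merit gap is at least `(τ/2)χ² - o(‖v‖²)`, while at the Newton point it is
`o(‖v‖²)`. The remaining obstacle is the `ν_k` term: the merit gap contracts by a fixed factor per
success, so `‖v‖²` decays geometrically in the number of successes and beats the polynomial growth
of `a_k²`; thus `ν_k → 0` along such iterations and the ratio exceeds `η₁`. -/

namespace TRSSN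

/-! ### The norm induced by a symmetric positive definite matrix. -/

section WeightedNorm

variable {n : ℕ} {Λ : Mat n}

theorem IsSPD.inner_comm (hΛ : IsSPD Λ) (x y : Vec n) :
    inner ℝ x (Λ y) = inner ℝ (Λ x) y := by
  have h := ContinuousLinearMap.adjoint_inner_right Λ x y
  rwa [(ContinuousLinearMap.isSelfAdjoint_iff').1 hΛ.1] at h

theorem IsSPD.inner_nonneg (hΛ : IsSPD Λ) (x : Vec n) : 0 ≤ inner ℝ x (Λ x) := by
  rcases eq_or_ne x 0 with rfl | h
  · simp
  · exact (hΛ.2 x h).le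

theorem IsSPD.isInvertible (hΛ : IsSPD Λ) : Λ.IsInvertible := by
  have hinj : Function.Injective (Λ : Vec n →ₗ[ℝ] Vec n) := by
    rw [injective_iff_map_eq_zero]
    intro x hx
    by_contra h
    have h1 := hΛ.2 x h
    have h2 : Λ x = 0 := hx
    simp [h2] at h1
  exact ⟨(LinearEquiv.ofInjectiveEndo _ hinj).toContinuousLinearEquiv, by ext x; rfl⟩

theorem IsSPD.apply_inverse (hΛ : IsSPD Λ) (x : Vec n) : Λ (Λ.inverse x) = x :=
  hΛ.isInvertible.self_apply_inverse x

theorem IsSPD.inverse_apply (hΛ : IsSPD Λ) (x : Vec n) : Λ.inverse (Λ x) = x :=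
  hΛ.isInvertible.inverse_apply_self x

/-- Stated for a bare vector space so that the norm built from the core cannot clash with the
Euclidean norm already present on `Vec n`. -/
theorem exists_embedding_of_core {V : Type} [AddCommGroup V] [Module ℝ V]
    (c : InnerProductSpace.Core ℝ V) :
    ∃ (E : Type) (_ : NormedAddCommGroup E) (_ : InnerProductSpace ℝ E) (J : V →ₗ[ℝ] E),
      ∀ x y, inner ℝ (J x) (J y) = c.inner x y := by
  let i1 : NormedAddCommGroup V := c.toNormedAddCommGroup
  let i2 : InnerProductSpace ℝ V := InnerProductSpace.ofCore c.toCore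
  exact ⟨V, i1, i2, LinearMap.id, fun _ _ => rfl⟩

/-- The inner product `⟨x, Λ y⟩` is realized by a linear embedding into an inner product space. -/
theorem IsSPD.exists_embedding (hΛ : IsSPD Λ) :
    ∃ (E : Type) (_ : NormedAddCommGroup E) (_ : InnerProductSpace ℝ E) (J : Vec n →ₗ[ℝ] E),
      ∀ x y, inner ℝ (J x) (J y) = inner ℝ x (Λ y) :=
  exists_embedding_of_core
    { inner := fun x y => inner ℝ x (Λ y)
      conj_inner_symm := fun x y => by
        simp only [conj_trivial]
        rw [hΛ.inner_comm, real_inner_comm]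
      re_inner_nonneg := fun x => hΛ.inner_nonneg x
      add_left := fun x y z => inner_add_left _ _ _
      smul_left := fun x y r => inner_smul_left _ _ _
      definite := fun x hx => by
        by_contra h
        exact (hΛ.2 x h).ne' hx }

theorem IsSPD.wnorm_sq (hΛ : IsSPD Λ) (x : Vec n) : wnorm Λ x ^ 2 = inner ℝ x (Λ x) :=
  Real.sq_sqrt (hΛ.inner_nonneg x)

theorem wnorm_nonneg (A : Mat n) (x : Vec n) : 0 ≤ wnorm A x := Real.sqrt_nonneg _

theorem wnorm_eq_norm_of_embedding {E : Type*} [NormedAddCommGroup E] [InnerProductSpace ℝ E]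
    {J : Vec n →ₗ[ℝ] E} (hJ : ∀ x y, inner ℝ (J x) (J y) = inner ℝ x (Λ y)) (x : Vec n) :
    wnorm Λ x = ‖J x‖ := by
  rw [wnorm, ← hJ, real_inner_self_eq_norm_sq, Real.sqrt_sq (norm_nonneg _)]

theorem IsSPD.abs_inner_le (hΛ : IsSPD Λ) (x y : Vec n) :
    |inner ℝ x (Λ y)| ≤ wnorm Λ x * wnorm Λ y := by
  obtain ⟨E, _, _, J, hJ⟩ := hΛ.exists_embedding
  rw [wnorm_eq_norm_of_embedding hJ, wnorm_eq_norm_of_embedding hJ, ← hJ]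
  exact abs_real_inner_le_norm _ _

theorem IsSPD.wnorm_smul (hΛ : IsSPD Λ) (c : ℝ) (x : Vec n) :
    wnorm Λ (c • x) = |c| * wnorm Λ x := by
  obtain ⟨E, _, _, J, hJ⟩ := hΛ.exists_embedding
  rw [wnorm_eq_norm_of_embedding hJ, wnorm_eq_norm_of_embedding hJ, map_smul, norm_smul,
    Real.norm_eq_abs]

theorem IsSPD.wnorm_pos (hΛ : IsSPD Λ) {x : Vec n} (hx : x ≠ 0) : 0 < wnorm Λ x :=
  Real.sqrt_pos.2 (hΛ.2 x hx)

theorem wnorm_le (A : Mat n) (x : Vec n) : wnorm A x ≤ √‖A‖ * ‖x‖ := by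
  rw [wnorm, ← Real.sqrt_sq (norm_nonneg x), ← Real.sqrt_mul (norm_nonneg A)]
  apply Real.sqrt_le_sqrt
  calc inner ℝ x (A x) ≤ ‖x‖ * ‖A x‖ := real_inner_le_norm _ _
    _ ≤ ‖x‖ * (‖A‖ * ‖x‖) := by gcongr; exact A.le_opNorm x
    _ = ‖A‖ * ‖x‖ ^ 2 := by ring

theorem IsSPD.wnorm_inverse (hΛ : IsSPD Λ) (x : Vec n) :
    wnorm Λ.inverse x = wnorm Λ (Λ.inverse x) := by
  rw [wnorm, wnorm, hΛ.apply_inverse, real_inner_comm]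

/-- Cauchy-Schwarz for the `Λ`-inner product of `Λ⁻¹x` and `x` gives `‖x‖² ≤ ‖Λ⁻¹x‖_Λ ‖x‖_Λ`.
Squaring, bounding `‖Λ⁻¹x‖_Λ² = ‖x‖_{Λ⁻¹}²` by `‖Λ⁻¹‖ ‖x‖²` and cancelling leaves the sharp constant
`‖Λ⁻¹‖ = 1/λ_m` that the condition on `τ` requires. -/
theorem IsSPD.norm_sq_le (hΛ : IsSPD Λ) (x : Vec n) :
    ‖x‖ ^ 2 ≤ ‖Λ.inverse‖ * wnorm Λ x ^ 2 := by
  rcases eq_or_ne x 0 with rfl | h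
  · rw [norm_zero, zero_pow two_ne_zero]
    exact mul_nonneg (norm_nonneg _) (sq_nonneg _)
  have h1 : ‖x‖ ^ 2 ≤ wnorm Λ (Λ.inverse x) * wnorm Λ x := by
    have := hΛ.abs_inner_le (Λ.inverse x) x
    rw [hΛ.inner_comm, hΛ.apply_inverse, real_inner_self_eq_norm_sq] at this
    exact (le_abs_self _).trans this
  have h2 : wnorm Λ (Λ.inverse x) ^ 2 ≤ ‖Λ.inverse‖ * ‖x‖ ^ 2 := by
    rw [← hΛ.wnorm_inverse]
    have := wnorm_le Λ.inverse x
    calc wnorm Λ.inverse x ^ 2 ≤ (√‖Λ.inverse‖ * ‖x‖) ^ 2 := by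
          gcongr; exact wnorm_nonneg _ _
      _ = _ := by rw [mul_pow, Real.sq_sqrt (norm_nonneg _)]
  have h3 : 0 < ‖x‖ ^ 2 := by positivity
  have h4 : ‖x‖ ^ 2 * ‖x‖ ^ 2 ≤ ‖x‖ ^ 2 * (‖Λ.inverse‖ * wnorm Λ x ^ 2) := by
    calc ‖x‖ ^ 2 * ‖x‖ ^ 2
      _ ≤ (wnorm Λ (Λ.inverse x) * wnorm Λ x) * (wnorm Λ (Λ.inverse x) * wnorm Λ x) := by
          have := mul_nonneg (wnorm_nonneg Λ (Λ.inverse x)) (wnorm_nonneg Λ x)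
          gcongr
      _ = wnorm Λ (Λ.inverse x) ^ 2 * wnorm Λ x ^ 2 := by ring
      _ ≤ (‖Λ.inverse‖ * ‖x‖ ^ 2) * wnorm Λ x ^ 2 := by gcongr
      _ = _ := by ring
  exact le_of_mul_le_mul_left h4 h3

theorem IsSPD.norm_le (hΛ : IsSPD Λ) (x : Vec n) : ‖x‖ ≤ √‖Λ.inverse‖ * wnorm Λ x := by
  rw [← Real.sqrt_sq (norm_nonneg x), ← Real.sqrt_sq (wnorm_nonneg Λ x),
    ← Real.sqrt_mul (norm_nonneg _)]
  exact Real.sqrt_le_sqrt (hΛ.norm_sq_le x)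

theorem continuous_wnorm (A : Mat n) : Continuous (wnorm A) := by
  unfold wnorm
  fun_prop

end WeightedNorm

/-! ### The proximity operator and the Moreau envelope. -/

section Prox

variable {n : ℕ} {φ : Vec n → EReal} {Λ : Mat n}

theorem IsConvexLscProper.coe_toReal (hφ : IsConvexLscProper φ) {x : Vec n}
    (hx : x ∈ effDom φ) : ((φ x).toReal : EReal) = φ x :=
  EReal.coe_toReal (ne_of_lt hx) (hφ.ne_bot x)

theorem IsConvexLscProper.apply_convexComb_le (hφ : IsConvexLscProper φ) {x y : Vec n}
    (hx : x ∈ effDom φ) (hy : y ∈ effDom φ) {a b : ℝ} (ha : 0 ≤ a) (hb : 0 ≤ b)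
    (hab : a + b = 1) :
    φ (a • x + b • y) ≤ ((a * (φ x).toReal + b * (φ y).toReal : ℝ) : EReal) := by
  have h1 : (x, (φ x).toReal) ∈ {p : Vec n × ℝ | φ p.1 ≤ (p.2 : EReal)} :=
    (hφ.coe_toReal hx).ge
  have h2 : (y, (φ y).toReal) ∈ {p : Vec n × ℝ | φ p.1 ≤ (p.2 : EReal)} :=
    (hφ.coe_toReal hy).ge
  have h := hφ.convex h1 h2 ha hb hab
  simpa using h

theorem IsConvexLscProper.convex_effDom (hφ : IsConvexLscProper φ) : Convex ℝ (effDom φ) := by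
  intro x hx y hy a b ha hb hab
  exact (hφ.apply_convexComb_le hx hy ha hb hab).trans_lt (EReal.coe_lt_top _)

theorem IsConvexLscProper.toReal_convexComb_le (hφ : IsConvexLscProper φ) {x y : Vec n}
    (hx : x ∈ effDom φ) (hy : y ∈ effDom φ) {a b : ℝ} (ha : 0 ≤ a) (hb : 0 ≤ b)
    (hab : a + b = 1) :
    (φ (a • x + b • y)).toReal ≤ a * (φ x).toReal + b * (φ y).toReal := by
  have h := hφ.apply_convexComb_le hx hy ha hb hab
  rw [← hφ.coe_toReal (hφ.convex_effDom hx hy ha hb hab)] at h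
  exact_mod_cast h

/-- A convex function decreases at most linearly away from a point of its domain. -/
theorem IsConvexLscProper.exists_linear_lower_bound (hφ : IsConvexLscProper φ) {y₀ : Vec n}
    (hy₀ : y₀ ∈ effDom φ) :
    ∃ c : ℝ, 0 ≤ c ∧ ∀ y ∈ effDom φ,
      (φ y₀).toReal - c * (1 + ‖y - y₀‖) ≤ (φ y).toReal := by
  obtain ⟨a, ha, hmin⟩ := LowerSemicontinuousOn.exists_isMinOn
    (s := Metric.closedBall y₀ 1) ⟨y₀, by simp⟩ (isCompact_closedBall _ _)
    (hφ.lsc.lowerSemicontinuousOn _)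
  have hmin' : ∀ y ∈ Metric.closedBall y₀ 1, φ a ≤ φ y := fun y hy => hmin hy
  have had : a ∈ effDom φ := (hmin' y₀ (by simp)).trans_lt hy₀
  have hreal : ∀ y ∈ effDom φ, ‖y - y₀‖ ≤ 1 → (φ a).toReal ≤ (φ y).toReal := by
    intro y hy hn
    have := hmin' y (by simpa [dist_eq_norm] using hn)
    rw [← hφ.coe_toReal had, ← hφ.coe_toReal hy] at this
    exact_mod_cast this
  have hc : 0 ≤ (φ y₀).toReal - (φ a).toReal := sub_nonneg.2 (hreal y₀ hy₀ (by simp))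
  refine ⟨(φ y₀).toReal - (φ a).toReal, hc, fun y hy => ?_⟩
  set r := ‖y - y₀‖ with hr
  have hr0 : 0 ≤ r := norm_nonneg _
  rcases le_total r 1 with h1 | h1
  · have := hreal y hy h1
    nlinarith
  · have hrpos : 0 < r := by linarith
    have hinv : r⁻¹ ≤ 1 := inv_le_one_of_one_le₀ h1
    have hinv0 : 0 ≤ r⁻¹ := by positivity
    -- The point at distance 1 from `y₀` towards `y` lies in the ball where `φ a` is minimal;
    -- convexity carries that bound out to `y`.
    have hcomb := hφ.toReal_convexComb_le hy₀ hy (sub_nonneg.2 hinv) hinv0 (by ring)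
    have hmem := hφ.convex_effDom hy₀ hy (sub_nonneg.2 hinv) hinv0 (by ring)
    have h2 := hreal _ hmem (by
      have : (1 - r⁻¹) • y₀ + r⁻¹ • y - y₀ = r⁻¹ • (y - y₀) := by module
      rw [this, norm_smul, Real.norm_eq_abs, abs_of_nonneg hinv0, ← hr,
        inv_mul_cancel₀ hrpos.ne'])
    have h3 : r * (φ a).toReal ≤ r * ((1 - r⁻¹) * (φ y₀).toReal + r⁻¹ * (φ y).toReal) :=
      mul_le_mul_of_nonneg_left (h2.trans hcomb) hr0
    have h4 : r * ((1 - r⁻¹) * (φ y₀).toReal + r⁻¹ * (φ y).toReal)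
        = (r - 1) * (φ y₀).toReal + (φ y).toReal := by
      field_simp
    nlinarith

/-- The proximal objective is lower semicontinuous, and outside a large ball its quadratic term
outweighs the at most linear decrease of `φ`, so a minimizer over the ball is global. -/
theorem exists_isProxPoint (hφ : IsConvexLscProper φ) (hΛ : IsSPD Λ) (z : Vec n) :
    ∃ x, IsProxPoint φ Λ z x := by
  obtain ⟨y₀, hy₀⟩ := hφ.proper
  obtain ⟨c, hc, hlow⟩ := hφ.exists_linear_lower_bound hy₀
  set κ := ‖Λ.inverse‖ + 1 with hκ
  have hκpos : 0 < κ := by positivity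
  have hw : ∀ x : Vec n, ‖x‖ ^ 2 ≤ κ * wnorm Λ x ^ 2 := fun x => by
    have := hΛ.norm_sq_le x
    nlinarith [sq_nonneg (wnorm Λ x)]
  set A := wnorm Λ (z - y₀) ^ 2 / 2 with hA
  have hA0 : 0 ≤ A := by positivity
  set b := ‖z - y₀‖ with hb
  have hb0 : 0 ≤ b := norm_nonneg _
  -- Chosen so that `u = ‖y - y₀‖ - b > t` gives `2κ(c(1 + ‖y - y₀‖) + A) ≤ (t - 1)u ≤ u²`; the
  -- summand 1 ensures `u ≥ 1`.
  set t := 2 * κ * (c * (2 + b) + A) + 1 with ht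
  have ht1 : 1 ≤ t := by
    have : 0 ≤ 2 * κ * (c * (2 + b) + A) := by positivity
    linarith
  have hlsc : LowerSemicontinuous
      fun y => φ y + ((wnorm Λ (z - y) ^ 2 / 2 : ℝ) : EReal) := by
    refine LowerSemicontinuous.add' hφ.lsc ?_ ?_
    · have h1 : Continuous fun y : Vec n => wnorm Λ (z - y) ^ 2 / 2 :=
        (((continuous_wnorm Λ).comp (continuous_const.sub continuous_id)).pow 2).div_const 2
      exact (continuous_coe_real_ereal.comp h1).lowerSemicontinuous
    · intro x
      exact EReal.continuousAt_add (Or.inr (EReal.coe_ne_bot _)) (Or.inr (EReal.coe_ne_top _))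
  obtain ⟨a, ha, hmin⟩ := LowerSemicontinuousOn.exists_isMinOn
    (s := Metric.closedBall y₀ (b + t)) ⟨y₀, by simp; linarith⟩ (isCompact_closedBall _ _)
    (hlsc.lowerSemicontinuousOn _)
  refine ⟨a, fun y => ?_⟩
  by_cases hy : y ∈ Metric.closedBall y₀ (b + t)
  · exact hmin hy
  have h0 : φ a + ((wnorm Λ (z - a) ^ 2 / 2 : ℝ) : EReal)
      ≤ φ y₀ + ((wnorm Λ (z - y₀) ^ 2 / 2 : ℝ) : EReal) :=
    hmin (show y₀ ∈ Metric.closedBall y₀ (b + t) by simp; linarith)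
  refine h0.trans ?_
  by_cases hyd : y ∈ effDom φ
  · rw [← hφ.coe_toReal hyd, ← hφ.coe_toReal hy₀]
    norm_cast
    have hl := hlow y hyd
    have hy' : b + t < ‖y - y₀‖ := by simpa [dist_eq_norm] using hy
    set r := ‖y - y₀‖ with hr
    have htri : r ≤ ‖z - y‖ + b := by
      have : y - y₀ = -(z - y) + (z - y₀) := by abel
      rw [hr, this]
      exact (norm_add_le _ _).trans (by rw [norm_neg])
    set u := r - b with hu
    have hut : t < u := by linarith
    have h1 : u ^ 2 ≤ κ * wnorm Λ (z - y) ^ 2 := by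
      refine le_trans ?_ (hw _)
      have : u ≤ ‖z - y‖ := by linarith
      exact pow_le_pow_left₀ (by linarith) this 2
    have h2 : 2 * κ * (c * (1 + r) + A) ≤ u ^ 2 := by
      have h3 : c * (1 + r) + A ≤ (c * (2 + b) + A) * u := by
        have e1 : r = u + b := by linarith
        have e2 : 0 ≤ u - 1 := by linarith
        have e3 := mul_nonneg hc (mul_nonneg hb0 e2)
        have e4 := mul_nonneg hA0 e2
        have e5 := mul_nonneg hc e2
        rw [e1]
        nlinarith
      calc 2 * κ * (c * (1 + r) + A) ≤ 2 * κ * ((c * (2 + b) + A) * u) := by gcongr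
        _ = (t - 1) * u := by rw [ht]; ring
        _ ≤ u ^ 2 := by nlinarith
    have h3 : 2 * (c * (1 + r) + A) ≤ wnorm Λ (z - y) ^ 2 := by
      have := h2.trans h1
      have h4 : κ * (2 * (c * (1 + r) + A)) ≤ κ * wnorm Λ (z - y) ^ 2 := by linarith
      exact le_of_mul_le_mul_left h4 hκpos
    linarith
  · have : φ y = ⊤ := not_lt_top_iff.1 hyd
    rw [this, EReal.top_add_of_ne_bot (EReal.coe_ne_bot _)]
    exact le_top

theorem isProxPoint_prox (hφ : IsConvexLscProper φ) (hΛ : IsSPD Λ) (z : Vec n) :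
    IsProxPoint φ Λ z (prox φ Λ z) :=
  Classical.epsilon_spec (exists_isProxPoint hφ hΛ z)

theorem prox_mem_effDom (hφ : IsConvexLscProper φ) (hΛ : IsSPD Λ) (z : Vec n) :
    prox φ Λ z ∈ effDom φ := by
  obtain ⟨y₀, hy₀⟩ := hφ.proper
  have h := isProxPoint_prox hφ hΛ z y₀
  by_contra hx
  have : φ (prox φ Λ z) = ⊤ := not_lt_top_iff.1 hx
  rw [this, EReal.top_add_of_ne_bot (EReal.coe_ne_bot _), ← hφ.coe_toReal hy₀] at h
  norm_cast at h

theorem prox_minimal (hφ : IsConvexLscProper φ) (hΛ : IsSPD Λ) (z : Vec n) {y : Vec n}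
    (hy : y ∈ effDom φ) :
    (φ (prox φ Λ z)).toReal + wnorm Λ (z - prox φ Λ z) ^ 2 / 2
      ≤ (φ y).toReal + wnorm Λ (z - y) ^ 2 / 2 := by
  have h := isProxPoint_prox hφ hΛ z y
  rw [← hφ.coe_toReal hy, ← hφ.coe_toReal (prox_mem_effDom hφ hΛ z)] at h
  exact_mod_cast h

theorem IsSPD.wnorm_sub_smul_sq (hΛ : IsSPD Λ) (u v : Vec n) (t : ℝ) :
    wnorm Λ (u - t • v) ^ 2
      = wnorm Λ u ^ 2 - 2 * t * inner ℝ v (Λ u) + t ^ 2 * wnorm Λ v ^ 2 := by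
  have h : inner ℝ u (Λ v) = inner ℝ v (Λ u) := by rw [hΛ.inner_comm, real_inner_comm]
  simp only [hΛ.wnorm_sq, map_sub, map_smul, inner_sub_left, inner_sub_right, inner_smul_left,
    inner_smul_right, conj_trivial, h]
  ring

theorem IsSPD.wnorm_sub_sq (hΛ : IsSPD Λ) (u v : Vec n) :
    wnorm Λ (u - v) ^ 2 = wnorm Λ u ^ 2 - 2 * inner ℝ v (Λ u) + wnorm Λ v ^ 2 := by
  have := hΛ.wnorm_sub_smul_sq u v 1
  simpa using this

/-- `Λ (z - prox z)` is a subgradient of `φ` at `prox z`. -/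
theorem prox_subgradient (hφ : IsConvexLscProper φ) (hΛ : IsSPD Λ) (z : Vec n) {y : Vec n}
    (hy : y ∈ effDom φ) :
    (φ (prox φ Λ z)).toReal + inner ℝ (y - prox φ Λ z) (Λ (z - prox φ Λ z))
      ≤ (φ y).toReal := by
  set x := prox φ Λ z with hxdef
  have hx : x ∈ effDom φ := prox_mem_effDom hφ hΛ z
  -- Minimality against the point `(1-t)x + ty`, divided by `t`; the error is of order `t` and
  -- vanishes as `t ↓ 0`.
  have key : ∀ t : ℝ, 0 < t → t ≤ 1 →
      (φ x).toReal + inner ℝ (y - x) (Λ (z - x)) - (φ y).toReal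
        ≤ t * (wnorm Λ (y - x) ^ 2 / 2) := by
    intro t ht0 ht1
    have hmem := hφ.convex_effDom hx hy (sub_nonneg.2 ht1) ht0.le (by ring)
    have h1 := prox_minimal hφ hΛ z hmem
    have h2 := hφ.toReal_convexComb_le hx hy (sub_nonneg.2 ht1) ht0.le (by ring)
    have h3 : z - ((1 - t) • x + t • y) = (z - x) - t • (y - x) := by module
    rw [h3, hΛ.wnorm_sub_smul_sq, ← hxdef] at h1
    have h4 : t * ((φ x).toReal + inner ℝ (y - x) (Λ (z - x)) - (φ y).toReal)
        ≤ t * (t * (wnorm Λ (y - x) ^ 2 / 2)) := by nlinarith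
    exact le_of_mul_le_mul_left h4 ht0
  by_contra hcon
  set a := (φ x).toReal + inner ℝ (y - x) (Λ (z - x)) - (φ y).toReal with ha
  set b := wnorm Λ (y - x) ^ 2 / 2 with hb
  have hapos : 0 < a := by rw [ha]; linarith
  have hb0 : 0 ≤ b := by positivity
  have hl : Tendsto (fun t : ℝ => t * b) (𝓝[>] 0) (𝓝 (0 * b)) :=
    (tendsto_id.mul_const b).mono_left nhdsWithin_le_nhds
  rw [zero_mul] at hl
  have : a ≤ 0 := by
    refine ge_of_tendsto hl ?_
    filter_upwards [Ioc_mem_nhdsGT (zero_lt_one' ℝ)] with t ht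
    exact key t ht.1 ht.2
  linarith

/-- Firm nonexpansiveness of the proximity operator. -/
theorem prox_firmly_nonexpansive (hφ : IsConvexLscProper φ) (hΛ : IsSPD Λ) (z z' : Vec n) :
    wnorm Λ (prox φ Λ z' - prox φ Λ z) ^ 2
      ≤ inner ℝ (prox φ Λ z' - prox φ Λ z) (Λ (z' - z)) := by
  have h1 := prox_subgradient hφ hΛ z (prox_mem_effDom hφ hΛ z')
  have h2 := prox_subgradient hφ hΛ z' (prox_mem_effDom hφ hΛ z)
  set x := prox φ Λ z
  set x' := prox φ Λ z'
  have e1 : inner ℝ (x - x') (Λ (z' - x')) = - inner ℝ (x' - x) (Λ (z' - x')) := by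
    rw [← inner_neg_left, neg_sub]
  have e2 : inner ℝ (x' - x) (Λ (z' - z))
      = inner ℝ (x' - x) (Λ (z' - x')) - inner ℝ (x' - x) (Λ (z - x)) + wnorm Λ (x' - x) ^ 2 := by
    rw [hΛ.wnorm_sq, ← inner_sub_right, ← inner_add_right, ← map_sub, ← map_add]
    congr 2
    abel
  rw [e1] at h2
  rw [e2]
  linarith

theorem wnorm_prox_sub_le (hφ : IsConvexLscProper φ) (hΛ : IsSPD Λ) (z z' : Vec n) :
    wnorm Λ (prox φ Λ z' - prox φ Λ z) ≤ wnorm Λ (z' - z) := by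
  have h1 := prox_firmly_nonexpansive hφ hΛ z z'
  have h2 := (le_abs_self _).trans (hΛ.abs_inner_le (prox φ Λ z' - prox φ Λ z) (z' - z))
  have h3 := wnorm_nonneg Λ (prox φ Λ z' - prox φ Λ z)
  have h4 := wnorm_nonneg Λ (z' - z)
  by_contra hcon
  nlinarith

theorem exists_norm_prox_sub_le (hφ : IsConvexLscProper φ) (hΛ : IsSPD Λ) :
    ∃ K : ℝ, 0 ≤ K ∧ ∀ z z' : Vec n, ‖prox φ Λ z' - prox φ Λ z‖ ≤ K * ‖z' - z‖ := by
  refine ⟨√‖Λ.inverse‖ * √‖Λ‖, by positivity, fun z z' => ?_⟩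
  calc ‖prox φ Λ z' - prox φ Λ z‖ ≤ √‖Λ.inverse‖ * wnorm Λ (prox φ Λ z' - prox φ Λ z) :=
        hΛ.norm_le _
    _ ≤ √‖Λ.inverse‖ * (√‖Λ‖ * ‖z' - z‖) := by
        gcongr
        exact (wnorm_prox_sub_le hφ hΛ z z').trans (wnorm_le _ _)
    _ = _ := by ring

theorem continuous_prox (hφ : IsConvexLscProper φ) (hΛ : IsSPD Λ) :
    Continuous (prox φ Λ) := by
  obtain ⟨K, hK, h⟩ := exists_norm_prox_sub_le hφ hΛ
  refine (LipschitzWith.of_dist_le_mul (K := ⟨K, hK⟩) fun x y => ?_).continuous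
  rw [dist_eq_norm, dist_eq_norm]
  exact h y x

/-- The Moreau envelope. -/
noncomputable def envelope (φ : Vec n → EReal) (Λ : Mat n) (z : Vec n) : ℝ :=
  (φ (prox φ Λ z)).toReal + wnorm Λ (z - prox φ Λ z) ^ 2 / 2

/-- `prox z` serves as a competitor in the minimization defining the envelope at `z'`. -/
theorem envelope_sub_le (hφ : IsConvexLscProper φ) (hΛ : IsSPD Λ) (z z' : Vec n) :
    envelope φ Λ z' - envelope φ Λ z
      ≤ inner ℝ (Λ (z - prox φ Λ z)) (z' - z) + wnorm Λ (z' - z) ^ 2 / 2 := by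
  have h := prox_minimal hφ hΛ z' (prox_mem_effDom hφ hΛ z)
  have e : z' - prox φ Λ z = (z - prox φ Λ z) - (z - z') := by abel
  rw [e, hΛ.wnorm_sub_sq (z - prox φ Λ z)] at h
  have e2 : inner ℝ (z - z') (Λ (z - prox φ Λ z)) = - inner ℝ (Λ (z - prox φ Λ z)) (z' - z) := by
    rw [← neg_sub z' z, inner_neg_left, real_inner_comm]
  have e3 : wnorm Λ (z - z') = wnorm Λ (z' - z) := by
    rw [← neg_sub z' z, ← neg_one_smul ℝ, hΛ.wnorm_smul]; simp
  rw [e2, e3] at h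
  unfold envelope
  linarith

/-- The upper estimate `envelope_sub_le`, used with both orders of `z` and `z'` and combined with
nonexpansiveness, is a two-sided bound of order `‖z' - z‖²`. -/
theorem hasGradientAt_envelope (hφ : IsConvexLscProper φ) (hΛ : IsSPD Λ) (z : Vec n) :
    HasGradientAt (envelope φ Λ) (Λ (z - prox φ Λ z)) z := by
  rw [hasGradientAt_iff_isLittleO]
  have hbound : ∀ z', |envelope φ Λ z' - envelope φ Λ z
      - inner ℝ (Λ (z - prox φ Λ z)) (z' - z)| ≤ ‖Λ‖ * ‖z' - z‖ ^ 2 := by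
    intro z'
    have h1 := envelope_sub_le hφ hΛ z z'
    have h2 := envelope_sub_le hφ hΛ z' z
    have hw : wnorm Λ (z' - z) ^ 2 ≤ ‖Λ‖ * ‖z' - z‖ ^ 2 := by
      calc wnorm Λ (z' - z) ^ 2 ≤ (√‖Λ‖ * ‖z' - z‖) ^ 2 := by
            gcongr
            · exact wnorm_nonneg _ _
            · exact wnorm_le _ _
        _ = _ := by rw [mul_pow, Real.sq_sqrt (norm_nonneg _)]
    have e3 : wnorm Λ (z - z') = wnorm Λ (z' - z) := by
      rw [← neg_sub z' z, ← neg_one_smul ℝ, hΛ.wnorm_smul]; simp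
    have e4 : inner ℝ (Λ (z' - prox φ Λ z')) (z - z')
        = - inner ℝ (Λ (z - prox φ Λ z)) (z' - z) - wnorm Λ (z' - z) ^ 2
          + inner ℝ (z' - z) (Λ (prox φ Λ z' - prox φ Λ z)) := by
      have e5 : Λ (z' - prox φ Λ z')
          = Λ (z - prox φ Λ z) + Λ (z' - z) - Λ (prox φ Λ z' - prox φ Λ z) := by
        simp only [map_sub]; abel
      rw [e5, ← neg_sub z' z, inner_neg_right, inner_sub_left, inner_add_left, hΛ.wnorm_sq,
        real_inner_comm (Λ (z' - z)), real_inner_comm (Λ (prox φ Λ z' - prox φ Λ z))]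
      ring
    have h5 : |inner ℝ (z' - z) (Λ (prox φ Λ z' - prox φ Λ z))| ≤ wnorm Λ (z' - z) ^ 2 := by
      refine (hΛ.abs_inner_le _ _).trans ?_
      rw [sq]
      exact mul_le_mul_of_nonneg_left (wnorm_prox_sub_le hφ hΛ z z') (wnorm_nonneg _ _)
    have h6 := (abs_le.1 h5).2
    have h7 := sq_nonneg (wnorm Λ (z' - z))
    rw [e3, e4] at h2
    rw [abs_le]
    constructor <;> linarith
  refine IsBigO.trans_isLittleO (g := fun z' => ‖z' - z‖ ^ 2) ?_ ?_
  · refine IsBigO.of_bound ‖Λ‖ (Eventually.of_forall fun z' => ?_)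
    rw [Real.norm_eq_abs, Real.norm_eq_abs, abs_of_nonneg (sq_nonneg ‖z' - z‖)]
    exact hbound z'
  · have h := isLittleO_pow_sub_sub z (one_lt_two)
    exact h

end Prox

/-! ### Generalized derivatives of the proximity operator. -/

section ClarkeProx

variable {n : ℕ} {φ : Vec n → EReal} {Λ : Mat n}

theorem IsSPD.wnorm_add_le (hΛ : IsSPD Λ) (x y : Vec n) :
    wnorm Λ (x + y) ≤ wnorm Λ x + wnorm Λ y := by
  obtain ⟨E, _, _, J, hJ⟩ := hΛ.exists_embedding
  simp only [wnorm_eq_norm_of_embedding hJ, map_add]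
  exact norm_add_le _ _

theorem wnorm_fderiv_prox_le (hφ : IsConvexLscProper φ) (hΛ : IsSPD Λ) {z : Vec n}
    (hd : DifferentiableAt ℝ (prox φ Λ) z) (v : Vec n) :
    wnorm Λ (fderiv ℝ (prox φ Λ) z v) ≤ wnorm Λ v := by
  have h := (hd.hasFDerivAt.hasLineDerivAt v).tendsto_slope_zero_right
  have h2 := ((continuous_wnorm Λ).tendsto _).comp h
  refine le_of_tendsto h2 ?_
  filter_upwards [self_mem_nhdsWithin] with t ht
  have ht : (0 : ℝ) < t := ht
  simp only [Function.comp_apply]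
  rw [hΛ.wnorm_smul, abs_of_pos (inv_pos.2 ht)]
  have h3 := wnorm_prox_sub_le hφ hΛ z (z + t • v)
  rw [add_sub_cancel_left, hΛ.wnorm_smul, abs_of_pos ht] at h3
  rw [inv_mul_le_iff₀ ht]
  exact h3

/-- `Λ(I - prox'(z))` is the second derivative of the Moreau envelope, hence symmetric. -/
theorem inner_fderiv_prox_symm (hφ : IsConvexLscProper φ) (hΛ : IsSPD Λ) {z : Vec n}
    (hd : DifferentiableAt ℝ (prox φ Λ) z) (u v : Vec n) :
    inner ℝ u (Λ (fderiv ℝ (prox φ Λ) z v)) = inner ℝ v (Λ (fderiv ℝ (prox φ Λ) z u)) := by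
  have h1 : ∀ y, HasFDerivAt (envelope φ Λ) (innerSL ℝ (Λ (y - prox φ Λ y))) y := fun y =>
    (hasGradientAt_envelope hφ hΛ y).hasFDerivAt
  have h2 : HasFDerivAt (fun y => innerSL ℝ (Λ (y - prox φ Λ y)))
      ((innerSL ℝ : Vec n →L[ℝ] Vec n →L[ℝ] ℝ) ∘L
        (Λ ∘L (ContinuousLinearMap.id ℝ (Vec n) - fderiv ℝ (prox φ Λ) z))) z :=
    (innerSL ℝ : Vec n →L[ℝ] Vec n →L[ℝ] ℝ).hasFDerivAt.comp z
      (Λ.hasFDerivAt.comp z ((hasFDerivAt_id z).sub hd.hasFDerivAt))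
  have h3 : inner ℝ (Λ (v - fderiv ℝ (prox φ Λ) z v)) u
      = inner ℝ (Λ (u - fderiv ℝ (prox φ Λ) z u)) v := second_derivative_symmetric h1 h2 v u
  rw [real_inner_comm, real_inner_comm v, map_sub, map_sub, inner_sub_right, inner_sub_right] at h3
  have h4 : inner ℝ u (Λ v) = inner ℝ v (Λ u) := by rw [hΛ.inner_comm, real_inner_comm]
  linarith

/-- Nonexpansiveness holds for Jacobians and cuts out a closed convex set of matrices, so it
survives limits and convex hulls. The same scheme proves `inner_clarke_prox_symm`. -/
theorem wnorm_clarke_prox_le (hφ : IsConvexLscProper φ) (hΛ : IsSPD Λ) {z : Vec n} {D : Mat n}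
    (hD : D ∈ clarke (prox φ Λ) z) (v : Vec n) : wnorm Λ (D v) ≤ wnorm Λ v := by
  have hsub : clarke (prox φ Λ) z ⊆ {A : Mat n | wnorm Λ (A v) ≤ wnorm Λ v} := by
    refine convexHull_min ?_ ?_
    · rintro A ⟨u, hu, -, hA⟩
      have h : Tendsto (fun k => wnorm Λ (fderiv ℝ (prox φ Λ) (u k) v)) atTop
          (𝓝 (wnorm Λ (A v))) :=
        (((continuous_wnorm Λ).comp
          (ContinuousLinearMap.apply ℝ (Vec n) v).continuous).tendsto A).comp hA
      exact le_of_tendsto h (Eventually.of_forall fun k => wnorm_fderiv_prox_le hφ hΛ (hu k) v)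
    · intro A hA B hB a b ha hb hab
      simp only [mem_ofPred_eq] at hA hB ⊢
      calc wnorm Λ ((a • A + b • B) v) = wnorm Λ (a • A v + b • B v) := rfl
        _ ≤ a * wnorm Λ (A v) + b * wnorm Λ (B v) := by
          refine (hΛ.wnorm_add_le _ _).trans ?_
          rw [hΛ.wnorm_smul, hΛ.wnorm_smul, abs_of_nonneg ha, abs_of_nonneg hb]
        _ ≤ a * wnorm Λ v + b * wnorm Λ v := by gcongr
        _ = wnorm Λ v := by rw [← add_mul, hab, one_mul]
  exact hsub hD

theorem inner_clarke_prox_symm (hφ : IsConvexLscProper φ) (hΛ : IsSPD Λ) {z : Vec n} {D : Mat n}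
    (hD : D ∈ clarke (prox φ Λ) z) (u v : Vec n) :
    inner ℝ u (Λ (D v)) = inner ℝ v (Λ (D u)) := by
  have hsub : clarke (prox φ Λ) z ⊆
      {A : Mat n | inner ℝ u (Λ (A v)) = inner ℝ v (Λ (A u))} := by
    refine convexHull_min ?_ ?_
    · rintro A ⟨w, hw, -, hA⟩
      have h : ∀ a b : Vec n, Tendsto (fun k => inner ℝ a (Λ (fderiv ℝ (prox φ Λ) (w k) b))) atTop
          (𝓝 (inner ℝ a (Λ (A b)))) := fun a b =>
        (((innerSL ℝ a).continuous.comp (Λ.continuous.comp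
          (ContinuousLinearMap.apply ℝ (Vec n) b).continuous)).tendsto A).comp hA
      exact tendsto_nhds_unique (h u v)
        ((h v u).congr fun k => inner_fderiv_prox_symm hφ hΛ (hw k) v u)
    · intro A hA B hB a b ha hb hab
      simp only [mem_ofPred_eq] at hA hB ⊢
      simp only [add_apply, smul_apply, map_add, map_smul,
        inner_add_right, inner_smul_right, hA, hB]
  exact hsub hD

theorem exists_norm_clarke_prox_le (hφ : IsConvexLscProper φ) (hΛ : IsSPD Λ) :
    ∃ K : ℝ, 0 ≤ K ∧ ∀ z, ∀ D ∈ clarke (prox φ Λ) z, ‖D‖ ≤ K := by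
  refine ⟨√‖Λ.inverse‖ * √‖Λ‖, by positivity, fun z D hD => ?_⟩
  refine D.opNorm_le_bound (by positivity) fun v => ?_
  calc ‖D v‖ ≤ √‖Λ.inverse‖ * wnorm Λ (D v) := hΛ.norm_le _
    _ ≤ √‖Λ.inverse‖ * (√‖Λ‖ * ‖v‖) := by
        gcongr
        exact (wnorm_clarke_prox_le hφ hΛ hD v).trans (wnorm_le _ _)
    _ = _ := by ring

end ClarkeProx

/-! ### Conjugate gradients for semidefinite systems, with truncation. -/

section ConjugateGradient

variable {n : ℕ} {S : Mat n} {g : Vec n} {ε Δ : ℝ}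

theorem CGLoop.norm_le {i : ℕ} {q r p out : Vec n} (h : CGLoop S g ε Δ i q r p out)
    (hq : ‖q‖ ≤ Δ) : ‖out‖ ≤ Δ := by
  induction h with
  | exhausted => exact hq
  | negCurv i q r p α hi hcurv hα hmin => exact hα.le
  | boundary i q r p α hi hcurv hout hα₀ hα => exact hα.le
  | converged i q r p hi hcurv hin hsmall => exact hin.le
  | next i q r p q' r' p' out hi hcurv hq' hr' hin hgo hp' hrec ih => exact ih hin.le

theorem SteihaugCG.norm_le {out : Vec n} (h : SteihaugCG S g ε Δ out) (hΔ : 0 ≤ Δ) :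
    ‖out‖ ≤ Δ := by
  rcases h with ⟨-, rfl⟩ | ⟨-, h⟩
  · simpa using hΔ
  · exact h.norm_le (by simpa using hΔ)

/-- One step of the conjugate gradient recursion for the triple `(q, r, p)`. -/
noncomputable def cgNext (S : Mat n) (s : Vec n × Vec n × Vec n) : Vec n × Vec n × Vec n :=
  (s.1 + cgStep S s.2.1 s.2.2 • s.2.2,
    s.2.1 + cgStep S s.2.1 s.2.2 • S s.2.2,
    -(s.2.1 + cgStep S s.2.1 s.2.2 • S s.2.2) +
      (‖s.2.1 + cgStep S s.2.1 s.2.2 • S s.2.2‖ ^ 2 / ‖s.2.1‖ ^ 2) • s.2.2)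

/-- The untruncated conjugate gradient sequence; it is stationary once the residual vanishes. -/
noncomputable def cgState (S : Mat n) (g : Vec n) (i : ℕ) : Vec n × Vec n × Vec n :=
  (cgNext S)^[i] (0, g, -g)

noncomputable def cgIter (S : Mat n) (g : Vec n) (i : ℕ) : Vec n := (cgState S g i).1
noncomputable def cgRes (S : Mat n) (g : Vec n) (i : ℕ) : Vec n := (cgState S g i).2.1
noncomputable def cgDir (S : Mat n) (g : Vec n) (i : ℕ) : Vec n := (cgState S g i).2.2
noncomputable def cgAlpha (S : Mat n) (g : Vec n) (i : ℕ) : ℝ :=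
  cgStep S (cgRes S g i) (cgDir S g i)

theorem cgState_succ (S : Mat n) (g : Vec n) (i : ℕ) :
    cgState S g (i + 1) = cgNext S (cgState S g i) :=
  Function.iterate_succ_apply' _ _ _

theorem cgIter_succ (S : Mat n) (g : Vec n) (i : ℕ) :
    cgIter S g (i + 1) = cgIter S g i + cgAlpha S g i • cgDir S g i := by
  rw [cgIter, cgState_succ]; rfl

theorem cgRes_succ (S : Mat n) (g : Vec n) (i : ℕ) :
    cgRes S g (i + 1) = cgRes S g i + cgAlpha S g i • S (cgDir S g i) := by
  rw [cgRes, cgState_succ]; rfl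

theorem cgDir_succ (S : Mat n) (g : Vec n) (i : ℕ) :
    cgDir S g (i + 1) = -cgRes S g (i + 1) +
      (‖cgRes S g (i + 1)‖ ^ 2 / ‖cgRes S g i‖ ^ 2) • cgDir S g i := by
  rw [cgRes_succ, cgDir, cgState_succ]; rfl

theorem cgIter_zero (S : Mat n) (g : Vec n) : cgIter S g 0 = 0 := rfl
theorem cgRes_zero (S : Mat n) (g : Vec n) : cgRes S g 0 = g := rfl
theorem cgDir_zero (S : Mat n) (g : Vec n) : cgDir S g 0 = -g := rfl

theorem cgRes_eq (S : Mat n) (g : Vec n) (i : ℕ) : cgRes S g i = g + S (cgIter S g i) := by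
  induction i with
  | zero => simp [cgRes_zero, cgIter_zero]
  | succ i ih => rw [cgRes_succ, cgIter_succ, ih, map_add, map_smul, add_assoc]

/-- `S` is symmetric, positive definite on its range, and the range contains `g`. -/
structure CGCompatible (S : Mat n) (g : Vec n) : Prop where
  symm : ∀ u v : Vec n, inner ℝ u (S v) = inner ℝ v (S u)
  pos : ∀ v : Vec n, S v ≠ 0 → 0 < inner ℝ (S v) (S (S v))
  mem : ∃ v, S v = g

theorem CGCompatible.mem_range (h : CGCompatible S g) (i : ℕ) :
    (∃ v, S v = cgIter S g i) ∧ (∃ v, S v = cgRes S g i) ∧ (∃ v, S v = cgDir S g i) := by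
  obtain ⟨v, hv⟩ := h.mem
  induction i with
  | zero => exact ⟨⟨0, by simp [cgIter_zero]⟩, ⟨v, hv⟩, ⟨-v, by simp [cgDir_zero, hv]⟩⟩
  | succ i ih =>
    obtain ⟨⟨a, ha⟩, ⟨b, hb⟩, ⟨c, hc⟩⟩ := ih
    have hres : S (b + cgAlpha S g i • cgDir S g i) = cgRes S g (i + 1) := by
      rw [cgRes_succ, map_add, map_smul, hb]
    refine ⟨⟨a + cgAlpha S g i • c, ?_⟩, ⟨_, hres⟩,
      ⟨-(b + cgAlpha S g i • cgDir S g i) +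
        (‖cgRes S g (i + 1)‖ ^ 2 / ‖cgRes S g i‖ ^ 2) • c, ?_⟩⟩
    · rw [cgIter_succ, map_add, map_smul, ha, hc]
    · rw [cgDir_succ, map_add, map_neg, hres, map_smul, hc]

theorem CGCompatible.curv_pos (h : CGCompatible S g) {i : ℕ} (hp : cgDir S g i ≠ 0) :
    0 < inner ℝ (cgDir S g i) (S (cgDir S g i)) := by
  obtain ⟨-, -, v, hv⟩ := h.mem_range i
  rw [← hv] at hp ⊢
  exact h.pos v hp

theorem CGCompatible.cgAlpha_nonneg (h : CGCompatible S g) (i : ℕ) : 0 ≤ cgAlpha S g i := by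
  rw [cgAlpha, cgStep, real_inner_self_eq_norm_sq]
  rcases eq_or_ne (cgDir S g i) 0 with hp | hp
  -- A zero direction has zero curvature, and division by zero makes the step length 0.
  · simp [hp]
  · have := h.curv_pos hp
    positivity

/-- The classical CG relations, proved by one simultaneous induction, together with `⟨p_i, p_j⟩ ≥
0`, which is behind the monotone growth of the iterates. The clause `r = 0 → p = 0` lets the
untruncated recursion continue harmlessly after it has converged. -/
theorem CGCompatible.orthogonality (h : CGCompatible S g) (i : ℕ) :
    inner ℝ (cgRes S g i) (cgDir S g i) = -‖cgRes S g i‖ ^ 2 ∧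
    (cgRes S g i = 0 → cgDir S g i = 0) ∧
    ∀ j < i, inner ℝ (cgRes S g i) (cgDir S g j) = 0 ∧
      inner ℝ (cgRes S g i) (cgRes S g j) = 0 ∧
      inner ℝ (cgDir S g i) (S (cgDir S g j)) = 0 ∧
      0 ≤ inner ℝ (cgDir S g i) (cgDir S g j) := by
  induction i using Nat.strong_induction_on with
  | _ i ih =>
  rcases i with _ | i
  · refine ⟨?_, ?_, by simp⟩
    · rw [cgRes_zero, cgDir_zero, inner_neg_right, real_inner_self_eq_norm_sq]
    · intro h0
      rw [cgRes_zero] at h0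
      simp [cgDir_zero, h0]
  obtain ⟨h1, h2, h3⟩ := ih i (Nat.lt_succ_self i)
  have hα : ∀ j ≤ i, cgAlpha S g j * inner ℝ (cgDir S g j) (S (cgDir S g j))
      = ‖cgRes S g j‖ ^ 2 := by
    intro j hj
    obtain ⟨k1, k2, -⟩ := ih j (by omega)
    rcases eq_or_ne (cgDir S g j) 0 with hp | hp
    · rw [hp, inner_zero_right] at k1
      rw [hp, inner_zero_left, mul_zero]
      linarith
    · rw [cgAlpha, cgStep, real_inner_self_eq_norm_sq, div_mul_cancel₀ _ (h.curv_pos hp).ne']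
  have hrp : ∀ j ≤ i, inner ℝ (cgRes S g (i + 1)) (cgDir S g j) = 0 := by
    intro j hj
    rw [cgRes_succ, inner_add_left, inner_smul_left, conj_trivial,
      real_inner_comm (cgDir S g j) (S _)]
    rcases hj.lt_or_eq with hlt | rfl
    · obtain ⟨k1, -, k3, -⟩ := h3 j hlt
      rw [h.symm, k3, k1, mul_zero, add_zero]
    · rw [hα j le_rfl, h1, neg_add_cancel]
  have hrr : ∀ j ≤ i, inner ℝ (cgRes S g (i + 1)) (cgRes S g j) = 0 := by
    intro j hj
    rcases j with _ | j
    · have := hrp 0 (Nat.zero_le i)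
      rw [cgDir_zero, inner_neg_right, neg_eq_zero] at this
      exact this
    -- Each residual is a combination of two consecutive directions, so orthogonality to directions
    -- implies orthogonality to residuals.
    · have e : cgRes S g (j + 1) = -cgDir S g (j + 1)
          + (‖cgRes S g (j + 1)‖ ^ 2 / ‖cgRes S g j‖ ^ 2) • cgDir S g j := by
        rw [cgDir_succ]; abel
      rw [e, inner_add_right, inner_neg_right, inner_smul_right, hrp _ hj, hrp j (by omega)]
      simp
  have hrS : ∀ j ≤ i, cgAlpha S g j * inner ℝ (cgRes S g (i + 1)) (S (cgDir S g j))
      = inner ℝ (cgRes S g (i + 1)) (cgRes S g (j + 1)) - inner ℝ (cgRes S g (i + 1)) (cgRes S g j) := by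
    intro j hj
    rw [cgRes_succ S g j, inner_add_right, inner_smul_right]
    ring
  have hzero : ∀ j ≤ i, cgAlpha S g j = 0 → cgDir S g j = 0 := by
    intro j hj h0
    have := hα j hj
    rw [h0, zero_mul] at this
    have h5 : cgRes S g j = 0 := by
      rw [← norm_eq_zero]; exact pow_eq_zero_iff (two_ne_zero) |>.1 this.symm
    exact (ih j (by omega)).2.1 h5
  refine ⟨?_, ?_, ?_⟩
  · rw [cgDir_succ, inner_add_right, inner_neg_right, inner_smul_right, hrp i le_rfl,
      real_inner_self_eq_norm_sq]
    ring
  · intro h0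
    rw [cgDir_succ, h0]
    simp
  · intro j hj
    have hj' : j ≤ i := Nat.lt_succ_iff.1 hj
    refine ⟨hrp j hj', hrr j hj', ?_, ?_⟩
    -- Conjugacy is checked after multiplication by `α_j`, since `α_j S p_j` is a difference of
    -- residuals; if `α_j = 0` then `p_j = 0`.
    · rcases eq_or_ne (cgAlpha S g j) 0 with h0 | h0
      · rw [hzero j hj' h0]; simp
      · apply mul_left_cancel₀ h0
        rw [cgDir_succ, inner_add_left, inner_neg_left, inner_smul_left, conj_trivial, mul_zero,
          mul_add, mul_neg, hrS j hj', hrr j hj']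
        rcases hj'.lt_or_eq with hlt | rfl
        · rw [hrr (j + 1) hlt, (h3 j hlt).2.2.1]
          ring
        · have h6 : ‖cgRes S g j‖ ^ 2 ≠ 0 := by
            rw [← hα j le_rfl]
            refine mul_ne_zero h0 (h.curv_pos ?_).ne'
            intro hp
            apply h0
            rw [cgAlpha, cgStep, hp]
            simp
          rw [mul_left_comm, hα j le_rfl, div_mul_cancel₀ _ h6, real_inner_self_eq_norm_sq]
          ring
    · rw [cgDir_succ, inner_add_left, inner_neg_left, inner_smul_left, conj_trivial, hrp j hj',
        neg_zero, zero_add]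
      refine mul_nonneg (by positivity) ?_
      rcases hj'.lt_or_eq with hlt | rfl
      · exact (h3 j hlt).2.2.2
      · exact real_inner_self_nonneg

theorem CGCompatible.cgRes_eq_zero_of_le (h : CGCompatible S g) {i j : ℕ} (hij : i ≤ j) (h0 : cgRes S g i = 0) :
    cgRes S g j = 0 := by
  induction j, hij using Nat.le_induction with
  | base => exact h0
  | succ k _ ih => rw [cgRes_succ, ih, (h.orthogonality k).2.1 ih]; simp

/-- Otherwise there would be `n + 1` nonzero, pairwise orthogonal residuals in `ℝⁿ`. -/
theorem CGCompatible.cgRes_eq_zero (h : CGCompatible S g) {i : ℕ} (hi : n ≤ i) : cgRes S g i = 0 := by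
  by_contra hne
  have hne' : ∀ j : Fin (n + 1), cgRes S g j ≠ 0 := fun j hj =>
    hne (h.cgRes_eq_zero_of_le (by omega) hj)
  have hortho : Pairwise fun a b : Fin (n + 1) =>
      inner ℝ (cgRes S g a) (cgRes S g b) = 0 := by
    intro a b hab
    rcases lt_or_gt_of_ne hab with hlt | hlt
    · rw [real_inner_comm]
      exact ((h.orthogonality b).2.2 a hlt).2.1
    · exact ((h.orthogonality a).2.2 b hlt).2.1
  have hli := linearIndependent_of_ne_zero_of_inner_eq_zero hne' hortho
  have := hli.fintype_card_le_finrank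
  simp at this

theorem CGCompatible.inner_cgDir_cgIter_nonneg (h : CGCompatible S g) {i k : ℕ} (hik : i ≤ k) :
    0 ≤ inner ℝ (cgDir S g k) (cgIter S g i) := by
  induction i with
  | zero => simp [cgIter_zero]
  | succ i ih =>
    rw [cgIter_succ, inner_add_right, inner_smul_right]
    exact add_nonneg (ih (by omega))
      (mul_nonneg (h.cgAlpha_nonneg i) ((h.orthogonality k).2.2 i hik).2.2.2)

/-- Every step `α_i p_i` makes a nonnegative inner product with the current iterate, which is a
nonnegative combination of earlier directions. -/
theorem CGCompatible.norm_cgIter_mono (h : CGCompatible S g) : Monotone fun i => ‖cgIter S g i‖ := by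
  refine monotone_nat_of_le_succ fun i => ?_
  refine le_of_sq_le_sq ?_ (norm_nonneg _)
  rw [cgIter_succ, norm_add_sq_real, inner_smul_right, real_inner_comm]
  have := mul_nonneg (h.cgAlpha_nonneg i) (h.inner_cgDir_cgIter_nonneg (le_refl i))
  nlinarith [sq_nonneg ‖cgAlpha S g i • cgDir S g i‖]

/-- The iterates are no longer than any solution of the linear system. -/
theorem CGCompatible.norm_cgIter_le (h : CGCompatible S g) {s : Vec n} (hs : S s = -g) (i : ℕ) :
    ‖cgIter S g i‖ ≤ ‖s‖ := by
  have h1 : ‖cgIter S g i‖ ≤ ‖cgIter S g (max n i)‖ := h.norm_cgIter_mono (le_max_right n i)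
  refine h1.trans ?_
  set q := cgIter S g (max n i) with hq
  have h2 : S q = -g := by
    have := cgRes_eq S g (max n i)
    rw [h.cgRes_eq_zero (le_max_left n i)] at this
    exact (neg_eq_of_add_eq_zero_right this.symm).symm
  obtain ⟨w, hw⟩ := (h.mem_range (max n i)).1
  -- The final iterate `q` is the minimum-norm solution: it lies in the range of `S`, and `s - q`
  -- lies in the kernel, which is orthogonal to the range.
  have h3 : inner ℝ (s - q) q = 0 := by
    have h5 : inner ℝ (s - q) q = inner ℝ (s - q) (S w) := by rw [hw]
    rw [h5, h.symm, map_sub, hs, h2, sub_self, inner_zero_right]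
  rw [inner_sub_left, real_inner_self_eq_norm_sq, sub_eq_zero] at h3
  have h4 := real_inner_le_norm s q
  rw [h3] at h4
  by_contra hcon
  nlinarith [norm_nonneg s, norm_nonneg q]

/-- The loop follows the untruncated sequence, and only the converged exit is possible: the residual
is zero once `i ≥ n`, curvature is positive along nonzero directions, and no iterate is longer than
`s`, which lies strictly inside the trust region. -/
theorem CGCompatible.norm_residual_le_of_loop (h : CGCompatible S g) (hε : 0 ≤ ε) {s : Vec n} (hs : S s = -g)
    (hsΔ : ‖s‖ < Δ) {i : ℕ} {q r p out : Vec n} (hloop : CGLoop S g ε Δ i q r p out)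
    (hq : q = cgIter S g i) (hr : r = cgRes S g i) (hp : p = cgDir S g i)
    (hres : ¬ CGStop ε r) : ‖g + S out‖ ≤ ε := by
  induction hloop with
  | exhausted i q r p hi =>
    exact absurd (Or.inr (hr.trans (h.cgRes_eq_zero hi))) hres
  | negCurv i q r p α hi hcurv hα hmin =>
    have hp0 : cgDir S g i ≠ 0 := by
      intro h0
      have h1 := (h.orthogonality i).1
      rw [h0, inner_zero_right] at h1
      apply hres
      right
      rw [hr, ← norm_eq_zero]
      exact pow_eq_zero_iff two_ne_zero |>.1 (by linarith)
    have := h.curv_pos hp0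
    rw [← hp] at this
    exact absurd this (not_lt.2 hcurv)
  | boundary i q r p α hi hcurv hout hα₀ hα =>
    have h1 := h.norm_cgIter_le hs (i + 1)
    rw [cgIter_succ, cgAlpha, ← hq, ← hr, ← hp] at h1
    linarith
  | converged i q r p hi hcurv hin hsmall =>
    have h1 := cgRes_eq S g (i + 1)
    rw [cgIter_succ, cgRes_succ, cgAlpha, ← hq, ← hr, ← hp] at h1
    rw [← h1]
    rcases hsmall with h2 | h2
    · exact h2.le
    · rw [h2, norm_zero]; exact hε
  | next i q r p q' r' p' out hi hcurv hq' hr' hin hgo hp' hrec ih =>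
    have h1 : q' = cgIter S g (i + 1) := by rw [hq', cgIter_succ, cgAlpha, ← hq, ← hr, ← hp]
    have h2 : r' = cgRes S g (i + 1) := by rw [hr', cgRes_succ, cgAlpha, ← hr, ← hp]
    exact ih h1 h2 (by rw [hp', cgDir_succ, ← h2, ← hr, ← hp]) hgo

/-- If the trust region contains a solution, the Steihaug-CG method returns a point whose
residual satisfies the tolerance. -/
theorem CGCompatible.norm_residual_le (h : CGCompatible S g) (hε : 0 ≤ ε) {s : Vec n} (hs : S s = -g)
    (hsΔ : ‖s‖ < Δ) {out : Vec n} (hcg : SteihaugCG S g ε Δ out) : ‖g + S out‖ ≤ ε := by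
  rcases hcg with ⟨h1, rfl⟩ | ⟨h1, h2⟩
  · rw [map_zero, add_zero]
    rcases h1 with h1 | h1
    · exact h1.le
    · rw [h1, norm_zero]; exact hε
  · exact h.norm_residual_le_of_loop hε hs hsΔ h2 rfl rfl rfl h1

end ConjugateGradient

/-! ### Decrease of the merit function for small radii. -/

section SufficientDecrease

/-- Complete the square in `δ`; `c` is the coefficient of `Δ²` that remains, and the hypothesis
makes it positive. In the application `δ` is the length of the proximal displacement and `Δ` that of
the step. -/
theorem exists_quadratic_gap {τ ν l : ℝ} (hτ : 0 < τ) (h : τ * l ^ 2 < 2 * (1 - τ - ν)) :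
    ∃ c : ℝ, 0 < c ∧ ∀ δ Δ : ℝ,
      c * Δ ^ 2 ≤ τ / 2 * Δ ^ 2 + (1 - τ - ν) * δ ^ 2 - τ * l * δ * Δ := by
  set A := 1 - τ - ν with hA
  have hApos : 0 < A := by
    have : 0 ≤ τ * l ^ 2 := by positivity
    linarith
  refine ⟨τ * (2 * A - τ * l ^ 2) / (4 * A), ?_, fun δ Δ => ?_⟩
  · have : 0 < 2 * A - τ * l ^ 2 := by linarith
    positivity
  · have : τ / 2 * Δ ^ 2 + A * δ ^ 2 - τ * l * δ * Δ
        - τ * (2 * A - τ * l ^ 2) / (4 * A) * Δ ^ 2 = A * (δ - τ * l * Δ / (2 * A)) ^ 2 := by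
      field_simp
      ring
    have h2 : 0 ≤ A * (δ - τ * l * Δ / (2 * A)) ^ 2 := by positivity
    linarith

/-- Decrease of the merit function along a short step, in normalized coordinates. -/
theorem decrease_of_short_step {E : Type*} [NormedAddCommGroup E] [InnerProductSpace ℝ E]
    {u w s d γ : E} {τ ν l l₂ c C Δ ψd : ℝ} (hτ : 0 < τ) (hτ1 : τ < 1) (hν : 0 ≤ ν) (hν1 : ν ≤ 1)
    (hl : 0 ≤ l) (hl₂ : 0 ≤ l₂) (hc : 0 < c) (hC : 0 ≤ C) (hΔ : 0 < Δ)
    (hgap : ∀ δ Δ : ℝ, c * Δ ^ 2 ≤ τ / 2 * Δ ^ 2 + (1 - τ - ν) * δ ^ 2 - τ * l * δ * Δ)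
    (hw : ‖w‖ ≤ C * Δ) (hΔu : (C + 1) * Δ ≤ ‖u‖) (hs : s = (Δ / ‖w - u‖) • (w - u))
    (hd : ‖d‖ ^ 2 ≤ inner ℝ s d) (hγ : ‖γ‖ ≤ l * ‖d‖)
    (hψ : -inner ℝ u d - inner ℝ s d - l₂ * ‖d‖ ^ 2 ≤ ψd) :
    τ / 2 * ‖u‖ * Δ + ν * ‖u‖ / Δ * ‖d‖ ^ 2 + c * ‖u‖ * Δ
      - (C * (4 + l) + 1 + l₂ + (l + 2) ^ 2 / 2) * Δ ^ 2
      ≤ ψd + τ / 2 * (‖u‖ ^ 2 - ‖u + (γ + s - d)‖ ^ 2) := by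
  have hN : Δ ≤ ‖w - u‖ := by
    have := norm_sub_norm_le u w
    rw [norm_sub_rev] at this
    nlinarith
  have hNpos : 0 < ‖w - u‖ := hΔ.trans_le hN
  -- Here `u = w - κs`, so each inner product with `u` becomes `-κ` times one with `s`, up to a term
  -- with `w` bounded by a multiple of `Δ²`. Since `κ` is at least `‖u‖/Δ - C`, the leading part has
  -- order `‖u‖Δ`.
  set κ := ‖w - u‖ / Δ with hκ
  have hκ0 : 0 < κ := by positivity
  have hu : u = w - κ • s := by
    rw [hs, smul_smul, hκ, div_mul_div_comm, mul_comm ‖w - u‖ Δ, div_self (by positivity)]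
    simp
  have hκlow : ‖u‖ / Δ - C ≤ κ := by
    rw [hκ, sub_le_iff_le_add, div_le_iff₀ hΔ, add_mul, div_mul_cancel₀ _ hΔ.ne']
    have := norm_sub_norm_le u w
    rw [norm_sub_rev] at this
    linarith
  have hsn : ‖s‖ = Δ := by
    rw [hs, norm_smul, Real.norm_eq_abs, abs_of_pos (by positivity), div_mul_cancel₀ _ hNpos.ne']
  have hdn : ‖d‖ ≤ Δ := by
    have h1 := hd.trans (real_inner_le_norm s d)
    rw [hsn] at h1
    by_contra hcon
    nlinarith [norm_nonneg d]
  have hd0 := norm_nonneg d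
  have hγn : ‖γ‖ ≤ l * Δ := hγ.trans (by gcongr)
  have hsd : inner ℝ s d ≤ Δ ^ 2 := by
    have h1 := real_inner_le_norm s d
    rw [hsn] at h1
    nlinarith
  have hsγ : -(l * ‖d‖ * Δ) ≤ inner ℝ s γ := by
    have h1 := (abs_le.1 (abs_real_inner_le_norm s γ)).1
    rw [hsn] at h1
    nlinarith
  have hwd : inner ℝ w d ≤ C * Δ ^ 2 := by
    refine (real_inner_le_norm w d).trans ?_
    calc ‖w‖ * ‖d‖ ≤ (C * Δ) * Δ := by gcongr
      _ = _ := by ring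
  have hwγ : inner ℝ w γ ≤ C * l * Δ ^ 2 := by
    refine (real_inner_le_norm w γ).trans ?_
    calc ‖w‖ * ‖γ‖ ≤ (C * Δ) * (l * Δ) := by gcongr
      _ = _ := by ring
  have hws : inner ℝ w s ≤ C * Δ ^ 2 := by
    refine (real_inner_le_norm w s).trans ?_
    calc ‖w‖ * ‖s‖ ≤ (C * Δ) * Δ := by rw [hsn]; gcongr
      _ = _ := by ring
  have hrest : ‖γ + s - d‖ ^ 2 ≤ (l + 2) ^ 2 * Δ ^ 2 := by
    have h1 : ‖γ + s - d‖ ≤ (l + 2) * Δ := by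
      calc ‖γ + s - d‖ ≤ ‖γ‖ + ‖s‖ + ‖d‖ := (norm_sub_le _ _).trans (by gcongr; exact norm_add_le _ _)
        _ ≤ l * Δ + Δ + Δ := by rw [hsn]; gcongr
        _ = _ := by ring
    rw [← mul_pow]
    gcongr
  -- Multiplied by `‖u‖/Δ` this is an upper bound for the predicted reduction plus the margin
  -- `c‖u‖Δ`, which later absorbs the errors of order `Δ²`.
  set Q₀ := τ / 2 * Δ ^ 2 + ν * ‖d‖ ^ 2 + c * Δ ^ 2 with hQ₀
  have hQ₀nonneg : 0 ≤ Q₀ := by positivity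
  have hΔ2 : 0 < Δ ^ 2 := by positivity
  have hcle : c ≤ τ / 2 := by
    have := hgap 0 1
    linarith
  have hdΔ : ‖d‖ ^ 2 ≤ Δ ^ 2 := by gcongr
  have hQ₀le : Q₀ ≤ 3 * Δ ^ 2 := by
    have h1 : ν * ‖d‖ ^ 2 ≤ 1 * Δ ^ 2 := by gcongr
    nlinarith
  have hQ : Q₀ ≤ (1 - τ) * inner ℝ s d + τ * inner ℝ s γ + τ * Δ ^ 2 := by
    have h1 := hgap ‖d‖ Δ
    have h2 : (1 - τ) * ‖d‖ ^ 2 ≤ (1 - τ) * inner ℝ s d :=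
      mul_le_mul_of_nonneg_left hd (by linarith)
    have h3 : τ * (-(l * ‖d‖ * Δ)) ≤ τ * inner ℝ s γ := mul_le_mul_of_nonneg_left hsγ hτ.le
    rw [hQ₀]
    linarith
  have hκQ : ‖u‖ / Δ * Q₀ - C * (3 * Δ ^ 2)
      ≤ κ * ((1 - τ) * inner ℝ s d + τ * inner ℝ s γ + τ * Δ ^ 2) := by
    have h1 : κ * Q₀ ≤ κ * ((1 - τ) * inner ℝ s d + τ * inner ℝ s γ + τ * Δ ^ 2) :=
      mul_le_mul_of_nonneg_left hQ hκ0.le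
    have h2 : (‖u‖ / Δ - C) * Q₀ ≤ κ * Q₀ := mul_le_mul_of_nonneg_right hκlow hQ₀nonneg
    have h3 : C * Q₀ ≤ C * (3 * Δ ^ 2) := mul_le_mul_of_nonneg_left hQ₀le hC
    linarith
  have hexp : ‖u‖ / Δ * Q₀ = τ / 2 * ‖u‖ * Δ + ν * ‖u‖ / Δ * ‖d‖ ^ 2 + c * ‖u‖ * Δ := by
    rw [hQ₀]
    field_simp
  have hnorm : ‖u + (γ + s - d)‖ ^ 2 = ‖u‖ ^ 2
      + 2 * (inner ℝ u γ + inner ℝ u s - inner ℝ u d) + ‖γ + s - d‖ ^ 2 := by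
    rw [norm_add_sq_real, inner_sub_right, inner_add_right]
  have hus : ∀ v : E, inner ℝ u v = inner ℝ w v - κ * inner ℝ s v := by
    intro v
    conv_lhs => rw [hu]
    rw [inner_sub_left, inner_smul_left, conj_trivial]
  have hss : inner ℝ s s = Δ ^ 2 := by rw [real_inner_self_eq_norm_sq, hsn]
  rw [hnorm]
  rw [hus γ, hus s, hus d, hss]
  rw [hus d] at hψ
  have b1 : (1 - τ) * inner ℝ w d ≤ (1 - τ) * (C * Δ ^ 2) :=
    mul_le_mul_of_nonneg_left hwd (by linarith)
  have b2 : τ * inner ℝ w γ ≤ τ * (C * l * Δ ^ 2) := mul_le_mul_of_nonneg_left hwγ hτ.le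
  have b3 : τ * inner ℝ w s ≤ τ * (C * Δ ^ 2) := mul_le_mul_of_nonneg_left hws hτ.le
  have b4 : l₂ * ‖d‖ ^ 2 ≤ l₂ * Δ ^ 2 := by gcongr
  have b5 : τ / 2 * ‖γ + s - d‖ ^ 2 ≤ 1 / 2 * ((l + 2) ^ 2 * Δ ^ 2) := by gcongr
  have b6 : τ * (C * l * Δ ^ 2) ≤ C * l * Δ ^ 2 := mul_le_of_le_one_left (by positivity) hτ1.le
  rw [← hexp]
  linarith

variable {n : ℕ} {f : Vec n → ℝ} {φ : Vec n → EReal} {Λ : Mat n}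

/-- The mean value inequality on the segment gives the factor `L` rather than `L/2`; this is enough,
since the term only enters errors of order `Δ²`. -/
theorem abs_sub_sub_inner_gradient_le (hf : ContDiff ℝ 1 f) {s : Set (Vec n)} (hs : Convex ℝ s)
    {L : ℝ≥0} (hLip : LipschitzOnWith L (gradient f) s) {x y : Vec n} (hx : x ∈ s) (hy : y ∈ s) :
    |f y - f x - inner ℝ (gradient f x) (y - x)| ≤ L * ‖y - x‖ ^ 2 := by
  have hd : ∀ z, HasFDerivAt f (innerSL ℝ (gradient f z)) z := fun z =>
    ((hf.differentiable one_ne_zero).differentiableAt.hasGradientAt (x := z)).hasFDerivAt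
  have hbound : ∀ z ∈ segment ℝ x y,
      ‖innerSL ℝ (gradient f z) - innerSL ℝ (gradient f x)‖ ≤ L * ‖y - x‖ := by
    intro z hz
    rw [← map_sub, innerSL_apply_norm]
    refine (hLip.norm_sub_le (hs.segment_subset hx hy hz) hx).trans ?_
    gcongr
    rw [segment_eq_image'] at hz
    obtain ⟨θ, hθ, rfl⟩ := hz
    rw [add_sub_cancel_left, norm_smul, Real.norm_eq_abs, abs_of_nonneg hθ.1]
    exact mul_le_of_le_one_left (norm_nonneg _) hθ.2
  have h := Convex.norm_image_sub_le_of_norm_hasFDerivWithin_le'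
    (fun z _ => (hd z).hasFDerivWithinAt) hbound (convex_segment x y)
    (left_mem_segment ℝ x y) (right_mem_segment ℝ x y)
  rw [Real.norm_eq_abs, innerSL_apply_apply] at h
  rw [sq, ← mul_assoc]
  exact h

theorem crit_eq (hΛ : IsSPD Λ) (z : Vec n) :
    crit f φ Λ z = wnorm Λ (Λ.inverse (normalMap f φ Λ z)) := hΛ.wnorm_inverse _

theorem crit_nonneg (z : Vec n) : 0 ≤ crit f φ Λ z := wnorm_nonneg _ _

theorem crit_pos (hΛ : IsSPD Λ) {z : Vec n} (hz : normalMap f φ Λ z ≠ 0) :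
    0 < crit f φ Λ z := by
  rw [crit_eq hΛ]
  refine hΛ.wnorm_pos fun h => hz ?_
  rw [← hΛ.apply_inverse (normalMap f φ Λ z), h, map_zero]

theorem pred_pos {τ Δ ν : ℝ} {z s : Vec n} (hτ : 0 < τ) (hΔ : 0 < Δ) (hν : 0 ≤ ν)
    (hχ : 0 < crit f φ Λ z) : 0 < pred f φ Λ τ z s Δ ν := by
  unfold pred
  have : 0 < min Δ (crit f φ Λ z) := lt_min hΔ hχ
  have : 0 < min 1 (min Δ (crit f φ Λ z)) := lt_min one_pos this
  positivity

/-- `decrease_of_short_step` is applied with `u = Λ⁻¹F(z)`, `d` the proximal displacement and `γ`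
equal to `Λ⁻¹` times the change of gradient, so that `Λ⁻¹F(z+s) = u + γ + s - d`. For `Δ ≤ cχ` the
error `KΔ²` is at most the margin `c₀χΔ`. -/
theorem exists_pred_le_merit_sub (hf : ContDiff ℝ 1 f) (hφ : IsConvexLscProper φ) (hΛ : IsSPD Λ)
    {τ : ℝ} (hτ0 : 0 < τ) (hτ1 : τ < 1) {L : ℝ≥0}
    (hLip : LipschitzOnWith L (gradient f) (effDom φ)) {ν : ℝ} (hν₁ : ν < 1)
    (hτ : τ * ((L : ℝ) ^ 2 + 2 * ‖Λ.inverse‖⁻¹ ^ 2) < 2 * ‖Λ.inverse‖⁻¹ ^ 2 * (1 - ν))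
    {C : ℝ} (hC : 0 ≤ C) :
    ∃ c : ℝ, 0 < c ∧ ∀ (z w s : Vec n) (Δ ν' : ℝ), 0 < Δ → 0 ≤ ν' → ν' ≤ ν →
      wnorm Λ w ≤ C * Δ → Δ ≤ c * crit f φ Λ z →
      s = min 1 (Δ / wnorm Λ (w - Λ.inverse (normalMap f φ Λ z))) •
        (w - Λ.inverse (normalMap f φ Λ z)) →
      pred f φ Λ τ z s Δ ν' ≤ merit f φ Λ τ z - merit f φ Λ τ (z + s) := by
  set κ := ‖Λ.inverse‖ with hκ
  have hκ0 : 0 < κ := by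
    -- If `‖Λ⁻¹‖ = 0` (dimension zero), then `0⁻¹ = 0` turns the condition on `τ` into `τL² < 0`.
    rcases (norm_nonneg Λ.inverse).eq_or_lt' with h | h
    · rw [hκ, h] at hτ
      have : 0 ≤ τ * (L : ℝ) ^ 2 := by positivity
      simp at hτ
      linarith
    · exact h
  set l := L * κ with hl
  have hl0 : 0 ≤ l := by positivity
  -- Multiplying the condition on `τ` by `κ² = λ_m⁻²` turns it into the hypothesis of
  -- `exists_quadratic_gap`.
  have hgap0 : τ * l ^ 2 < 2 * (1 - τ - ν) := by
    have h1 : κ ^ 2 * (τ * ((L : ℝ) ^ 2 + 2 * κ⁻¹ ^ 2)) < κ ^ 2 * (2 * κ⁻¹ ^ 2 * (1 - ν)) :=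
      mul_lt_mul_of_pos_left hτ (by positivity)
    have h2 : κ ^ 2 * (τ * ((L : ℝ) ^ 2 + 2 * κ⁻¹ ^ 2)) = τ * l ^ 2 + 2 * τ := by
      rw [hl]; field_simp
    have h3 : κ ^ 2 * (2 * κ⁻¹ ^ 2 * (1 - ν)) = 2 * (1 - ν) := by field_simp
    linarith
  obtain ⟨c₀, hc₀, hgap⟩ := exists_quadratic_gap hτ0 hgap0
  set K := C * (4 + l) + 1 + l + (l + 2) ^ 2 / 2 with hK
  have hKpos : 0 < K := by positivity
  refine ⟨min (C + 1)⁻¹ (c₀ / K), by positivity, ?_⟩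
  intro z w s Δ ν' hΔ hν'0 hν' hw hΔc hs
  set u := Λ.inverse (normalMap f φ Λ z) with hu
  have hΛu : Λ u = normalMap f φ Λ z := hΛ.apply_inverse _
  have hχ : crit f φ Λ z = wnorm Λ u := crit_eq hΛ z
  set χ := crit f φ Λ z with hχdef
  have hχ0 : 0 ≤ χ := crit_nonneg z
  have hΔ1 : (C + 1) * Δ ≤ χ := by
    have h1 : Δ ≤ (C + 1)⁻¹ * χ := hΔc.trans (by gcongr; exact min_le_left _ _)
    rwa [← div_eq_inv_mul, le_div_iff₀ (by positivity), mul_comm] at h1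
  have hΔ2 : K * Δ ≤ c₀ * χ := by
    have h1 : Δ ≤ c₀ / K * χ := hΔc.trans (by gcongr; exact min_le_right _ _)
    rwa [div_mul_eq_mul_div, le_div_iff₀ hKpos, mul_comm] at h1
  have hΔχ : Δ ≤ χ := by nlinarith
  obtain ⟨E, _, _, J, hJ⟩ := hΛ.exists_embedding
  have hJn := wnorm_eq_norm_of_embedding hJ
  set x := prox φ Λ z with hx
  set x' := prox φ Λ (z + s) with hx'
  set γ := Λ.inverse (gradient f x' - gradient f x) with hγ
  have hΛγ : Λ γ = gradient f x' - gradient f x := hΛ.apply_inverse _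
  have hxd : x ∈ effDom φ := prox_mem_effDom hφ hΛ z
  have hx'd : x' ∈ effDom φ := prox_mem_effDom hφ hΛ (z + s)
  have hdnorm : ‖x' - x‖ ^ 2 ≤ κ * wnorm Λ (x' - x) ^ 2 := hΛ.norm_sq_le _
  have hγn : wnorm Λ γ ≤ l * wnorm Λ (x' - x) := by
    rw [hγ, ← hΛ.wnorm_inverse]
    calc wnorm Λ.inverse (gradient f x' - gradient f x)
        ≤ √κ * ‖gradient f x' - gradient f x‖ := wnorm_le _ _
      _ ≤ √κ * (L * (√κ * wnorm Λ (x' - x))) := by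
          gcongr
          exact (hLip.norm_sub_le hx'd hxd).trans (by gcongr; exact hΛ.norm_le _)
      _ = (√κ * √κ) * L * wnorm Λ (x' - x) := by ring
      _ = l * wnorm Λ (x' - x) := by rw [Real.mul_self_sqrt hκ0.le, hl]; ring
  have hN : Δ ≤ wnorm Λ (w - u) := by
    rw [hJn, map_sub]
    have h1 := norm_sub_norm_le (J u) (J w)
    rw [norm_sub_rev, ← hJn, ← hJn] at h1
    rw [hχ] at hΔ1
    nlinarith
  have hsJ : J s = (Δ / ‖J w - J u‖) • (J w - J u) := by
    rw [hs, min_eq_right ((div_le_one (hΔ.trans_le hN)).2 hN), map_smul, map_sub, hJn, map_sub]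
  have hdJ : ‖J (x' - x)‖ ^ 2 ≤ inner ℝ (J s) (J (x' - x)) := by
    have h1 := prox_firmly_nonexpansive hφ hΛ z (z + s)
    rw [add_sub_cancel_left, hJn, ← hJ, real_inner_comm] at h1
    exact h1
  have hsub := prox_subgradient hφ hΛ (z + s) hxd
  have hff := (abs_le.1 (abs_sub_sub_inner_gradient_le hf hφ.convex_effDom hLip hxd hx'd)).2
  have hψ : -inner ℝ (J u) (J (x' - x)) - inner ℝ (J s) (J (x' - x)) - l * ‖J (x' - x)‖ ^ 2
      ≤ f x + (φ x).toReal - (f x' + (φ x').toReal) := by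
    have e1 : Λ (z + s - x') = normalMap f φ Λ z - gradient f x + Λ s - Λ (x' - x) := by
      simp only [normalMap, ← hx, map_sub, map_add]; abel
    have e2 : inner ℝ (J u) (J (x' - x)) = inner ℝ (x' - x) (normalMap f φ Λ z) := by
      rw [real_inner_comm, hJ, hΛu]
    have e3 : inner ℝ (J s) (J (x' - x)) = inner ℝ (x' - x) (Λ s) := by
      rw [real_inner_comm, hJ]
    have e4 : inner ℝ (x - x') (Λ (z + s - x')) = -(inner ℝ (x' - x) (normalMap f φ Λ z)
        - inner ℝ (gradient f x) (x' - x) + inner ℝ (x' - x) (Λ s) - wnorm Λ (x' - x) ^ 2) := by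
      rw [← neg_sub x' x, inner_neg_left, e1, inner_sub_right, inner_add_right, inner_sub_right,
        hΛ.wnorm_sq, real_inner_comm (x' - x) (gradient f x)]
    rw [e4] at hsub
    rw [e2, e3, ← hJn]
    have h5 : (L : ℝ) * ‖x' - x‖ ^ 2 ≤ l * wnorm Λ (x' - x) ^ 2 := by
      calc (L : ℝ) * ‖x' - x‖ ^ 2 ≤ L * (κ * wnorm Λ (x' - x) ^ 2) := by gcongr
        _ = _ := by rw [hl]; ring
    have h6 := sq_nonneg (wnorm Λ (x' - x))
    linarith
  have hcrit' : crit f φ Λ (z + s) = ‖J u + (J γ + J s - J (x' - x))‖ := by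
    rw [crit_eq hΛ, hJn, ← map_add, ← map_sub, ← map_add]
    congr 2
    have : normalMap f φ Λ (z + s) = Λ (u + (γ + s - (x' - x))) := by
      simp only [map_add, map_sub, hΛu, hΛγ]
      simp only [normalMap, ← hx, ← hx', map_sub, map_add]
      abel
    rw [this, hΛ.inverse_apply]
  have hgap' : ∀ δ Δ : ℝ,
      c₀ * Δ ^ 2 ≤ τ / 2 * Δ ^ 2 + (1 - τ - ν') * δ ^ 2 - τ * l * δ * Δ := by
    intro δ Δ
    have h1 := hgap δ Δ
    have h2 : ν' * δ ^ 2 ≤ ν * δ ^ 2 := by gcongr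
    linarith
  have hmain := decrease_of_short_step (u := J u) (w := J w) (s := J s) (d := J (x' - x))
    (γ := J γ) hτ0 hτ1 hν'0 (hν'.trans hν₁.le) hl0 hl0 hc₀ hC hΔ hgap'
    (by rw [← hJn]; exact hw) (by rw [← hJn, ← hχ]; exact hΔ1) hsJ hdJ
    (by rw [← hJn, ← hJn]; exact hγn) hψ
  rw [← hK, ← hcrit', ← hJn, ← hJn, ← hχ] at hmain
  have hpred : pred f φ Λ τ z s Δ ν'
      ≤ τ / 2 * χ * Δ + ν' * χ / Δ * wnorm Λ (x' - x) ^ 2 := by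
    simp only [pred, ← hχdef, ← hx, ← hx']
    rw [min_eq_left hΔχ]
    gcongr
    exact min_le_right _ _
  have hfin : K * Δ ^ 2 ≤ c₀ * χ * Δ := by
    calc K * Δ ^ 2 = K * Δ * Δ := by ring
      _ ≤ c₀ * χ * Δ := by gcongr
  simp only [merit, ← hx, ← hx', ← hχdef]
  linarith

end SufficientDecrease

/-! ### Successful iterations, radii and criticality of the limit. -/

section GlobalConvergence

variable {n : ℕ} {f : Vec n → ℝ} {φ : Vec n → EReal} {Λ : Mat n} {P : Params} {T : Trace n}
  {L : ℝ≥0} {ν : ℝ}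

theorem continuous_gradient (hf : ContDiff ℝ 1 f) : Continuous (gradient f) :=
  (InnerProductSpace.toDual ℝ (Vec n)).symm.continuous.comp (hf.continuous_fderiv one_ne_zero)

theorem continuous_normalMap (hf : ContDiff ℝ 1 f) (hφ : IsConvexLscProper φ) (hΛ : IsSPD Λ) :
    Continuous (normalMap f φ Λ) :=
  ((continuous_gradient hf).comp (continuous_prox hφ hΛ)).add
    (Λ.continuous.comp (continuous_id.sub (continuous_prox hφ hΛ)))

theorem continuous_crit (hf : ContDiff ℝ 1 f) (hφ : IsConvexLscProper φ) (hΛ : IsSPD Λ) :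
    Continuous (crit f φ Λ) :=
  (continuous_wnorm _).comp (continuous_normalMap hf hφ hΛ)

theorem merit_eq (τ : ℝ) (z : Vec n) :
    merit f φ Λ τ z = f (prox φ Λ z) + (envelope φ Λ z - wnorm Λ (z - prox φ Λ z) ^ 2 / 2)
      + τ / 2 * crit f φ Λ z ^ 2 := by
  rw [merit, envelope]; ring

/-- `φ` is only lower semicontinuous, but `φ ∘ prox` is the Moreau envelope minus a continuous
quadratic term. -/
theorem continuous_merit (hf : ContDiff ℝ 1 f) (hφ : IsConvexLscProper φ) (hΛ : IsSPD Λ) (τ : ℝ) :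
    Continuous (merit f φ Λ τ) := by
  have h1 := continuous_prox hφ hΛ
  have h2 : Continuous (envelope φ Λ) := continuous_iff_continuousAt.2 fun z =>
    (hasGradientAt_envelope hφ hΛ z).differentiableAt.continuousAt
  have h3 := continuous_crit hf hφ hΛ
  have h4 := continuous_wnorm Λ
  have h5 := hf.continuous
  refine Continuous.congr ?_ fun z => (merit_eq τ z).symm
  fun_prop

/-- The assumptions under which the method is globally convergent. -/
structure GlobalAssumptions (f : Vec n → ℝ) (φ : Vec n → EReal) (Λ : Mat n) (P : Params)
    (T : Trace n) (L : ℝ≥0) (ν : ℝ) : Prop where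
  smooth : ContDiff ℝ 1 f
  convex : IsConvexLscProper φ
  spd : IsSPD Λ
  admissible : P.Admissible
  run : IsRun f φ Λ P T
  Δmin_pos : 0 < P.Δmin
  lipschitz : LipschitzOnWith L (gradient f) (effDom φ)
  ν_lt : ν < 1
  ν_mem : ∀ k, 0 ≤ T.ν k ∧ T.ν k ≤ ν
  τ_small : P.τ * ((L : ℝ) ^ 2 + 2 * ‖Λ.inverse‖⁻¹ ^ 2) < 2 * ‖Λ.inverse‖⁻¹ ^ 2 * (1 - ν)
  bounded : ∃ κB : ℝ, ∀ k, ‖T.B k‖ ≤ κB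

namespace GlobalAssumptions

theorem radius_pos (h : GlobalAssumptions f φ Λ P T L ν) (k : ℕ) : 0 < T.Δ k := by
  have hP := h.admissible
  induction k with
  | zero => exact h.run.radius_pos
  | succ k ih =>
    obtain ⟨h1, h2, h3⟩ := h.run.radius k
    rcases lt_or_ge (T.rho f φ Λ P k) P.η₁ with c1 | c1
    · exact (mul_pos hP.γ₀_pos ih).trans (h1 c1).1
    rcases lt_or_ge (T.rho f φ Λ P k) P.η₂ with c2 | c2
    · exact (mul_pos (hP.γ₀_pos.trans hP.γ₀_lt) ih).trans_le (h2 c1 c2).1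
    · exact ih.trans (h3 c2).1

theorem radius_succ_ge (h : GlobalAssumptions f φ Λ P T L ν) {k : ℕ}
    (hk : k ∈ T.succSet f φ Λ P) : P.Δmin ≤ T.Δ (k + 1) := by
  obtain ⟨-, h2, h3⟩ := h.run.radius k
  rcases lt_or_ge (T.rho f φ Λ P k) P.η₂ with c2 | c2
  · exact (h2 hk c2).2.2
  · exact (h3 c2).2.2

theorem exists_norm_M_le (h : GlobalAssumptions f φ Λ P T L ν) :
    ∃ C : ℝ, 0 ≤ C ∧ ∀ k, ‖T.M Λ k‖ ≤ C := by
  obtain ⟨κ, hκ⟩ := h.bounded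
  obtain ⟨K, hK0, hK⟩ := exists_norm_clarke_prox_le h.convex h.spd
  have hκ0 : 0 ≤ κ := (norm_nonneg _).trans (hκ 0)
  refine ⟨κ * K + ‖Λ‖ * (1 + K), by positivity, fun k => ?_⟩
  have hD := hK _ _ (h.run.genDeriv k)
  calc ‖T.M Λ k‖ ≤ ‖T.B k ∘L T.D k‖ + ‖Λ ∘L (ContinuousLinearMap.id ℝ (Vec n) - T.D k)‖ :=
        norm_add_le _ _
    _ ≤ ‖T.B k‖ * ‖T.D k‖ + ‖Λ‖ * ‖ContinuousLinearMap.id ℝ (Vec n) - T.D k‖ := by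
        gcongr <;> exact ContinuousLinearMap.opNorm_comp_le _ _
    _ ≤ κ * K + ‖Λ‖ * (1 + K) := by
        gcongr
        · exact hκ k
        · refine (norm_sub_le _ _).trans ?_
          gcongr
          exact ContinuousLinearMap.norm_id_le

theorem crit_pos (h : GlobalAssumptions f φ Λ P T L ν) (k : ℕ) : 0 < crit f φ Λ (T.z k) :=
  TRSSN.crit_pos h.spd (h.run.noTermination k)

theorem pred_pos (h : GlobalAssumptions f φ Λ P T L ν) (k : ℕ) :
    0 < pred f φ Λ P.τ (T.z k) (T.s f φ Λ k) (T.Δ k) (T.ν k) :=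
  TRSSN.pred_pos h.admissible.τ_pos (h.radius_pos k) (h.ν_mem k).1 (h.crit_pos k)

/-- Iterations whose radius is small compared to the criticality measure are successful. -/
theorem exists_success_of_radius_le (h : GlobalAssumptions f φ Λ P T L ν) :
    ∃ c : ℝ, 0 < c ∧ ∀ k, T.Δ k ≤ c * crit f φ Λ (T.z k) → k ∈ T.succSet f φ Λ P := by
  obtain ⟨CM, hCM0, hCM⟩ := h.exists_norm_M_le
  have hP := h.admissible
  set C := √‖Λ‖ * (1 + ‖Λ.inverse‖ * CM) with hC
  have hC0 : 0 ≤ C := by positivity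
  obtain ⟨c, hc, hmain⟩ := exists_pred_le_merit_sub h.smooth h.convex h.spd hP.τ_pos hP.τ_lt
    h.lipschitz h.ν_lt h.τ_small hC0
  refine ⟨c, hc, fun k hk => ?_⟩
  have hΔ := h.radius_pos k
  have hq : ‖T.q k‖ ≤ T.Δ k := (h.run.cg k).norm_le hΔ.le
  set w := T.q k - Λ.inverse (T.M Λ k (T.q k)) with hw
  have hsbar : T.sbar f φ Λ k = w - Λ.inverse (normalMap f φ Λ (T.z k)) := by
    rw [Trace.sbar, hw, map_add]; abel
  have hwn : wnorm Λ w ≤ C * T.Δ k := by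
    refine (wnorm_le Λ w).trans ?_
    rw [hC, mul_assoc]
    gcongr
    calc ‖w‖ ≤ ‖T.q k‖ + ‖Λ.inverse (T.M Λ k (T.q k))‖ := norm_sub_le _ _
      _ ≤ T.Δ k + ‖Λ.inverse‖ * (CM * T.Δ k) := by
          gcongr
          refine (Λ.inverse.le_opNorm _).trans ?_
          gcongr
          refine ((T.M Λ k).le_opNorm _).trans ?_
          gcongr
          exact hCM k
      _ = _ := by ring
  have h1 := hmain (T.z k) w (T.s f φ Λ k) (T.Δ k) (T.ν k) hΔ (h.ν_mem k).1 (h.ν_mem k).2 hwn hk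
    (by rw [← hsbar]; rfl)
  change P.η₁ ≤ T.rho f φ Λ P k
  rw [Trace.rho, le_div_iff₀ (h.pred_pos k)]
  refine le_trans ?_ h1
  exact mul_le_of_le_one_left (h.pred_pos k).le (hP.η₁_le.trans hP.η₂_lt.le)

/-- After a success the radius is at least `Δmin`. After a failure `Δ_k > cχ(z_k)` had to hold, the
iterate is unchanged, and the radius shrinks by no more than `γ₀`. The index starts at 1 because
`Δ₀` is arbitrary. -/
theorem exists_radius_lower_bound (h : GlobalAssumptions f φ Λ P T L ν) :
    ∃ c : ℝ, 0 < c ∧ ∀ k, min P.Δmin (c * crit f φ Λ (T.z (k + 1))) ≤ T.Δ (k + 1) := by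
  obtain ⟨c, hc, hs⟩ := h.exists_success_of_radius_le
  refine ⟨P.γ₀ * c, mul_pos h.admissible.γ₀_pos hc, fun k => ?_⟩
  by_cases hk : k ∈ T.succSet f φ Λ P
  · exact (min_le_left _ _).trans (h.radius_succ_ge hk)
  · have hk' : T.rho f φ Λ P k < P.η₁ := not_le.1 hk
    refine (min_le_right _ _).trans ?_
    rw [(h.run.reject k hk').1, mul_assoc]
    have h1 : c * crit f φ Λ (T.z k) ≤ T.Δ k := by
      by_contra hcon
      exact hk (hs k (not_le.1 hcon).le)
    exact (mul_le_mul_of_nonneg_left h1 h.admissible.γ₀_pos.le).trans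
      ((h.run.radius k).1 hk').1.le

/-- Perpetual rejection would freeze `z_k`, hence `χ > 0`, while the radius decays geometrically
below `cχ`. -/
theorem exists_success_ge (h : GlobalAssumptions f φ Λ P T L ν) (K : ℕ) :
    ∃ k ≥ K, k ∈ T.succSet f φ Λ P := by
  by_contra! hcon
  have hrej : ∀ k ≥ K, T.rho f φ Λ P k < P.η₁ := fun k hk => not_le.1 (hcon k hk)
  have hz : ∀ j, T.z (K + j) = T.z K := by
    intro j
    induction j with
    | zero => rfl
    | succ j ih => rw [← add_assoc, (h.run.reject _ (hrej _ (by omega))).1, ih]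
  have hΔ : ∀ j, T.Δ (K + j) ≤ P.γ₁ ^ j * T.Δ K := by
    intro j
    induction j with
    | zero => simp
    | succ j ih =>
      have h1 := ((h.run.radius (K + j)).1 (hrej _ (by omega))).2
      rw [← add_assoc, pow_succ]
      have h0 : 0 ≤ P.γ₁ := (h.admissible.γ₀_pos.trans h.admissible.γ₀_lt).le
      calc T.Δ (K + j + 1) ≤ P.γ₁ * T.Δ (K + j) := h1
        _ ≤ P.γ₁ * (P.γ₁ ^ j * T.Δ K) := by gcongr
        _ = _ := by ring
  obtain ⟨c, hc, hs⟩ := h.exists_success_of_radius_le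
  have h0 : 0 ≤ P.γ₁ := (h.admissible.γ₀_pos.trans h.admissible.γ₀_lt).le
  have hlim : Tendsto (fun j => P.γ₁ ^ j * T.Δ K) atTop (𝓝 (0 * T.Δ K)) :=
    (tendsto_pow_atTop_nhds_zero_of_lt_one h0 h.admissible.γ₁_lt).mul_const _
  rw [zero_mul] at hlim
  have hpos : 0 < c * crit f φ Λ (T.z K) := mul_pos hc (h.crit_pos K)
  obtain ⟨j, hj⟩ := (hlim.eventually (gt_mem_nhds hpos)).exists
  refine hcon (K + j) (by omega) (hs _ ?_)
  rw [hz]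
  exact (hΔ j).trans hj.le

theorem merit_decrease (h : GlobalAssumptions f φ Λ P T L ν) {k : ℕ}
    (hk : k ∈ T.succSet f φ Λ P) :
    P.η₁ * (P.τ / 2 * crit f φ Λ (T.z k) * min 1 (min (T.Δ k) (crit f φ Λ (T.z k))))
      ≤ merit f φ Λ P.τ (T.z k) - merit f φ Λ P.τ (T.z (k + 1)) := by
  have h1 : P.η₁ ≤ T.rho f φ Λ P k := hk
  rw [h.run.accept k h1]
  rw [Trace.rho, le_div_iff₀ (h.pred_pos k)] at h1
  refine le_trans ?_ h1
  refine mul_le_mul_of_nonneg_left ?_ h.admissible.η₁_pos.le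
  rw [pred]
  have := h.radius_pos k
  have := h.crit_pos k
  have := (h.ν_mem k).1
  refine le_add_of_nonneg_right ?_
  positivity

theorem merit_antitone (h : GlobalAssumptions f φ Λ P T L ν) :
    Antitone fun k => merit f φ Λ P.τ (T.z k) := by
  refine antitone_nat_of_succ_le fun k => ?_
  by_cases hk : k ∈ T.succSet f φ Λ P
  · have h1 := h.merit_decrease hk
    have := h.radius_pos k
    have := h.crit_pos k
    have := h.admissible.η₁_pos
    have := h.admissible.τ_pos
    have : 0 ≤ P.η₁ * (P.τ / 2 * crit f φ Λ (T.z k) *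
        min 1 (min (T.Δ k) (crit f φ Λ (T.z k)))) := by
      positivity
    linarith
  · rw [(h.run.reject k (not_le.1 hk)).1]

/-- Limits of the iterates are zeros of the normal map. -/
theorem normalMap_limit_eq_zero (h : GlobalAssumptions f φ Λ P T L ν) {zbar : Vec n}
    (hconv : Tendsto T.z atTop (𝓝 zbar)) : normalMap f φ Λ zbar = 0 := by
  by_contra hne
  have hχ := TRSSN.crit_pos h.spd hne
  set χ := crit f φ Λ zbar with hχdef
  obtain ⟨c, hc, hlow⟩ := h.exists_radius_lower_bound
  have hlim : Tendsto (fun k => crit f φ Λ (T.z k)) atTop (𝓝 χ) :=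
    ((continuous_crit h.smooth h.convex h.spd).tendsto zbar).comp hconv
  have hH : Tendsto (fun k => merit f φ Λ P.τ (T.z k)) atTop (𝓝 (merit f φ Λ P.τ zbar)) :=
    ((continuous_merit h.smooth h.convex h.spd P.τ).tendsto zbar).comp hconv
  have hdiff : Tendsto (fun k => merit f φ Λ P.τ (T.z k) - merit f φ Λ P.τ (T.z (k + 1)))
      atTop (𝓝 0) := by
    simpa using hH.sub (hH.comp (tendsto_add_atTop_nat 1))
  have hη := h.admissible.η₁_pos
  have hτ := h.admissible.τ_pos
  have hΔm := h.Δmin_pos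
  -- If `χ(z̄) > 0`, every late success lowers the merit function by at least this fixed amount,
  -- although its decrements tend to zero.
  set δ := P.η₁ * (P.τ / 2 * (χ / 2) * min 1 (min (min P.Δmin (c * (χ / 2))) (χ / 2))) with hδ
  have hδpos : 0 < δ := by positivity
  obtain ⟨K, hK⟩ := eventually_atTop.1
    ((hdiff.eventually (gt_mem_nhds hδpos)).and
      (hlim.eventually (lt_mem_nhds (half_lt_self hχ))))
  obtain ⟨k, hk, hks⟩ := h.exists_success_ge (K + 1)
  obtain ⟨h1, h2⟩ := hK k (by omega)
  have h3 := h.merit_decrease hks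
  obtain ⟨j, rfl⟩ : ∃ j, k = j + 1 := ⟨k - 1, by omega⟩
  have h4 := hlow j
  have h5 : δ ≤ P.η₁ * (P.τ / 2 * crit f φ Λ (T.z (j + 1)) *
      min 1 (min (T.Δ (j + 1)) (crit f φ Λ (T.z (j + 1))))) := by
    rw [hδ]
    have h6 : min P.Δmin (c * (χ / 2)) ≤ T.Δ (j + 1) := le_trans (by gcongr) h4
    have h7 : 0 ≤ P.τ / 2 * crit f φ Λ (T.z (j + 1)) :=
      mul_nonneg (by positivity) (h.crit_pos _).le
    gcongr
  linarith

end GlobalAssumptions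

end GlobalConvergence

/-! ### The Newton system and the residual of the lifted step. -/

section NewtonStep

variable {n : ℕ}

theorem apply_eq_zero_of_inner_eq_zero {S : Mat n}
    (hsymm : ∀ u v : Vec n, inner ℝ u (S v) = inner ℝ v (S u))
    (hpsd : ∀ v : Vec n, 0 ≤ inner ℝ v (S v)) {w : Vec n} (hw : inner ℝ w (S w) = 0) :
    S w = 0 := by
  by_contra hne
  set y := S w with hy
  have hy0 : 0 < inner ℝ y y := real_inner_self_pos.2 hne
  have hb := hpsd y
  set b := inner ℝ y (S y) with hbdef
  have key : ∀ t : ℝ, 0 ≤ -2 * t * inner ℝ y y + t ^ 2 * b := by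
    intro t
    have h1 := hpsd (w - t • y)
    have h2 : inner ℝ w (S y) = inner ℝ y y := hsymm w y
    simp only [map_sub, map_smul, inner_sub_left, inner_sub_right, inner_smul_left,
      inner_smul_right, conj_trivial, hw, h2, ← hy, ← hbdef] at h1
    linarith
  -- A value of `t` making the quadratic negative; the added 1 covers `b = 0`.
  have h1 := key (inner ℝ y y / (b + 1))
  have hpos : 0 < b + 1 := by linarith
  have h2 : -2 * (inner ℝ y y / (b + 1)) * inner ℝ y y + (inner ℝ y y / (b + 1)) ^ 2 * b
      = -(inner ℝ y y) ^ 2 * (b + 2) / (b + 1) ^ 2 := by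
    field_simp
    ring
  rw [h2] at h1
  have h3 : 0 < (inner ℝ y y) ^ 2 * (b + 2) / (b + 1) ^ 2 := by positivity
  rw [neg_mul, neg_div] at h1
  linarith

variable {f : Vec n → ℝ} {φ : Vec n → EReal} {Λ : Mat n}

/-- Symmetry of `ΛD` says `Dᵀ = ΛDΛ⁻¹`. -/
theorem adjoint_clarke_prox (hφ : IsConvexLscProper φ) (hΛ : IsSPD Λ) {z : Vec n} {D : Mat n}
    (hD : D ∈ clarke (prox φ Λ) z) (y : Vec n) :
    Λ (D (Λ.inverse y)) = ContinuousLinearMap.adjoint D y := by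
  refine ext_inner_left ℝ fun u => ?_
  rw [inner_clarke_prox_symm hφ hΛ hD, hΛ.inner_comm, hΛ.apply_inverse,
    ContinuousLinearMap.adjoint_inner_right, real_inner_comm]

/-- `M = B D + Λ (I - D)`. -/
noncomputable def newtonMatrix (Λ B D : Mat n) : Mat n :=
  B ∘L D + Λ ∘L (ContinuousLinearMap.id ℝ (Vec n) - D)

theorem newtonMatrix_apply (Λ B D : Mat n) (v : Vec n) :
    newtonMatrix Λ B D v = B (D v) + (Λ v - Λ (D v)) := by
  simp [newtonMatrix]

theorem inner_adjoint_newtonMatrix (hΛ : IsSPD Λ) (B D : Mat n) (u v : Vec n) :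
    inner ℝ u ((ContinuousLinearMap.adjoint D ∘L newtonMatrix Λ B D) v)
      = inner ℝ (D u) (B (D v)) + inner ℝ v (Λ (D u)) - inner ℝ (D u) (Λ (D v)) := by
  rw [ContinuousLinearMap.comp_apply, ContinuousLinearMap.adjoint_inner_right,
    newtonMatrix_apply, inner_add_right, inner_sub_right, hΛ.inner_comm (D u) v,
    real_inner_comm v]
  ring

/-- Symmetry comes from `DᵀM = DᵀBD + DᵀΛ - DᵀΛD` and `DᵀΛ = ΛD`. If the form vanishes at `y = Sv`,
semidefiniteness gives `Sy = 0`, so `‖y‖² = ⟨v, Sy⟩ = 0`. The preimage of `DᵀF` is `M⁻¹F`. -/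
theorem cgCompatible_newtonMatrix (hφ : IsConvexLscProper φ) (hΛ : IsSPD Λ) {z : Vec n}
    {B D : Mat n} (hB : IsSelfAdjoint B) (hD : D ∈ clarke (prox φ Λ) z)
    (hpsd : ∀ h : Vec n, 0 ≤ inner ℝ h (ContinuousLinearMap.adjoint D (newtonMatrix Λ B D h)))
    (hinv : (newtonMatrix Λ B D).IsInvertible) (F : Vec n) :
    CGCompatible (ContinuousLinearMap.adjoint D ∘L newtonMatrix Λ B D)
      (ContinuousLinearMap.adjoint D F) := by
  have hsymm : ∀ u v : Vec n,
      inner ℝ u ((ContinuousLinearMap.adjoint D ∘L newtonMatrix Λ B D) v)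
        = inner ℝ v ((ContinuousLinearMap.adjoint D ∘L newtonMatrix Λ B D) u) := by
    intro u v
    rw [inner_adjoint_newtonMatrix hΛ, inner_adjoint_newtonMatrix hΛ,
      inner_clarke_prox_symm hφ hΛ hD u v, hΛ.inner_comm (D u) (D v),
      real_inner_comm (D v) (Λ (D u))]
    have h1 : inner ℝ (D u) (B (D v)) = inner ℝ (D v) (B (D u)) := by
      have := ContinuousLinearMap.adjoint_inner_right B (D u) (D v)
      rw [(ContinuousLinearMap.isSelfAdjoint_iff').1 hB] at this
      rw [this, real_inner_comm]
    rw [h1]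
  refine ⟨hsymm, fun v hv => ?_, (newtonMatrix Λ B D).inverse F, ?_⟩
  · refine lt_of_le_of_ne (hpsd _) fun h0 => hv ?_
    have h1 := apply_eq_zero_of_inner_eq_zero hsymm hpsd h0.symm
    have h2 := hsymm ((ContinuousLinearMap.adjoint D ∘L newtonMatrix Λ B D) v) v
    rw [h1, inner_zero_right] at h2
    exact inner_self_eq_zero.1 h2
  · rw [ContinuousLinearMap.comp_apply, hinv.self_apply_inverse]

/-- The lifted step solves the Newton equation up to the residual of the CG method. -/
theorem newtonMatrix_liftedStep (hφ : IsConvexLscProper φ) (hΛ : IsSPD Λ) {z : Vec n}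
    {B D : Mat n} (hD : D ∈ clarke (prox φ Λ) z) (F q : Vec n) :
    newtonMatrix Λ B D (q - Λ.inverse (F + newtonMatrix Λ B D q)) + F
      = ContinuousLinearMap.adjoint D (F + newtonMatrix Λ B D q)
        - B (Λ.inverse (ContinuousLinearMap.adjoint D (F + newtonMatrix Λ B D q))) := by
  rw [map_sub]
  set y := F + newtonMatrix Λ B D q with hy
  -- In `y - MΛ⁻¹y` the term `ΛΛ⁻¹y` cancels `y`; what remains is `ΛDΛ⁻¹y - BDΛ⁻¹y`, and `Dᵀ =
  -- ΛDΛ⁻¹` expresses both parts through the CG residual `Dᵀy`.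
  rw [newtonMatrix_apply Λ B D (Λ.inverse y), ← adjoint_clarke_prox hφ hΛ hD, hΛ.apply_inverse,
    hΛ.inverse_apply, hy]
  abel

/-- `-M⁻¹F` solves the projected system and lies strictly inside the trust region, so CG stops with
residual at most `ε`. -/
theorem norm_newtonMatrix_liftedStep_le (hφ : IsConvexLscProper φ) (hΛ : IsSPD Λ) {z : Vec n}
    {B D : Mat n} (hB : IsSelfAdjoint B) (hD : D ∈ clarke (prox φ Λ) z)
    (hpsd : ∀ h : Vec n, 0 ≤ inner ℝ h (ContinuousLinearMap.adjoint D (newtonMatrix Λ B D h)))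
    (hinv : (newtonMatrix Λ B D).IsInvertible) {F q : Vec n} {ε Δ : ℝ} (hε : 0 ≤ ε)
    (hΔ : ‖(newtonMatrix Λ B D).inverse‖ * ‖F‖ < Δ)
    (hcg : SteihaugCG (ContinuousLinearMap.adjoint D ∘L newtonMatrix Λ B D)
      (ContinuousLinearMap.adjoint D F) ε Δ q) :
    ‖newtonMatrix Λ B D (q - Λ.inverse (F + newtonMatrix Λ B D q)) + F‖
      ≤ (1 + ‖B‖ * ‖Λ.inverse‖) * ε := by
  have hs : (ContinuousLinearMap.adjoint D ∘L newtonMatrix Λ B D)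
      (-(newtonMatrix Λ B D).inverse F) = -ContinuousLinearMap.adjoint D F := by
    rw [ContinuousLinearMap.comp_apply, map_neg, map_neg, hinv.self_apply_inverse]
  have hsΔ : ‖-(newtonMatrix Λ B D).inverse F‖ < Δ := by
    rw [norm_neg]
    exact (ContinuousLinearMap.le_opNorm _ _).trans_lt hΔ
  have hr := (cgCompatible_newtonMatrix hφ hΛ hB hD hpsd hinv F).norm_residual_le hε hs hsΔ hcg
  rw [ContinuousLinearMap.comp_apply, ← map_add] at hr
  rw [newtonMatrix_liftedStep hφ hΛ hD]
  set r := ContinuousLinearMap.adjoint D (F + newtonMatrix Λ B D q)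
  calc ‖r - B (Λ.inverse r)‖ ≤ ‖r‖ + ‖B (Λ.inverse r)‖ := norm_sub_le _ _
    _ ≤ ‖r‖ + ‖B‖ * (‖Λ.inverse‖ * ‖r‖) := by
        gcongr
        refine (B.le_opNorm _).trans ?_
        gcongr
        exact Λ.inverse.le_opNorm _
    _ = (1 + ‖B‖ * ‖Λ.inverse‖) * ‖r‖ := by ring
    _ ≤ _ := by gcongr

/-- Splits the Newton residual into the semismoothness, Dennis-Moré and Taylor remainders, which are
estimated separately. -/
theorem newtonMatrix_sub_normalMap {zbar : Vec n} (h0 : normalMap f φ Λ zbar = 0) (B D : Mat n)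
    (z : Vec n) :
    newtonMatrix Λ B D (z - zbar) - normalMap f φ Λ z
      = (B - Λ) (D (z - zbar) - (prox φ Λ z - prox φ Λ zbar))
        + (B - hess f (prox φ Λ z)) (prox φ Λ z - prox φ Λ zbar)
        - (gradient f (prox φ Λ z) - gradient f (prox φ Λ zbar)
          - hess f (prox φ Λ z) (prox φ Λ z - prox φ Λ zbar)) := by
  have h1 : normalMap f φ Λ z = normalMap f φ Λ z - normalMap f φ Λ zbar := by
    rw [h0, sub_zero]
  rw [h1, newtonMatrix_apply]
  simp only [normalMap, map_sub, sub_apply]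
  abel

end NewtonStep

/-! ### Superlinear contraction of full Newton steps. -/

section LocalAnalysis

variable {n : ℕ} {f : Vec n → ℝ} {φ : Vec n → EReal} {Λ : Mat n} {P : Params} {T : Trace n}
  {L : ℝ≥0} {ν : ℝ} {zbar : Vec n} {κM : ℝ} {K : ℕ}

/-- The assumptions under which the method is locally superlinearly convergent. -/
structure LocalAssumptions (f : Vec n → ℝ) (φ : Vec n → EReal) (Λ : Mat n) (P : Params)
    (T : Trace n) (L : ℝ≥0) (ν : ℝ) (zbar : Vec n) (κM : ℝ) (K : ℕ) : Prop
    extends GlobalAssumptions f φ Λ P T L ν where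
  conv : Tendsto T.z atTop (𝓝 zbar)
  hess_diff : ∀ x ∈ effDom φ, DifferentiableAt ℝ (gradient f) x
  hess_cont : ContinuousOn (hess f) (effDom φ)
  semismooth : SemismoothAt (prox φ Λ) zbar
  κM_pos : 0 < κM
  psd : ∀ k ≥ K, ∀ h : Vec n, 0 ≤ inner ℝ h (ContinuousLinearMap.adjoint (T.D k) (T.M Λ k h))
  inv : ∀ k ≥ K, (T.M Λ k).IsInvertible
  inv_le : ∀ k ≥ K, ‖(T.M Λ k).inverse‖ ≤ κM
  dennis_more : Tendsto (fun k => ‖(T.B k - hess f (T.x φ Λ k)) (T.x φ Λ k - prox φ Λ zbar)‖ /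
    ‖T.z k - zbar‖) atTop (𝓝 0)
  tol : T.ε =o[atTop] fun k => normalMap f φ Λ (T.z k)

namespace LocalAssumptions

theorem normalMap_eq_zero (h : LocalAssumptions f φ Λ P T L ν zbar κM K) :
    normalMap f φ Λ zbar = 0 :=
  h.toGlobalAssumptions.normalMap_limit_eq_zero h.conv

theorem sub_ne_zero (h : LocalAssumptions f φ Λ P T L ν zbar κM K) (k : ℕ) :
    T.z k - zbar ≠ 0 := fun h0 =>
  h.run.noTermination k (by rw [_root_.sub_eq_zero.1 h0, h.normalMap_eq_zero])

theorem tendsto_sub (h : LocalAssumptions f φ Λ P T L ν zbar κM K) :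
    Tendsto (fun k => T.z k - zbar) atTop (𝓝 0) := by
  simpa using h.conv.sub_const zbar

theorem prox_sub_isBigO (h : LocalAssumptions f φ Λ P T L ν zbar κM K) :
    (fun k => T.x φ Λ k - prox φ Λ zbar) =O[atTop] fun k => T.z k - zbar := by
  obtain ⟨C, -, hC⟩ := exists_norm_prox_sub_le h.convex h.spd
  exact IsBigO.of_bound C (Eventually.of_forall fun k => hC _ _)

theorem tendsto_prox (h : LocalAssumptions f φ Λ P T L ν zbar κM K) :
    Tendsto (T.x φ Λ) atTop (𝓝 (prox φ Λ zbar)) :=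
  ((continuous_prox h.convex h.spd).tendsto zbar).comp h.conv

theorem tendsto_hess (h : LocalAssumptions f φ Λ P T L ν zbar κM K) :
    Tendsto (fun k => hess f (T.x φ Λ k)) atTop (𝓝 (hess f (prox φ Λ zbar))) := by
  have h1 := h.hess_cont _ (prox_mem_effDom h.convex h.spd zbar)
  exact h1.tendsto.comp (tendsto_nhdsWithin_iff.2
    ⟨h.tendsto_prox, Eventually.of_forall fun k => prox_mem_effDom h.convex h.spd _⟩)

/-- Differentiability at `x̄` handles the expansion with the fixed matrix `∇²f(x̄)`; continuity of
the Hessian on `dom φ` permits replacing it by `∇²f(x_k)`. -/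
theorem gradient_remainder_isLittleO (h : LocalAssumptions f φ Λ P T L ν zbar κM K) :
    (fun k => gradient f (T.x φ Λ k) - gradient f (prox φ Λ zbar)
      - hess f (T.x φ Λ k) (T.x φ Λ k - prox φ Λ zbar)) =o[atTop] fun k => T.z k - zbar := by
  have h1 : (fun k => gradient f (T.x φ Λ k) - gradient f (prox φ Λ zbar)
      - hess f (prox φ Λ zbar) (T.x φ Λ k - prox φ Λ zbar))
      =o[atTop] fun k => T.x φ Λ k - prox φ Λ zbar :=
    (h.hess_diff _ (prox_mem_effDom h.convex h.spd zbar)).hasFDerivAt.isLittleO.comp_tendsto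
      h.tendsto_prox
  have h2 : (fun k => (hess f (prox φ Λ zbar) - hess f (T.x φ Λ k))
      (T.x φ Λ k - prox φ Λ zbar)) =o[atTop] fun k => T.x φ Λ k - prox φ Λ zbar := by
    have h3 : Tendsto (fun k => hess f (prox φ Λ zbar) - hess f (T.x φ Λ k)) atTop (𝓝 0) := by
      simpa using h.tendsto_hess.const_sub (hess f (prox φ Λ zbar))
    refine isLittleO_iff.2 fun c hc => ?_
    filter_upwards [h3.norm.eventually (gt_mem_nhds (by simpa using hc))] with k hk
    refine (ContinuousLinearMap.le_opNorm _ _).trans ?_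
    gcongr
  refine IsLittleO.trans_isBigO ?_ h.prox_sub_isBigO
  refine (h1.add h2).congr_left fun k => ?_
  simp only [sub_apply]
  abel

theorem semismooth_remainder_isLittleO (h : LocalAssumptions f φ Λ P T L ν zbar κM K) :
    (fun k => T.D k (T.z k - zbar) - (T.x φ Λ k - prox φ Λ zbar))
      =o[atTop] fun k => T.z k - zbar := by
  refine isLittleO_iff.2 fun c hc => ?_
  filter_upwards [h.tendsto_sub.eventually (h.semismooth.2 c hc)] with k hk
  have h1 := h.run.genDeriv k
  rw [← add_sub_cancel zbar (T.z k)] at h1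
  have h2 := hk _ h1
  rw [add_sub_cancel] at h2
  rw [← norm_neg, neg_sub]
  exact h2

theorem dennis_more_isLittleO (h : LocalAssumptions f φ Λ P T L ν zbar κM K) :
    (fun k => (T.B k - hess f (T.x φ Λ k)) (T.x φ Λ k - prox φ Λ zbar))
      =o[atTop] fun k => T.z k - zbar := by
  rw [← isLittleO_norm_norm, isLittleO_iff_tendsto]
  · exact h.dennis_more
  · intro k hk
    exact absurd (norm_eq_zero.1 hk) (h.sub_ne_zero k)

theorem exists_norm_B_sub_le (h : LocalAssumptions f φ Λ P T L ν zbar κM K) :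
    ∃ C : ℝ, 0 ≤ C ∧ ∀ k, ‖T.B k - Λ‖ ≤ C := by
  obtain ⟨κ, hκ⟩ := h.bounded
  have : 0 ≤ κ := (norm_nonneg _).trans (hκ 0)
  exact ⟨κ + ‖Λ‖, by positivity, fun k => (norm_sub_le _ _).trans (by gcongr; exact hκ k)⟩

/-- The Newton residual inherits any common bound on the three remainders. -/
theorem newton_residual_isBigO_of (h : LocalAssumptions f φ Λ P T L ν zbar κM K) {g : ℕ → ℝ}
    (h1 : (fun k => T.D k (T.z k - zbar) - (T.x φ Λ k - prox φ Λ zbar)) =O[atTop] g)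
    (h2 : (fun k => (T.B k - hess f (T.x φ Λ k)) (T.x φ Λ k - prox φ Λ zbar)) =O[atTop] g)
    (h3 : (fun k => gradient f (T.x φ Λ k) - gradient f (prox φ Λ zbar)
      - hess f (T.x φ Λ k) (T.x φ Λ k - prox φ Λ zbar)) =O[atTop] g) :
    (fun k => T.M Λ k (T.z k - zbar) - normalMap f φ Λ (T.z k)) =O[atTop] g := by
  obtain ⟨C, hC0, hC⟩ := h.exists_norm_B_sub_le
  have h4 : (fun k => (T.B k - Λ) (T.D k (T.z k - zbar) - (T.x φ Λ k - prox φ Λ zbar)))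
      =O[atTop] g := by
    refine IsBigO.trans (IsBigO.of_bound C (Eventually.of_forall fun k => ?_)) h1
    exact ((T.B k - Λ).le_opNorm _).trans (by gcongr; exact hC k)
  refine ((h4.add h2).sub h3).congr_left fun k => ?_
  exact (newtonMatrix_sub_normalMap h.normalMap_eq_zero (T.B k) (T.D k) (T.z k)).symm

theorem newton_residual_isLittleO (h : LocalAssumptions f φ Λ P T L ν zbar κM K) :
    (fun k => T.M Λ k (T.z k - zbar) - normalMap f φ Λ (T.z k))
      =o[atTop] fun k => T.z k - zbar := by
  obtain ⟨C, hC0, hC⟩ := h.exists_norm_B_sub_le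
  have h4 : (fun k => (T.B k - Λ) (T.D k (T.z k - zbar) - (T.x φ Λ k - prox φ Λ zbar)))
      =o[atTop] fun k => T.z k - zbar := by
    refine IsBigO.trans_isLittleO (IsBigO.of_bound C (Eventually.of_forall fun k => ?_))
      h.semismooth_remainder_isLittleO
    exact ((T.B k - Λ).le_opNorm _).trans (by gcongr; exact hC k)
  refine ((h4.add h.dennis_more_isLittleO).sub h.gradient_remainder_isLittleO).congr_left
    fun k => ?_
  exact (newtonMatrix_sub_normalMap h.normalMap_eq_zero (T.B k) (T.D k) (T.z k)).symm

theorem normalMap_isBigO (h : LocalAssumptions f φ Λ P T L ν zbar κM K) :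
    (fun k => normalMap f φ Λ (T.z k)) =O[atTop] fun k => T.z k - zbar := by
  obtain ⟨C, hC0, hC⟩ := h.exists_norm_M_le
  have h1 : (fun k => T.M Λ k (T.z k - zbar)) =O[atTop] fun k => T.z k - zbar := by
    refine IsBigO.of_bound C (Eventually.of_forall fun k => ?_)
    exact ((T.M Λ k).le_opNorm _).trans (by gcongr; exact hC k)
  exact (h1.sub h.newton_residual_isLittleO.isBigO).congr_left fun k => by abel

theorem norm_le_of_inverse (h : LocalAssumptions f φ Λ P T L ν zbar κM K) {k : ℕ} (hk : K ≤ k)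
    (v : Vec n) : ‖v‖ ≤ κM * ‖T.M Λ k v‖ := by
  have h1 := (T.M Λ k).inverse.le_opNorm (T.M Λ k v)
  rw [(h.inv k hk).inverse_apply_self] at h1
  exact h1.trans (by gcongr; exact h.inv_le k hk)

/-- A local error bound along the iterates: `‖v‖ ≤ κM‖M_k v‖ ≤ κM(‖F(z_k)‖ + o(‖v‖))` for `v = z_k -
z̄`. The factor `1/(2κM)` lets half of `‖v‖` be absorbed on the left. -/
theorem sub_isBigO_normalMap (h : LocalAssumptions f φ Λ P T L ν zbar κM K) :
    (fun k => T.z k - zbar) =O[atTop] fun k => normalMap f φ Λ (T.z k) := by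
  have hκ := h.κM_pos
  refine IsBigO.of_bound (2 * κM) ?_
  filter_upwards [eventually_ge_atTop K,
    isLittleO_iff.1 h.newton_residual_isLittleO (show 0 < 1 / (2 * κM) by positivity)] with k hk h1
  have h2 := h.norm_le_of_inverse hk (T.z k - zbar)
  have h3 : ‖T.M Λ k (T.z k - zbar)‖ ≤ ‖normalMap f φ Λ (T.z k)‖
      + ‖T.M Λ k (T.z k - zbar) - normalMap f φ Λ (T.z k)‖ := by
    have := norm_add_le (normalMap f φ Λ (T.z k))
      (T.M Λ k (T.z k - zbar) - normalMap f φ Λ (T.z k))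
    rwa [add_sub_cancel] at this
  have h4 : κM * ‖T.M Λ k (T.z k - zbar)‖
      ≤ κM * (‖normalMap f φ Λ (T.z k)‖ + 1 / (2 * κM) * ‖T.z k - zbar‖) := by gcongr; linarith
  have h5 : κM * (‖normalMap f φ Λ (T.z k)‖ + 1 / (2 * κM) * ‖T.z k - zbar‖)
      = κM * ‖normalMap f φ Λ (T.z k)‖ + ‖T.z k - zbar‖ / 2 := by field_simp
  linarith

theorem tol_isLittleO (h : LocalAssumptions f φ Λ P T L ν zbar κM K) :
    T.ε =o[atTop] fun k => T.z k - zbar :=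
  h.tol.trans_isBigO h.normalMap_isBigO

theorem tendsto_normalMap (h : LocalAssumptions f φ Λ P T L ν zbar κM K) :
    Tendsto (fun k => normalMap f φ Λ (T.z k)) atTop (𝓝 0) :=
  h.normalMap_isBigO.trans_tendsto h.tendsto_sub

/-- `M_k` applied to the new error is the Newton residual at `z_k` plus the residual of the lifted
step. For late `k` one has `κM‖F(z_k)‖ < Δmin`, which is where `Δ_k ≥ Δmin` enters. -/
theorem exists_newton_error_le (h : LocalAssumptions f φ Λ P T L ν zbar κM K) :
    ∃ C : ℝ, 0 ≤ C ∧ ∀ᶠ k in atTop, P.Δmin ≤ T.Δ k → ‖T.z k + T.sbar f φ Λ k - zbar‖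
      ≤ C * (‖T.M Λ k (T.z k - zbar) - normalMap f φ Λ (T.z k)‖ + T.ε k) := by
  obtain ⟨κ, hκ⟩ := h.bounded
  have hκ0 : 0 ≤ κ := (norm_nonneg _).trans (hκ 0)
  have hκM := h.κM_pos
  have hsmall : ∀ᶠ k in atTop, κM * ‖normalMap f φ Λ (T.z k)‖ < P.Δmin := by
    have h1 : Tendsto (fun k => κM * ‖normalMap f φ Λ (T.z k)‖) atTop (𝓝 0) := by
      simpa using h.tendsto_normalMap.norm.const_mul κM
    exact h1.eventually (gt_mem_nhds h.Δmin_pos)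
  refine ⟨κM * (1 + κ * ‖Λ.inverse‖), by positivity, ?_⟩
  filter_upwards [eventually_ge_atTop K, hsmall] with k hk hs hΔ
  have hε := h.run.tol_nonneg k
  have h1 : ‖T.M Λ k (T.sbar f φ Λ k) + normalMap f φ Λ (T.z k)‖
      ≤ (1 + ‖T.B k‖ * ‖Λ.inverse‖) * T.ε k :=
    norm_newtonMatrix_liftedStep_le h.convex h.spd (h.run.symm k) (h.run.genDeriv k) (h.psd k hk)
      (h.inv k hk) hε (lt_of_le_of_lt (mul_le_mul_of_nonneg_right (h.inv_le k hk) (norm_nonneg _))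
        (hs.trans_le hΔ)) (h.run.cg k)
  have h2 : (1 + ‖T.B k‖ * ‖Λ.inverse‖) * T.ε k ≤ (1 + κ * ‖Λ.inverse‖) * T.ε k := by
    gcongr; exact hκ k
  have h3 := h.norm_le_of_inverse hk (T.z k + T.sbar f φ Λ k - zbar)
  have h4 : T.M Λ k (T.z k + T.sbar f φ Λ k - zbar)
      = (T.M Λ k (T.z k - zbar) - normalMap f φ Λ (T.z k))
        + (T.M Λ k (T.sbar f φ Λ k) + normalMap f φ Λ (T.z k)) := by
    simp only [map_sub, map_add]; abel
  rw [h4] at h3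
  set R := ‖T.M Λ k (T.z k - zbar) - normalMap f φ Λ (T.z k)‖ with hR
  have hR0 : 0 ≤ R := norm_nonneg _
  have h6 : 0 ≤ κ * ‖Λ.inverse‖ := by positivity
  calc _ ≤ κM * (R + (1 + κ * ‖Λ.inverse‖) * T.ε k) := by
        refine h3.trans ?_
        gcongr
        exact (norm_add_le _ _).trans (by gcongr; exact h1.trans h2)
    _ ≤ κM * ((1 + κ * ‖Λ.inverse‖) * (R + T.ε k)) := by
        gcongr
        nlinarith [mul_nonneg h6 hR0]
    _ = _ := by ring

theorem eventually_step_eq (h : LocalAssumptions f φ Λ P T L ν zbar κM K) {c : ℝ} (hc : 0 < c) :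
    ∀ᶠ k in atTop, P.Δmin ≤ T.Δ k → T.s f φ Λ k = T.sbar f φ Λ k ∧
      ‖T.z k + T.s f φ Λ k - zbar‖ ≤ c * ‖T.z k - zbar‖ := by
  obtain ⟨C, hC0, hC⟩ := h.exists_newton_error_le
  -- Two terms with this constant, times `C + 1`, add up to `min c 1`. The cap 1 bounds `‖s̄_k‖` by
  -- `2‖z_k - z̄‖`, so that late steps are not scaled.
  have ho := isLittleO_iff.1 h.newton_residual_isLittleO
    (show 0 < min c 1 / (2 * (C + 1)) by positivity)
  have hoε := isLittleO_iff.1 h.tol_isLittleO (show 0 < min c 1 / (2 * (C + 1)) by positivity)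
  have hsmall : ∀ᶠ k in atTop, √‖Λ‖ * (2 * ‖T.z k - zbar‖) < P.Δmin := by
    have h1 : Tendsto (fun k => √‖Λ‖ * (2 * ‖T.z k - zbar‖)) atTop (𝓝 0) := by
      simpa using (h.tendsto_sub.norm.const_mul 2).const_mul √‖Λ‖
    exact h1.eventually (gt_mem_nhds h.Δmin_pos)
  filter_upwards [hC, ho, hoε, hsmall] with k h1 h2 h3 h4 hΔ
  have h5 := h1 hΔ
  rw [Real.norm_eq_abs, abs_of_nonneg (h.run.tol_nonneg k)] at h3
  have hz0 := norm_nonneg (T.z k - zbar)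
  have h6 : ‖T.z k + T.sbar f φ Λ k - zbar‖ ≤ min c 1 * ‖T.z k - zbar‖ := by
    refine h5.trans ?_
    calc C * (‖T.M Λ k (T.z k - zbar) - normalMap f φ Λ (T.z k)‖ + T.ε k)
        ≤ (C + 1) * (min c 1 / (2 * (C + 1)) * ‖T.z k - zbar‖
          + min c 1 / (2 * (C + 1)) * ‖T.z k - zbar‖) := by
          have := h.run.tol_nonneg k
          gcongr
          linarith
      _ = min c 1 * ‖T.z k - zbar‖ := by field_simp; ring
  have h7 : ‖T.sbar f φ Λ k‖ ≤ 2 * ‖T.z k - zbar‖ := by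
    have h8 : T.sbar f φ Λ k = (T.z k + T.sbar f φ Λ k - zbar) - (T.z k - zbar) := by abel
    rw [h8]
    refine (norm_sub_le _ _).trans ?_
    have : min c 1 * ‖T.z k - zbar‖ ≤ ‖T.z k - zbar‖ := mul_le_of_le_one_left hz0 (min_le_right _ _)
    linarith
  have h9 : wnorm Λ (T.sbar f φ Λ k) ≤ T.Δ k := by
    refine (wnorm_le Λ _).trans (le_trans ?_ hΔ)
    refine le_trans ?_ h4.le
    gcongr
  have h10 : T.s f φ Λ k = T.sbar f φ Λ k := by
    rw [Trace.s]
    rcases (wnorm_nonneg Λ (T.sbar f φ Λ k)).eq_or_lt' with h0 | h0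
    · have h11 : T.sbar f φ Λ k = 0 := by
        by_contra hne
        exact (h.spd.wnorm_pos hne).ne' h0
      rw [h11, smul_zero]
    · rw [min_eq_left ((one_le_div h0).2 h9), one_smul]
  refine ⟨h10, ?_⟩
  rw [h10]
  exact h6.trans (by gcongr; exact min_le_left _ _)

theorem gradient_remainder_isBigO_sq (h : LocalAssumptions f φ Λ P T L ν zbar κM K)
    (hL : ∃ K : ℝ≥0, ∃ U ∈ 𝓝 (prox φ Λ zbar), LipschitzOnWith K (hess f) (U ∩ effDom φ)) :
    (fun k => gradient f (T.x φ Λ k) - gradient f (prox φ Λ zbar)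
      - hess f (T.x φ Λ k) (T.x φ Λ k - prox φ Λ zbar))
      =O[atTop] fun k => ‖T.z k - zbar‖ ^ 2 := by
  obtain ⟨κ, U, hU, hLip⟩ := hL
  obtain ⟨r, hr, hball⟩ := Metric.mem_nhds_iff.1 hU
  set xb := prox φ Λ zbar with hxb
  have hxbd : xb ∈ effDom φ := prox_mem_effDom h.convex h.spd zbar
  have h1 : (fun k => gradient f (T.x φ Λ k) - gradient f xb
      - hess f (T.x φ Λ k) (T.x φ Λ k - xb))
      =O[atTop] fun k => ‖T.x φ Λ k - xb‖ ^ 2 := by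
    refine IsBigO.of_bound κ ?_
    filter_upwards [h.tendsto_prox.eventually (Metric.ball_mem_nhds xb hr)] with k hk
    have hxd : T.x φ Λ k ∈ effDom φ := prox_mem_effDom h.convex h.spd _
    -- The Hessian is Lipschitz only on part of `dom φ`; convexity keeps the whole segment there.
    have hconv : Convex ℝ (Metric.ball xb r ∩ effDom φ) :=
      (convex_ball _ _).inter h.convex.convex_effDom
    have hseg : segment ℝ xb (T.x φ Λ k) ⊆ Metric.ball xb r ∩ effDom φ :=
      hconv.segment_subset ⟨Metric.mem_ball_self hr, hxbd⟩ ⟨hk, hxd⟩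
    have hb : ∀ y ∈ segment ℝ xb (T.x φ Λ k),
        ‖hess f y - hess f (T.x φ Λ k)‖ ≤ κ * ‖T.x φ Λ k - xb‖ := by
      intro y hy
      have hyU := hseg hy
      refine (hLip.norm_sub_le ⟨hball hyU.1, hyU.2⟩ ⟨hball hk, hxd⟩).trans ?_
      gcongr
      rw [segment_eq_image'] at hy
      obtain ⟨θ, hθ, rfl⟩ := hy
      have : xb + θ • (T.x φ Λ k - xb) - T.x φ Λ k = (θ - 1) • (T.x φ Λ k - xb) := by module
      rw [this, norm_smul, Real.norm_eq_abs, abs_sub_comm, abs_of_nonneg (sub_nonneg.2 hθ.2)]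
      exact mul_le_of_le_one_left (norm_nonneg _) (by linarith [hθ.1])
    have h2 := Convex.norm_image_sub_le_of_norm_hasFDerivWithin_le' (f := gradient f)
      (fun y hy => (h.hess_diff y (hseg hy).2).hasFDerivAt.hasFDerivWithinAt) hb
      (convex_segment xb (T.x φ Λ k)) (left_mem_segment ℝ _ _) (right_mem_segment ℝ _ _)
    refine h2.trans (le_of_eq ?_)
    rw [Real.norm_eq_abs, abs_of_nonneg (sq_nonneg _)]
    ring
  exact h1.trans ((h.prox_sub_isBigO.norm_norm).pow 2)

/-- Newton steps inside the trust region are of order `1 + β`. -/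
theorem exists_newton_order (h : LocalAssumptions f φ Λ P T L ν zbar κM K) {β : ℝ} (hβ0 : 0 < β)
    (hβ1 : β ≤ 1) (hord : OrderSemismoothAt β (prox φ Λ) zbar) {E : Vec n → ℝ}
    (hE : E =O[𝓝 0] fun h : Vec n => ‖h‖ ^ (1 + β))
    (hε : ∀ k, T.ε k ≤ E (normalMap f φ Λ (T.z k)))
    (hB : ∀ k, T.B k = hess f (T.x φ Λ k))
    (hL : ∃ K : ℝ≥0, ∃ U ∈ 𝓝 (prox φ Λ zbar), LipschitzOnWith K (hess f) (U ∩ effDom φ)) :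
    ∃ C : ℝ, ∀ᶠ k in atTop, P.Δmin ≤ T.Δ k →
      ‖T.z k + T.s f φ Λ k - zbar‖ ≤ C * ‖T.z k - zbar‖ ^ (1 + β) := by
  have h1 : (fun k => T.D k (T.z k - zbar) - (T.x φ Λ k - prox φ Λ zbar))
      =O[atTop] fun k => ‖T.z k - zbar‖ ^ (1 + β) := by
    obtain ⟨c, hc⟩ := hord.2
    refine IsBigO.of_bound c ?_
    filter_upwards [h.tendsto_sub.eventually hc] with k hk
    have h1 := h.run.genDeriv k
    rw [← add_sub_cancel zbar (T.z k)] at h1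
    have h2 := hk _ h1
    rw [add_sub_cancel] at h2
    rw [← norm_neg, neg_sub, Real.norm_eq_abs, abs_of_nonneg (by positivity)]
    exact h2
  have h2 : (fun k => (T.B k - hess f (T.x φ Λ k)) (T.x φ Λ k - prox φ Λ zbar))
      =O[atTop] fun k => ‖T.z k - zbar‖ ^ (1 + β) := by
    refine (isBigO_zero (E' := Vec n) _ _).congr_left fun k => ?_
    rw [hB, sub_self]; rfl
  have h3 : (fun k => ‖T.z k - zbar‖ ^ 2) =O[atTop] fun k => ‖T.z k - zbar‖ ^ (1 + β) := by
    refine IsBigO.of_bound 1 ?_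
    have hlim : Tendsto (fun k => ‖T.z k - zbar‖) atTop (𝓝 0) := by simpa using h.tendsto_sub.norm
    filter_upwards [hlim.eventually (gt_mem_nhds one_pos)] with k hk
    rw [Real.norm_eq_abs, Real.norm_eq_abs, abs_of_nonneg (by positivity),
      abs_of_nonneg (by positivity), one_mul, ← Real.rpow_natCast]
    refine Real.rpow_le_rpow_of_exponent_ge (norm_pos_iff.2 (h.sub_ne_zero k)) hk.le ?_
    push_cast
    linarith
  have hres := h.newton_residual_isBigO_of h1 h2 ((h.gradient_remainder_isBigO_sq hL).trans h3)
  have htol : T.ε =O[atTop] fun k => ‖T.z k - zbar‖ ^ (1 + β) := by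
    have h4 : (fun k => E (normalMap f φ Λ (T.z k)))
        =O[atTop] fun k => ‖normalMap f φ Λ (T.z k)‖ ^ (1 + β) :=
      hE.comp_tendsto h.tendsto_normalMap
    have h5 : (fun k => ‖normalMap f φ Λ (T.z k)‖ ^ (1 + β))
        =O[atTop] fun k => ‖T.z k - zbar‖ ^ (1 + β) :=
      (h.normalMap_isBigO.norm_norm).rpow (by linarith)
        (Eventually.of_forall fun k => norm_nonneg _)
    refine IsBigO.trans (IsBigO.of_bound 1 (Eventually.of_forall fun k => ?_)) (h4.trans h5)
    rw [one_mul, Real.norm_eq_abs, abs_of_nonneg (h.run.tol_nonneg k)]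
    exact (hε k).trans (le_abs_self _)
  obtain ⟨C, hC0, hC⟩ := h.exists_newton_error_le
  obtain ⟨C₁, hC₁⟩ := hres.bound
  obtain ⟨C₂, hC₂⟩ := htol.bound
  refine ⟨C * (C₁ + C₂), ?_⟩
  filter_upwards [hC, hC₁, hC₂, h.eventually_step_eq one_pos] with k k1 k2 k3 k4 hΔ
  rw [(k4 hΔ).1]
  refine (k1 hΔ).trans ?_
  rw [mul_assoc, add_mul]
  have hn : ‖‖T.z k - zbar‖ ^ (1 + β)‖ = ‖T.z k - zbar‖ ^ (1 + β) := by
    rw [Real.norm_eq_abs, abs_of_nonneg (by positivity)]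
  rw [hn] at k2 k3
  gcongr
  exact (le_abs_self _).trans k3

end LocalAssumptions

end LocalAnalysis

/-! ### Second-order expansion of the composite objective. -/

section Expansion

variable {n : ℕ} {f : Vec n → ℝ} {φ : Vec n → EReal} {Λ : Mat n}

/-- For a Lipschitz map, directional differentiability at a point is uniform in the direction. -/
theorem exists_radius_directional {G : Vec n → Vec n} {K : ℝ} (hK : 0 ≤ K)
    (hG : ∀ x y, ‖G y - G x‖ ≤ K * ‖y - x‖) {z : Vec n}
    (hdir : ∀ h : Vec n, ∃ d : Vec n,
      Tendsto (fun t : ℝ => t⁻¹ • (G (z + t • h) - G z)) (𝓝[>] 0) (𝓝 d)) {c : ℝ} (hc : 0 < c) :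
    ∃ δ > 0, ∀ h : Vec n, ‖h‖ < δ → ∀ t ∈ Icc (0 : ℝ) 1,
      ‖G (z + t • h) - G z - t • (G (z + h) - G z)‖ ≤ c * ‖h‖ := by
  choose d hd using hdir
  set c' := c / (2 * (K + 1)) with hc'
  have hc'0 : 0 < c' := by positivity
  -- Directional limits are uniform over a finite net of the sphere; the Lipschitz bound transfers
  -- them to every direction with error `(K+1)c'`. The claim compares two such quotients, hence the
  -- factor 2 in `c'`.
  obtain ⟨N, -, hNfin, hNcov⟩ := (isCompact_sphere (0 : Vec n) 1).finite_cover_balls hc'0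
  have hev : ∀ᶠ s : ℝ in 𝓝[>] 0, ∀ x ∈ N, ‖s⁻¹ • (G (z + s • x) - G z) - d x‖ ≤ c' := by
    rw [eventually_all_finite hNfin]
    intro x _
    filter_upwards [Metric.tendsto_nhds.1 (hd x) c' hc'0] with s hs
    rw [dist_eq_norm] at hs
    exact hs.le
  obtain ⟨δ, hδ, hsub⟩ := mem_nhdsGT_iff_exists_Ioo_subset.1 hev
  have hδ0 : (0 : ℝ) < δ := hδ
  refine ⟨δ, hδ0, fun h hh t ht => ?_⟩
  rcases eq_or_ne h 0 with rfl | hne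
  · simp
  rcases ht.1.eq_or_lt with rfl | ht0
  · simp only [zero_smul, add_zero, sub_self, norm_zero]
    positivity
  have hs0 : 0 < ‖h‖ := norm_pos_iff.2 hne
  set s := ‖h‖ with hs
  set u := s⁻¹ • h with hu
  have hun : ‖u‖ = 1 := by
    rw [hu, norm_smul, norm_inv, Real.norm_eq_abs, abs_of_pos hs0, ← hs, inv_mul_cancel₀ hs0.ne']
  have hsu : h = s • u := by rw [hu, smul_smul, mul_inv_cancel₀ hs0.ne', one_smul]
  obtain ⟨x, hxN, hxu⟩ : ∃ x ∈ N, ‖u - x‖ < c' := by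
    have := hNcov (show u ∈ Metric.sphere (0 : Vec n) 1 by simpa using hun)
    simpa [dist_eq_norm] using this
  have happ : ∀ r : ℝ, 0 < r → r < δ → ‖r⁻¹ • (G (z + r • u) - G z) - d x‖ ≤ (K + 1) * c' := by
    intro r hr0 hrδ
    have h1 : ‖r⁻¹ • (G (z + r • x) - G z) - d x‖ ≤ c' := hsub ⟨hr0, hrδ⟩ x hxN
    have h2 : ‖r⁻¹ • (G (z + r • u) - G (z + r • x))‖ ≤ K * c' := by
      rw [norm_smul, norm_inv, Real.norm_eq_abs, abs_of_pos hr0, inv_mul_le_iff₀ hr0]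
      refine (hG _ _).trans ?_
      rw [add_sub_add_left_eq_sub, ← smul_sub, norm_smul, Real.norm_eq_abs, abs_of_pos hr0]
      calc K * (r * ‖u - x‖) ≤ K * (r * c') := by gcongr
        _ = r * (K * c') := by ring
    have h3 : r⁻¹ • (G (z + r • u) - G z) - d x
        = r⁻¹ • (G (z + r • u) - G (z + r • x)) + (r⁻¹ • (G (z + r • x) - G z) - d x) := by
      module
    rw [h3]
    refine (norm_add_le _ _).trans ?_
    linarith
  have hts : t * s ≤ s := mul_le_of_le_one_left hs0.le ht.2
  have htspos : 0 < t * s := mul_pos ht0 hs0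
  have e1 := happ (t * s) htspos (hts.trans_lt hh)
  have e2 := happ s hs0 hh
  have e3 : G (z + t • h) - G z - t • (G (z + h) - G z)
      = (t * s) • (((t * s)⁻¹ • (G (z + (t * s) • u) - G z) - d x)
        - (s⁻¹ • (G (z + s • u) - G z) - d x)) := by
    have e4 : (t * s) • u = t • h := by rw [mul_smul, ← hsu]
    rw [sub_sub_sub_cancel_right, e4, ← hsu, smul_sub (t * s), smul_smul, smul_smul,
      mul_inv_cancel₀ htspos.ne', one_smul, mul_assoc, mul_inv_cancel₀ hs0.ne', mul_one]
  rw [e3, norm_smul, Real.norm_eq_abs, abs_of_pos htspos]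
  calc t * s * _ ≤ s * ((K + 1) * c' + (K + 1) * c') := by
        gcongr
        exact (norm_sub_le _ _).trans (add_le_add e1 e2)
    _ = c * s := by rw [hc']; field_simp; ring

/-- Second-order expansion of a function whose gradient is nearly affine along a segment. -/
theorem abs_second_order_remainder_le {e : Vec n → ℝ} {g : Vec n → Vec n}
    (he : ∀ z, HasGradientAt e (g z) z) {z h w : Vec n} {C : ℝ}
    (hC : ∀ t ∈ Icc (0 : ℝ) 1, ‖g (z + t • h) - g z - t • w‖ ≤ C) :
    |e (z + h) - e z - inner ℝ (g z) h - inner ℝ w h / 2| ≤ C * ‖h‖ := by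
  have hder : ∀ t ∈ Icc (0 : ℝ) 1, HasDerivWithinAt
      (fun t : ℝ => e (z + t • h) - t * inner ℝ (g z) h - t ^ 2 * (inner ℝ w h / 2))
      (inner ℝ (g (z + t • h) - g z - t • w) h) (Icc 0 1) t := by
    intro t _
    have h1 : HasDerivAt (fun t : ℝ => z + t • h) h t := by
      simpa using ((hasDerivAt_id t).smul_const h).const_add z
    have h0 : HasFDerivAt e (innerSL ℝ (g (z + t • h))) (z + t • h) := (he _).hasFDerivAt
    have h2 : HasDerivAt (fun t : ℝ => e (z + t • h)) (inner ℝ (g (z + t • h)) h) t := by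
      have := h0.comp_hasDerivAt t h1
      exact this
    have h3 := (h2.sub ((hasDerivAt_id t).mul_const (inner ℝ (g z) h))).sub
      ((hasDerivAt_pow 2 t).mul_const (inner ℝ w h / 2))
    refine (h3.congr_deriv ?_).hasDerivWithinAt
    rw [inner_sub_left, inner_sub_left, inner_smul_left, conj_trivial]
    push_cast
    ring
  have h := norm_image_sub_le_of_norm_deriv_le_segment_01' hder (C := C * ‖h‖) fun t ht =>
    (norm_inner_le_norm _ _).trans
      (mul_le_mul_of_nonneg_right (hC t (Ico_subset_Icc_self ht)) (norm_nonneg _))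
  rw [Real.norm_eq_abs] at h
  refine le_trans (le_of_eq ?_) h
  congr 1
  simp only [one_smul, zero_smul, add_zero]
  ring

/-- The envelope need not be twice differentiable; it suffices that its gradient is nearly affine
along each segment from `z̄`, uniformly in the direction. -/
theorem envelope_expansion (hφ : IsConvexLscProper φ) (hΛ : IsSPD Λ) {zbar : Vec n}
    (hdir : LipDirDiffAt (prox φ Λ) zbar) {c : ℝ} (hc : 0 < c) :
    ∀ᶠ z in 𝓝 zbar, |envelope φ Λ z - envelope φ Λ zbar
      - inner ℝ (Λ (zbar - prox φ Λ zbar)) (z - zbar)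
      - inner ℝ (Λ ((z - zbar) - (prox φ Λ z - prox φ Λ zbar))) (z - zbar) / 2|
        ≤ c * ‖z - zbar‖ ^ 2 := by
  obtain ⟨K, hK0, hK⟩ := exists_norm_prox_sub_le hφ hΛ
  obtain ⟨δ, hδ, hmain⟩ := exists_radius_directional hK0 hK hdir.2
    (show 0 < c / (‖Λ‖ + 1) by positivity)
  filter_upwards [Metric.ball_mem_nhds zbar hδ] with z hz
  have hz' : ‖z - zbar‖ < δ := by simpa [dist_eq_norm] using hz
  have h1 := abs_second_order_remainder_le (fun z => hasGradientAt_envelope hφ hΛ z)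
    (z := zbar) (h := z - zbar) (w := Λ ((z - zbar) - (prox φ Λ z - prox φ Λ zbar)))
    (C := c * ‖z - zbar‖) (by
      intro t ht
      have h2 := hmain (z - zbar) hz' t ht
      rw [add_sub_cancel] at h2
      rw [← map_sub, ← map_smul, ← map_sub]
      have h3 : zbar + t • (z - zbar) - prox φ Λ (zbar + t • (z - zbar)) - (zbar - prox φ Λ zbar)
          - t • (z - zbar - (prox φ Λ z - prox φ Λ zbar))
          = -(prox φ Λ (zbar + t • (z - zbar)) - prox φ Λ zbar
            - t • (prox φ Λ z - prox φ Λ zbar)) := by module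
      rw [h3, map_neg, norm_neg]
      refine (Λ.le_opNorm _).trans ?_
      calc ‖Λ‖ * _ ≤ (‖Λ‖ + 1) * (c / (‖Λ‖ + 1) * ‖z - zbar‖) := by
            gcongr
            linarith
        _ = c * ‖z - zbar‖ := by field_simp)
  rw [add_sub_cancel] at h1
  exact h1.trans (le_of_eq (by ring))

theorem smooth_expansion (hf : ContDiff ℝ 1 f) {x : Vec n}
    (hd : DifferentiableAt ℝ (gradient f) x) {c : ℝ} (hc : 0 < c) :
    ∀ᶠ y in 𝓝 x, |f y - f x - inner ℝ (gradient f x) (y - x)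
      - inner ℝ (hess f x (y - x)) (y - x) / 2| ≤ c * ‖y - x‖ ^ 2 := by
  obtain ⟨δ, hδ, hball⟩ := Metric.eventually_nhds_iff.1 (isLittleO_iff.1 hd.hasFDerivAt.isLittleO hc)
  filter_upwards [Metric.ball_mem_nhds x hδ] with y hy
  have hy' : ‖y - x‖ < δ := by simpa [dist_eq_norm] using hy
  have h1 := abs_second_order_remainder_le
    (fun z => (hf.differentiable one_ne_zero).differentiableAt.hasGradientAt (x := z))
    (z := x) (h := y - x) (w := hess f x (y - x)) (C := c * ‖y - x‖) (by
      intro t ht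
      have htn : ‖t • (y - x)‖ ≤ ‖y - x‖ := by
        rw [norm_smul, Real.norm_eq_abs, abs_of_nonneg ht.1]
        exact mul_le_of_le_one_left (norm_nonneg _) ht.2
      have h2 := hball (show dist (x + t • (y - x)) x < δ by
        rw [dist_eq_norm, add_sub_cancel_left]; exact htn.trans_lt hy')
      rw [add_sub_cancel_left, map_smul] at h2
      exact h2.trans (by gcongr))
  rw [add_sub_cancel] at h1
  exact h1.trans (le_of_eq (by ring))

/-- The composite objective at the proximal point. -/
noncomputable def objective (f : Vec n → ℝ) (φ : Vec n → EReal) (Λ : Mat n) (z : Vec n) : ℝ :=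
  f (prox φ Λ z) + (φ (prox φ Λ z)).toReal

/-- Write `φ ∘ prox` as the envelope minus `½‖z - prox z‖_Λ²`. First-order terms cancel by `∇f(x̄) =
-Λ(z̄ - x̄)`, and the remaining quadratic terms combine into a pairing with `prox z - x̄` alone. -/
theorem objective_expansion (hf : ContDiff ℝ 1 f) (hφ : IsConvexLscProper φ) (hΛ : IsSPD Λ)
    {zbar : Vec n} (h0 : normalMap f φ Λ zbar = 0) (hdir : LipDirDiffAt (prox φ Λ) zbar)
    (hd : DifferentiableAt ℝ (gradient f) (prox φ Λ zbar)) {c : ℝ} (hc : 0 < c) :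
    ∀ᶠ z in 𝓝 zbar, |objective f φ Λ z - objective f φ Λ zbar
      - inner ℝ (hess f (prox φ Λ zbar) (prox φ Λ z - prox φ Λ zbar)
        + Λ ((z - zbar) - (prox φ Λ z - prox φ Λ zbar))) (prox φ Λ z - prox φ Λ zbar) / 2|
        ≤ c * ‖z - zbar‖ ^ 2 := by
  obtain ⟨K, hK0, hK⟩ := exists_norm_prox_sub_le hφ hΛ
  have hf' := ((continuous_prox hφ hΛ).tendsto zbar).eventually
    (smooth_expansion hf hd (show 0 < c / (2 * (K ^ 2 + 1)) by positivity))
  filter_upwards [hf', envelope_expansion hφ hΛ hdir (half_pos hc)] with z h1 h2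
  set x := prox φ Λ z with hx
  set xb := prox φ Λ zbar with hxb
  set h := z - zbar with hh
  have h3 : c / (2 * (K ^ 2 + 1)) * ‖x - xb‖ ^ 2 ≤ c / 2 * ‖h‖ ^ 2 := by
    have h4 : ‖x - xb‖ ^ 2 ≤ (K ^ 2 + 1) * ‖h‖ ^ 2 := by
      calc ‖x - xb‖ ^ 2 ≤ (K * ‖h‖) ^ 2 := by gcongr; exact hK _ _
        _ ≤ (K ^ 2 + 1) * ‖h‖ ^ 2 := by nlinarith [sq_nonneg ‖h‖]
    calc _ ≤ c / (2 * (K ^ 2 + 1)) * ((K ^ 2 + 1) * ‖h‖ ^ 2) := by gcongr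
      _ = _ := by field_simp
  have h5 : wnorm Λ (z - x) ^ 2 = wnorm Λ (zbar - xb) ^ 2
      + 2 * inner ℝ (Λ (zbar - xb)) (h - (x - xb))
      + inner ℝ (Λ (h - (x - xb))) (h - (x - xb)) := by
    have e : z - x = (zbar - xb) - (-(h - (x - xb))) := by rw [hh]; abel
    rw [e, hΛ.wnorm_sub_sq (zbar - xb)]
    rw [hΛ.wnorm_sq (-(h - (x - xb))), map_neg, inner_neg_neg, inner_neg_left,
      real_inner_comm (Λ (zbar - xb)), real_inner_comm (Λ (h - (x - xb)))]
    ring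
  have h6 : inner ℝ (gradient f xb) (x - xb) = - inner ℝ (Λ (zbar - xb)) (x - xb) := by
    rw [← inner_neg_left]
    congr 1
    exact eq_neg_of_add_eq_zero_left h0
  have h7 : objective f φ Λ z - objective f φ Λ zbar
      - inner ℝ (hess f xb (x - xb) + Λ (h - (x - xb))) (x - xb) / 2
      = (f x - f xb - inner ℝ (gradient f xb) (x - xb) - inner ℝ (hess f xb (x - xb)) (x - xb) / 2)
        + (envelope φ Λ z - envelope φ Λ zbar - inner ℝ (Λ (zbar - xb)) h
          - inner ℝ (Λ (h - (x - xb))) h / 2) := by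
    rw [h6]
    simp only [objective, envelope, ← hx, ← hxb]
    rw [h5]
    simp only [inner_add_left, inner_sub_right]
    ring
  rw [h7]
  refine (abs_add_le _ _).trans ?_
  linarith

theorem exists_objective_le (hf : ContDiff ℝ 1 f) (hφ : IsConvexLscProper φ) (hΛ : IsSPD Λ)
    {zbar : Vec n} (h0 : normalMap f φ Λ zbar = 0) (hdir : LipDirDiffAt (prox φ Λ) zbar)
    (hd : DifferentiableAt ℝ (gradient f) (prox φ Λ zbar)) :
    ∃ C : ℝ, 0 ≤ C ∧ ∀ᶠ z in 𝓝 zbar,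
      objective f φ Λ z - objective f φ Λ zbar ≤ C * ‖z - zbar‖ ^ 2 := by
  obtain ⟨K, hK0, hK⟩ := exists_norm_prox_sub_le hφ hΛ
  set H := hess f (prox φ Λ zbar) with hH
  refine ⟨1 + (‖H‖ * K + ‖Λ‖ * (1 + K)) * K / 2, by positivity, ?_⟩
  filter_upwards [objective_expansion hf hφ hΛ h0 hdir hd one_pos] with z hz
  set d := prox φ Λ z - prox φ Λ zbar with hd
  set h := z - zbar with hh
  have hdn : ‖d‖ ≤ K * ‖h‖ := hK _ _
  have h1 : inner ℝ (H d + Λ (h - d)) d ≤ (‖H‖ * K + ‖Λ‖ * (1 + K)) * K * ‖h‖ ^ 2 := by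
    calc inner ℝ (H d + Λ (h - d)) d ≤ ‖H d + Λ (h - d)‖ * ‖d‖ := real_inner_le_norm _ _
      _ ≤ (‖H‖ * (K * ‖h‖) + ‖Λ‖ * (‖h‖ + K * ‖h‖)) * (K * ‖h‖) := by
          gcongr
          refine (norm_add_le _ _).trans ?_
          gcongr
          · exact (H.le_opNorm _).trans (by gcongr)
          · exact (Λ.le_opNorm _).trans (by gcongr; exact (norm_sub_le _ _).trans (by gcongr))
      _ = _ := by ring
  have h2 := (abs_le.1 hz).2
  linarith

variable {P : Params} {T : Trace n} {L : ℝ≥0} {ν : ℝ} {zbar : Vec n} {κM : ℝ} {K : ℕ}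

/-- The objective at the iterates is minorized by its limit up to second order. -/
theorem LocalAssumptions.eventually_objective_ge (h : LocalAssumptions f φ Λ P T L ν zbar κM K)
    {c : ℝ} (hc : 0 < c) : ∀ᶠ k in atTop,
      -(c * ‖T.z k - zbar‖ ^ 2) ≤ objective f φ Λ (T.z k) - objective f φ Λ zbar := by
  have hd := h.hess_diff _ (prox_mem_effDom h.convex h.spd zbar)
  have hexp := h.conv.eventually (objective_expansion h.smooth h.convex h.spd h.normalMap_eq_zero
    h.semismooth.1 hd (half_pos hc))
  set H := hess f (prox φ Λ zbar) with hH
  have hgrad : (fun k => gradient f (T.x φ Λ k) - gradient f (prox φ Λ zbar)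
      - H (T.x φ Λ k - prox φ Λ zbar)) =o[atTop] fun k => T.z k - zbar :=
    (hd.hasFDerivAt.isLittleO.comp_tendsto h.tendsto_prox).trans_isBigO h.prox_sub_isBigO
  have hres : (fun k => H (T.x φ Λ k - prox φ Λ zbar)
      + Λ ((T.z k - zbar) - (T.x φ Λ k - prox φ Λ zbar)) - T.M Λ k (T.z k - zbar))
      =o[atTop] fun k => T.z k - zbar := by
    refine (h.newton_residual_isLittleO.add hgrad).neg_left.congr_left fun k => ?_
    have h1 : normalMap f φ Λ (T.z k) = normalMap f φ Λ (T.z k) - normalMap f φ Λ zbar := by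
      rw [h.normalMap_eq_zero, sub_zero]
    rw [h1]
    simp only [normalMap, Trace.x, map_sub]
    abel
  obtain ⟨K₀, hK0, hK⟩ := exists_norm_prox_sub_le h.convex h.spd
  obtain ⟨CM, hCM0, hCM⟩ := h.exists_norm_M_le
  set c' := c / (K₀ + CM + 1) with hc'
  have hc'0 : 0 < c' := by positivity
  filter_upwards [hexp, isLittleO_iff.1 hres hc'0,
    isLittleO_iff.1 h.semismooth_remainder_isLittleO hc'0, eventually_ge_atTop K]
    with k h1 h2 h3 hk
  have hpsd := h.psd k hk (T.z k - zbar)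
  rw [ContinuousLinearMap.adjoint_inner_right] at hpsd
  have hdn : ‖T.x φ Λ k - prox φ Λ zbar‖ ≤ K₀ * ‖T.z k - zbar‖ := hK _ _
  change |_ - _ - inner ℝ (H (T.x φ Λ k - prox φ Λ zbar)
    + Λ ((T.z k - zbar) - (T.x φ Λ k - prox φ Λ zbar))) (T.x φ Λ k - prox φ Λ zbar) / 2| ≤ _ at h1
  set d := T.x φ Λ k - prox φ Λ zbar with hd
  set v := T.z k - zbar with hv
  set y := H d + Λ (v - d) with hy
  -- Up to `o(‖v‖²)` the quadratic term `⟨y, d⟩` equals `⟨Dv, Mv⟩ = ⟨v, DᵀMv⟩`, which is nonnegative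
  -- by assumption.
  have e1 : inner ℝ y d = inner ℝ (y - T.M Λ k v) d + (inner ℝ (T.D k v) (T.M Λ k v)
      - inner ℝ (T.D k v - d) (T.M Λ k v)) := by
    rw [inner_sub_left, inner_sub_left, real_inner_comm (T.M Λ k v) d]
    ring
  have e2 : -(c' * ‖v‖ * (K₀ * ‖v‖)) ≤ inner ℝ (y - T.M Λ k v) d := by
    refine le_trans ?_ (abs_le.1 (abs_real_inner_le_norm _ _)).1
    gcongr
  have e3 : inner ℝ (T.D k v - d) (T.M Λ k v) ≤ c' * ‖v‖ * (CM * ‖v‖) := by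
    refine (real_inner_le_norm _ _).trans ?_
    gcongr
    exact ((T.M Λ k).le_opNorm _).trans (by gcongr; exact hCM k)
  have e4 : c' * (K₀ + CM) * ‖v‖ ^ 2 ≤ c * ‖v‖ ^ 2 := by
    gcongr
    rw [hc', div_mul_eq_mul_div, div_le_iff₀ (by positivity)]
    nlinarith
  have e5 := (abs_le.1 h1).1
  nlinarith

end Expansion

/-! ### Geometric decay, decay of `ν_k`, and eventual acceptance. -/

section Acceptance

variable {n : ℕ} {f : Vec n → ℝ} {φ : Vec n → EReal} {Λ : Mat n} {P : Params} {T : Trace n}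
  {L : ℝ≥0} {ν : ℝ} {zbar : Vec n} {κM : ℝ} {K : ℕ}

theorem Trace.nSucc_succ_of_mem {k : ℕ} (hk : k ∈ T.succSet f φ Λ P) :
    T.nSucc f φ Λ P (k + 1) = T.nSucc f φ Λ P k + 1 := by
  have h1 : T.succSet f φ Λ P ∩ Iio (k + 1) = insert k (T.succSet f φ Λ P ∩ Iio k) := by
    ext j
    simp only [mem_inter_iff, mem_Iio, mem_insert_iff]
    constructor
    · rintro ⟨h1, h2⟩
      rcases (Nat.lt_succ_iff.1 h2).eq_or_lt with h3 | h3
      · exact Or.inl h3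
      · exact Or.inr ⟨h1, h3⟩
    · rintro (rfl | ⟨h1, h2⟩)
      · exact ⟨hk, Nat.lt_succ_self _⟩
      · exact ⟨h1, by omega⟩
  rw [Trace.nSucc, h1, ncard_insert_of_notMem (by simp) ((finite_Iio k).inter_of_right _)]
  rfl

theorem Trace.nSucc_succ_of_notMem {k : ℕ} (hk : k ∉ T.succSet f φ Λ P) :
    T.nSucc f φ Λ P (k + 1) = T.nSucc f φ Λ P k := by
  have h1 : T.succSet f φ Λ P ∩ Iio (k + 1) = T.succSet f φ Λ P ∩ Iio k := by
    ext j
    simp only [mem_inter_iff, mem_Iio]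
    refine and_congr_right fun h1 => ⟨fun h2 => ?_, fun h2 => by omega⟩
    rcases (Nat.lt_succ_iff.1 h2).eq_or_lt with h3 | h3
    · exact absurd (h3 ▸ h1) hk
    · exact h3
  rw [Trace.nSucc, h1]
  rfl

theorem Trace.nSucc_mono : Monotone (T.nSucc f φ Λ P) := by
  refine monotone_nat_of_le_succ fun k => ?_
  by_cases hk : k ∈ T.succSet f φ Λ P
  · rw [Trace.nSucc_succ_of_mem hk]; exact Nat.le_succ _
  · rw [Trace.nSucc_succ_of_notMem hk]

theorem GlobalAssumptions.tendsto_nSucc (h : GlobalAssumptions f φ Λ P T L ν) :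
    Tendsto (T.nSucc f φ Λ P) atTop atTop := by
  refine tendsto_atTop_atTop_of_monotone Trace.nSucc_mono fun b => ?_
  induction b with
  | zero => exact ⟨0, Nat.zero_le _⟩
  | succ b ih =>
    obtain ⟨k, hk⟩ := ih
    obtain ⟨j, hj, hjs⟩ := h.exists_success_ge k
    refine ⟨j + 1, ?_⟩
    rw [Trace.nSucc_succ_of_mem hjs]
    exact Nat.succ_le_succ (hk.trans (Trace.nSucc_mono hj))

/-- Polynomially growing sequences are dominated by geometric decay. -/
theorem tendsto_rpow_mul_pow (r : ℝ) {ρ : ℝ} (hρ0 : 0 ≤ ρ) (hρ1 : ρ < 1) :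
    Tendsto (fun N : ℕ => (N : ℝ) ^ r * ρ ^ N) atTop (𝓝 0) := by
  have h1 := tendsto_pow_const_mul_const_pow_of_abs_lt_one ⌈r⌉₊
    (show |ρ| < 1 by rwa [abs_of_nonneg hρ0])
  refine squeeze_zero' (Eventually.of_forall fun N => by positivity) ?_ h1
  filter_upwards [eventually_ge_atTop 1] with N hN
  gcongr
  rw [← Real.rpow_natCast]
  exact Real.rpow_le_rpow_of_exponent_le (by exact_mod_cast hN) (Nat.le_ceil r)

theorem exists_eventually_sq_le_of_limsup {a : ℕ → ℝ} {r : ℝ}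
    (ha : limsup (fun k : ℕ => ((a k ^ 2 / (k : ℝ) ^ r : ℝ) : EReal)) atTop < ⊤) :
    ∃ C : ℝ, ∀ᶠ k : ℕ in atTop, a k ^ 2 ≤ C * (k : ℝ) ^ r := by
  obtain ⟨C, hC, -⟩ := EReal.lt_iff_exists_real_btwn.1 ha
  refine ⟨C, ?_⟩
  filter_upwards [eventually_lt_of_limsup_lt hC, eventually_ge_atTop 1] with k hk hk1
  have h1 : a k ^ 2 / (k : ℝ) ^ r < C := by exact_mod_cast hk
  have h2 : 0 < (k : ℝ) ^ r := Real.rpow_pos_of_pos (by exact_mod_cast hk1) _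
  exact ((div_lt_iff₀ h2).1 h1).le

theorem IsSPD.norm_le_wnorm_inverse (hΛ : IsSPD Λ) (v : Vec n) :
    ‖v‖ ≤ ‖Λ‖ * √‖Λ.inverse‖ * wnorm Λ.inverse v := by
  rw [hΛ.wnorm_inverse, mul_assoc]
  calc ‖v‖ = ‖Λ (Λ.inverse v)‖ := by rw [hΛ.apply_inverse]
    _ ≤ ‖Λ‖ * ‖Λ.inverse v‖ := Λ.le_opNorm _
    _ ≤ _ := by gcongr; exact hΛ.norm_le _

namespace LocalAssumptions

theorem exists_norm_sub_le_crit (h : LocalAssumptions f φ Λ P T L ν zbar κM K) :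
    ∃ c : ℝ, 0 < c ∧ ∀ᶠ k in atTop, c * ‖T.z k - zbar‖ ≤ crit f φ Λ (T.z k) := by
  obtain ⟨C, hC0, hC⟩ := h.sub_isBigO_normalMap.exists_pos
  set A := C * (‖Λ‖ * √‖Λ.inverse‖) + 1 with hA
  have hA0 : 0 < A := by positivity
  refine ⟨A⁻¹, by positivity, ?_⟩
  filter_upwards [hC.bound] with k hk
  rw [inv_mul_le_iff₀ hA0]
  have h1 := h.spd.norm_le_wnorm_inverse (normalMap f φ Λ (T.z k))
  have h2 : 0 ≤ crit f φ Λ (T.z k) := crit_nonneg _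
  calc ‖T.z k - zbar‖ ≤ C * ‖normalMap f φ Λ (T.z k)‖ := hk
    _ ≤ C * (‖Λ‖ * √‖Λ.inverse‖ * crit f φ Λ (T.z k)) := by gcongr; exact h1
    _ ≤ A * crit f φ Λ (T.z k) := by rw [hA]; nlinarith

theorem exists_crit_le (h : LocalAssumptions f φ Λ P T L ν zbar κM K) :
    ∃ C : ℝ, 0 ≤ C ∧ ∀ z, crit f φ Λ z ≤ C * ‖z - zbar‖ := by
  obtain ⟨K₀, hK0, hK⟩ := exists_norm_prox_sub_le h.convex h.spd
  refine ⟨√‖Λ.inverse‖ * (L * K₀ + ‖Λ‖ * (1 + K₀)), by positivity, fun z => ?_⟩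
  have h1 : normalMap f φ Λ z = (gradient f (prox φ Λ z) - gradient f (prox φ Λ zbar))
      + Λ ((z - zbar) - (prox φ Λ z - prox φ Λ zbar)) := by
    rw [← sub_zero (normalMap f φ Λ z), ← h.normalMap_eq_zero]
    simp only [normalMap, map_sub]
    abel
  refine (wnorm_le _ _).trans ?_
  rw [mul_assoc]
  gcongr
  rw [h1]
  calc _ ≤ L * (K₀ * ‖z - zbar‖) + ‖Λ‖ * (‖z - zbar‖ + K₀ * ‖z - zbar‖) := by
        refine (norm_add_le _ _).trans ?_
        gcongr
        · refine (h.lipschitz.norm_sub_le (prox_mem_effDom h.convex h.spd _)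
            (prox_mem_effDom h.convex h.spd _)).trans ?_
          gcongr
          exact hK _ _
        · refine (Λ.le_opNorm _).trans ?_
          gcongr
          exact (norm_sub_le _ _).trans (by gcongr; exact hK _ _)
    _ = _ := by ring

theorem crit_limit_eq_zero (h : LocalAssumptions f φ Λ P T L ν zbar κM K) :
    crit f φ Λ zbar = 0 := by
  rw [crit, h.normalMap_eq_zero, wnorm]
  simp

theorem merit_sub_eq (h : LocalAssumptions f φ Λ P T L ν zbar κM K) (z : Vec n) :
    merit f φ Λ P.τ z - merit f φ Λ P.τ zbar
      = objective f φ Λ z - objective f φ Λ zbar + P.τ / 2 * crit f φ Λ z ^ 2 := by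
  simp only [merit, objective, h.crit_limit_eq_zero]
  ring

theorem exists_merit_sub_le (h : LocalAssumptions f φ Λ P T L ν zbar κM K) :
    ∃ C : ℝ, 0 ≤ C ∧ ∀ᶠ z in 𝓝 zbar,
      merit f φ Λ P.τ z - merit f φ Λ P.τ zbar ≤ C * ‖z - zbar‖ ^ 2 := by
  obtain ⟨C₁, hC₁0, hC₁⟩ := exists_objective_le h.smooth h.convex h.spd h.normalMap_eq_zero
    h.semismooth.1 (h.hess_diff _ (prox_mem_effDom h.convex h.spd zbar))
  obtain ⟨C₂, hC₂0, hC₂⟩ := h.exists_crit_le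
  have hτ := h.admissible.τ_pos
  refine ⟨C₁ + P.τ / 2 * C₂ ^ 2, by positivity, ?_⟩
  filter_upwards [hC₁] with z hz
  rw [h.merit_sub_eq]
  have h1 : crit f φ Λ z ^ 2 ≤ (C₂ * ‖z - zbar‖) ^ 2 :=
    pow_le_pow_left₀ (crit_nonneg z) (hC₂ z) 2
  have h2 : P.τ / 2 * crit f φ Λ z ^ 2 ≤ P.τ / 2 * (C₂ * ‖z - zbar‖) ^ 2 := by gcongr
  linarith

theorem eventually_merit_sub_ge (h : LocalAssumptions f φ Λ P T L ν zbar κM K) {c : ℝ}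
    (hc : 0 < c) : ∀ᶠ k in atTop, P.τ / 2 * crit f φ Λ (T.z k) ^ 2 - c * ‖T.z k - zbar‖ ^ 2
      ≤ merit f φ Λ P.τ (T.z k) - merit f φ Λ P.τ zbar := by
  filter_upwards [h.eventually_objective_ge hc] with k hk
  rw [h.merit_sub_eq]
  linarith

theorem tendsto_crit (h : LocalAssumptions f φ Λ P T L ν zbar κM K) :
    Tendsto (fun k => crit f φ Λ (T.z k)) atTop (𝓝 0) := by
  rw [← h.crit_limit_eq_zero]
  exact ((continuous_crit h.smooth h.convex h.spd).tendsto zbar).comp h.conv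

/-- The merit gap contracts linearly at successful iterations. -/
theorem exists_merit_contraction (h : LocalAssumptions f φ Λ P T L ν zbar κM K) :
    ∃ q : ℝ, 0 < q ∧ q < 1 ∧ ∀ᶠ k in atTop, k ∈ T.succSet f φ Λ P →
      merit f φ Λ P.τ (T.z (k + 1)) - merit f φ Λ P.τ zbar
        ≤ q * (merit f φ Λ P.τ (T.z k) - merit f φ Λ P.τ zbar) := by
  obtain ⟨c, hc, hrad⟩ := h.exists_radius_lower_bound
  obtain ⟨c₁, hc₁, hlow⟩ := h.exists_norm_sub_le_crit
  obtain ⟨C, hC0, hup⟩ := h.exists_merit_sub_le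
  have hτ := h.admissible.τ_pos
  have hη := h.admissible.η₁_pos
  have hm : 0 < min 1 c := lt_min one_pos hc
  set m := min 1 c with hmdef
  -- Ratio of the guaranteed decrease, at least `η₁(τ/2)mχ²` with `χ ≥ c₁‖z_k - z̄‖`, to the merit
  -- gap, at most `C‖z_k - z̄‖²`. The minimum with `1/2` below keeps the contraction factor
  -- positive.
  set c₂ := P.η₁ * (P.τ / 2) * m * c₁ ^ 2 / (C + 1) with hc₂
  have hc₂0 : 0 < c₂ := by positivity
  refine ⟨1 - min (1 / 2) c₂, by linarith [min_le_left (1 / 2) c₂],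
    by linarith [lt_min (show (0 : ℝ) < 1 / 2 by norm_num) hc₂0], ?_⟩
  have hcχ : Tendsto (fun k => c * crit f φ Λ (T.z k)) atTop (𝓝 0) := by
    simpa using h.tendsto_crit.const_mul c
  filter_upwards [eventually_ge_atTop 1, hlow, h.conv.eventually hup,
    h.tendsto_crit.eventually (gt_mem_nhds one_pos),
    hcχ.eventually (gt_mem_nhds h.Δmin_pos)] with k hk1 k1 k2 k3 k4 hs
  obtain ⟨j, rfl⟩ : ∃ j, k = j + 1 := ⟨k - 1, by omega⟩
  have hχ0 : 0 ≤ crit f φ Λ (T.z (j + 1)) := crit_nonneg _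
  set χ := crit f φ Λ (T.z (j + 1)) with hχ
  have hΔ : c * χ ≤ T.Δ (j + 1) := by
    have := hrad j
    rwa [min_eq_right k4.le] at this
  have hmin : m * χ ≤ min 1 (min (T.Δ (j + 1)) χ) := by
    have e1 : m * χ ≤ χ := mul_le_of_le_one_left hχ0 (min_le_left _ _)
    refine le_min (e1.trans k3.le) (le_min (le_trans ?_ hΔ) e1)
    gcongr
    exact min_le_right _ _
  have hdec := h.merit_decrease hs
  rw [← hχ] at hdec
  have e2 : P.η₁ * (P.τ / 2) * m * χ ^ 2
      ≤ P.η₁ * (P.τ / 2 * χ * min 1 (min (T.Δ (j + 1)) χ)) := by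
    calc P.η₁ * (P.τ / 2) * m * χ ^ 2 = P.η₁ * (P.τ / 2 * χ * (m * χ)) := by ring
      _ ≤ _ := by gcongr
  have e3 : P.η₁ * (P.τ / 2) * m * (c₁ * ‖T.z (j + 1) - zbar‖) ^ 2
      ≤ P.η₁ * (P.τ / 2) * m * χ ^ 2 := by gcongr
  set V := merit f φ Λ P.τ (T.z (j + 1)) - merit f φ Λ P.τ zbar with hV
  have e4 : min (1 / 2) c₂ * V ≤ P.η₁ * (P.τ / 2) * m * (c₁ * ‖T.z (j + 1) - zbar‖) ^ 2 := by
    have hmn : 0 ≤ min (1 / 2) c₂ := le_min (by norm_num) hc₂0.le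
    calc min (1 / 2) c₂ * V ≤ min (1 / 2) c₂ * (C * ‖T.z (j + 1) - zbar‖ ^ 2) := by gcongr
      _ ≤ c₂ * ((C + 1) * ‖T.z (j + 1) - zbar‖ ^ 2) := by
          gcongr
          · exact min_le_right _ _
          · linarith
      _ = _ := by rw [hc₂]; field_simp
  have e5 : merit f φ Λ P.τ (T.z (j + 1)) = V + merit f φ Λ P.τ zbar := by rw [hV]; ring
  rw [e5] at hdec
  linarith

/-- The distance to the limit decays geometrically in the number of successful iterations. -/
theorem exists_geometric_bound (h : LocalAssumptions f φ Λ P T L ν zbar κM K) :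
    ∃ A q : ℝ, 0 ≤ A ∧ 0 < q ∧ q < 1 ∧ ∀ᶠ k in atTop,
      ‖T.z k - zbar‖ ^ 2 ≤ A * q ^ T.nSucc f φ Λ P k := by
  obtain ⟨q, hq0, hq1, hq⟩ := h.exists_merit_contraction
  obtain ⟨K₀, hK₀⟩ := eventually_atTop.1 hq
  obtain ⟨c₁, hc₁, hlow⟩ := h.exists_norm_sub_le_crit
  have hτ := h.admissible.τ_pos
  set V : ℕ → ℝ := fun k => merit f φ Λ P.τ (T.z k) - merit f φ Λ P.τ zbar with hV
  have hVnonneg : ∀ k, 0 ≤ V k := fun k => by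
    have hH : Tendsto (fun k => merit f φ Λ P.τ (T.z k)) atTop (𝓝 (merit f φ Λ P.τ zbar)) :=
      ((continuous_merit h.smooth h.convex h.spd P.τ).tendsto zbar).comp h.conv
    exact sub_nonneg.2 (h.merit_antitone.le_of_tendsto hH k)
  set A := V K₀ / q ^ T.nSucc f φ Λ P K₀ with hA
  have hA0 : 0 ≤ A := div_nonneg (hVnonneg _) (by positivity)
  have hVle : ∀ k ≥ K₀, V k ≤ A * q ^ T.nSucc f φ Λ P k := by
    intro k hk
    induction k, hk using Nat.le_induction with
    | base => rw [hA, div_mul_cancel₀ _ (by positivity)]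
    | succ k hk ih =>
      by_cases hks : k ∈ T.succSet f φ Λ P
      · rw [Trace.nSucc_succ_of_mem hks, pow_succ]
        calc V (k + 1) ≤ q * V k := hK₀ k hk hks
          _ ≤ q * (A * q ^ T.nSucc f φ Λ P k) := by gcongr
          _ = _ := by ring
      · rw [Trace.nSucc_succ_of_notMem hks]
        have : V (k + 1) = V k := by
          simp only [hV, (h.run.reject k (not_le.1 hks)).1]
        rwa [this]
  -- Half of the coefficient `(τ/2)c₁²` in the lower bound for the merit gap pays for the negative
  -- part of the objective gap; the other half remains.
  have hB : 0 < P.τ / 4 * c₁ ^ 2 := by positivity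
  refine ⟨A / (P.τ / 4 * c₁ ^ 2), q, by positivity, hq0, hq1, ?_⟩
  filter_upwards [hlow, h.eventually_merit_sub_ge hB, eventually_ge_atTop K₀] with k k1 k2 k3
  have e1 : P.τ / 2 * (c₁ * ‖T.z k - zbar‖) ^ 2 ≤ P.τ / 2 * crit f φ Λ (T.z k) ^ 2 := by gcongr
  have e2 := hVle k k3
  rw [div_mul_eq_mul_div, le_div_iff₀ hB]
  have e3 : V k = merit f φ Λ P.τ (T.z k) - merit f φ Λ P.τ zbar := rfl
  nlinarith

theorem exists_step_le (h : LocalAssumptions f φ Λ P T L ν zbar κM K) :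
    ∃ C : ℝ, 0 ≤ C ∧ ∀ᶠ k in atTop, P.Δmin ≤ T.Δ k →
      wnorm Λ (prox φ Λ (T.z k + T.s f φ Λ k) - T.x φ Λ k) ≤ C * ‖T.z k - zbar‖ := by
  refine ⟨√‖Λ‖ * 2, by positivity, ?_⟩
  filter_upwards [h.eventually_step_eq one_pos] with k hk hΔ
  refine (wnorm_prox_sub_le h.convex h.spd _ _).trans ((wnorm_le _ _).trans ?_)
  rw [mul_assoc, add_sub_cancel_left]
  gcongr
  have h1 := (hk hΔ).2
  have h2 : T.s f φ Λ k = (T.z k + T.s f φ Λ k - zbar) - (T.z k - zbar) := by abel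
  rw [h2]
  refine (norm_sub_le _ _).trans ?_
  linarith

/-- With `N` successes so far, `a_N²` is at most a multiple of `N^(1+p)`, whereas the proximal step
to the power `2p` is at most a multiple of `(q^p)^N`. -/
theorem eventually_ν_le (h : LocalAssumptions f φ Λ P T L ν zbar κM K) {p : ℝ} (hp : 0 < p)
    {a : ℕ → ℝ} (ha : limsup (fun k : ℕ => ((a k ^ 2 / (k : ℝ) ^ (1 + p) : ℝ) : EReal)) atTop < ⊤)
    (hν : ∀ k, T.ν k ≤ a (T.nSucc f φ Λ P k) ^ 2 *
      wnorm Λ (prox φ Λ (T.z k + T.s f φ Λ k) - T.x φ Λ k) ^ (2 * p)) {δ : ℝ} (hδ : 0 < δ) :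
    ∀ᶠ k in atTop, P.Δmin ≤ T.Δ k → T.ν k ≤ δ := by
  obtain ⟨C₁, hC₁⟩ := exists_eventually_sq_le_of_limsup ha
  obtain ⟨C₂, hC₂0, hC₂⟩ := h.exists_step_le
  obtain ⟨A, q, hA, hq0, hq1, hgeo⟩ := h.exists_geometric_bound
  have hlim : Tendsto (fun N : ℕ => C₁ * (C₂ ^ (2 * p) * A ^ p)
      * ((N : ℝ) ^ (1 + p) * (q ^ p) ^ N)) atTop (𝓝 0) := by
    have := (tendsto_rpow_mul_pow (1 + p) (Real.rpow_nonneg hq0.le p)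
      (Real.rpow_lt_one hq0.le hq1 hp)).const_mul (C₁ * (C₂ ^ (2 * p) * A ^ p))
    simpa using this
  have hN := h.toGlobalAssumptions.tendsto_nSucc
  filter_upwards [hN.eventually hC₁, hC₂, hgeo,
    hN.eventually (hlim.eventually (gt_mem_nhds hδ))] with k k1 k2 k3 k4 hΔ
  set N := T.nSucc f φ Λ P k with hNdef
  have e1 : wnorm Λ (prox φ Λ (T.z k + T.s f φ Λ k) - T.x φ Λ k) ^ (2 * p)
      ≤ C₂ ^ (2 * p) * (A ^ p * (q ^ p) ^ N) := by
    calc _ ≤ (C₂ * ‖T.z k - zbar‖) ^ (2 * p) :=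
          Real.rpow_le_rpow (wnorm_nonneg _ _) (k2 hΔ) (by positivity)
      _ = C₂ ^ (2 * p) * (‖T.z k - zbar‖ ^ 2) ^ p := by
          rw [Real.mul_rpow hC₂0 (norm_nonneg _), Real.rpow_mul (norm_nonneg _), Real.rpow_two]
      _ ≤ C₂ ^ (2 * p) * (A * q ^ N) ^ p := by gcongr
      _ = _ := by
          rw [Real.mul_rpow hA (by positivity), ← Real.rpow_natCast q, ← Real.rpow_natCast,
            ← Real.rpow_mul hq0.le, ← Real.rpow_mul hq0.le, mul_comm (N : ℝ)]
  have hw0 : 0 ≤ wnorm Λ (prox φ Λ (T.z k + T.s f φ Λ k) - T.x φ Λ k) ^ (2 * p) :=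
    Real.rpow_nonneg (wnorm_nonneg _ _) _
  have e0 : 0 ≤ C₁ * (N : ℝ) ^ (1 + p) := (sq_nonneg _).trans k1
  refine (hν k).trans (le_trans ?_ k4.le)
  calc a N ^ 2 * wnorm Λ (prox φ Λ (T.z k + T.s f φ Λ k) - T.x φ Λ k) ^ (2 * p)
      ≤ (C₁ * (N : ℝ) ^ (1 + p)) * (C₂ ^ (2 * p) * (A ^ p * (q ^ p) ^ N)) := by gcongr
    _ = _ := by ring

/-- Newton steps inside the trust region are eventually accepted. -/
theorem eventually_success_of_radius_ge (h : LocalAssumptions f φ Λ P T L ν zbar κM K)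
    (hν : ∀ δ : ℝ, 0 < δ → ∀ᶠ k in atTop, P.Δmin ≤ T.Δ k → T.ν k ≤ δ) :
    ∀ᶠ k in atTop, P.Δmin ≤ T.Δ k → k ∈ T.succSet f φ Λ P := by
  obtain ⟨c₁, hc₁, hlow⟩ := h.exists_norm_sub_le_crit
  obtain ⟨C, hC0, hup⟩ := h.exists_merit_sub_le
  obtain ⟨C₂, hC₂0, hC₂⟩ := h.exists_step_le
  have hτ := h.admissible.τ_pos
  have hη := h.admissible.η₁_pos
  have hη1 : P.η₁ < 1 := h.admissible.η₁_le.trans_lt h.admissible.η₂_lt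
  -- In units of `‖z_k - z̄‖²`, the slack between `(τ/2)χ²` and `η₁` times it. One third each covers
  -- the merit gap at the trial point, the `ν_k` term, and the possible deficit in the objective;
  -- `b` is tuned to the first.
  set g := (1 - P.η₁) * (P.τ / 2) * c₁ ^ 2 with hg
  have hg0 : 0 < g := mul_pos (mul_pos (by linarith) (by positivity)) (by positivity)
  set b := min 1 (g / (3 * (C + 1))) with hb
  have hb0 : 0 < b := lt_min one_pos (by positivity)
  have hstep := h.eventually_step_eq hb0
  obtain ⟨r, hr, hball⟩ := Metric.eventually_nhds_iff.1 hup
  have hδ : 0 < g / (3 * (C₂ ^ 2 + 1)) := by positivity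
  have hnorm : Tendsto (fun k => ‖T.z k - zbar‖) atTop (𝓝 0) := by simpa using h.tendsto_sub.norm
  filter_upwards [hlow, hC₂, hstep, h.eventually_merit_sub_ge (show 0 < g / 3 by positivity),
    hν _ hδ, hnorm.eventually (gt_mem_nhds hr),
    h.tendsto_crit.eventually (gt_mem_nhds h.Δmin_pos)] with k k1 k2 k3 k4 k5 k6 k7 hΔ
  change P.η₁ ≤ T.rho f φ Λ P k
  rw [Trace.rho, le_div_iff₀ (h.pred_pos k)]
  have hχ := h.crit_pos k
  have hstep' := (k3 hΔ).2
  set e := ‖T.z k - zbar‖ with he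
  have he0 : 0 ≤ e := norm_nonneg _
  have hbe : b * e ≤ e := mul_le_of_le_one_left he0 (min_le_left _ _)
  have hm := hball (show dist (T.z k + T.s f φ Λ k) zbar < r by
    rw [dist_eq_norm]; linarith)
  have hm2 : merit f φ Λ P.τ (T.z k + T.s f φ Λ k) - merit f φ Λ P.τ zbar ≤ g / 3 * e ^ 2 := by
    refine hm.trans ?_
    calc C * ‖T.z k + T.s f φ Λ k - zbar‖ ^ 2 ≤ (C + 1) * (b * e) ^ 2 := by
          gcongr
          linarith
      _ = (C + 1) * (b * b) * e ^ 2 := by ring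
      _ ≤ (C + 1) * (1 * (g / (3 * (C + 1)))) * e ^ 2 := by
          gcongr
          · exact min_le_left _ _
          · exact min_le_right _ _
      _ = _ := by field_simp
  have hpred : pred f φ Λ P.τ (T.z k) (T.s f φ Λ k) (T.Δ k) (T.ν k)
      ≤ P.τ / 2 * crit f φ Λ (T.z k) ^ 2 + g / 3 * e ^ 2 := by
    -- Late iterations have `χ < Δmin ≤ Δ_k`, so `min{Δ_k, χ} = χ` and the factor of the second term
    -- reduces to `ν_k`.
    rw [pred, min_eq_right (k7.le.trans hΔ), mul_div_cancel_right₀ _ hχ.ne']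
    have hk2 := k2 hΔ
    have hν0 := (h.ν_mem k).1
    have e1 : T.ν k * wnorm Λ (prox φ Λ (T.z k + T.s f φ Λ k) - prox φ Λ (T.z k)) ^ 2
        ≤ g / 3 * e ^ 2 := by
      calc _ ≤ g / (3 * (C₂ ^ 2 + 1)) * (C₂ * e) ^ 2 := by
            gcongr
            · exact k5 hΔ
            · exact wnorm_nonneg _ _
            · exact hk2
        _ = g / 3 * (C₂ ^ 2 / (C₂ ^ 2 + 1)) * e ^ 2 := by field_simp
        _ ≤ g / 3 * 1 * e ^ 2 := by
            gcongr
            exact (div_le_one (by positivity)).2 (by linarith)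
        _ = _ := by ring
    have e2 : P.τ / 2 * crit f φ Λ (T.z k) * min 1 (crit f φ Λ (T.z k))
        ≤ P.τ / 2 * crit f φ Λ (T.z k) ^ 2 := by
      rw [sq, ← mul_assoc]
      gcongr
      exact min_le_right _ _
    linarith
  have hge : g * e ^ 2 ≤ (1 - P.η₁) * (P.τ / 2 * crit f φ Λ (T.z k) ^ 2) := by
    have e1 : (c₁ * e) ^ 2 ≤ crit f φ Λ (T.z k) ^ 2 := by gcongr
    have e2 : 0 ≤ (1 - P.η₁) * (P.τ / 2) := mul_nonneg (by linarith) (by positivity)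
    calc g * e ^ 2 = (1 - P.η₁) * (P.τ / 2) * (c₁ * e) ^ 2 := by rw [hg]; ring
      _ ≤ (1 - P.η₁) * (P.τ / 2) * crit f φ Λ (T.z k) ^ 2 := mul_le_mul_of_nonneg_left e1 e2
      _ = _ := by ring
  have e3 : P.η₁ * pred f φ Λ P.τ (T.z k) (T.s f φ Λ k) (T.Δ k) (T.ν k)
      ≤ P.η₁ * (P.τ / 2 * crit f φ Λ (T.z k) ^ 2 + g / 3 * e ^ 2) := by gcongr
  have e4 : P.η₁ * (g / 3 * e ^ 2) ≤ g / 3 * e ^ 2 :=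
    mul_le_of_le_one_left (by positivity) hη1.le
  linarith

/-- A success makes the next radius at least `Δmin`, and this in turn makes the next iteration
successful; infinitely many successes supply the start. -/
theorem eventually_success (h : LocalAssumptions f φ Λ P T L ν zbar κM K)
    (hν : ∀ δ : ℝ, 0 < δ → ∀ᶠ k in atTop, P.Δmin ≤ T.Δ k → T.ν k ≤ δ) :
    ∀ᶠ k in atTop, k ∈ T.succSet f φ Λ P ∧ P.Δmin ≤ T.Δ k := by
  obtain ⟨K₀, hK₀⟩ := eventually_atTop.1 (h.eventually_success_of_radius_ge hν)
  obtain ⟨k₀, hk₀, hs⟩ := h.exists_success_ge K₀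
  refine eventually_atTop.2 ⟨k₀ + 1, fun k hk => ?_⟩
  induction k, hk using Nat.le_induction with
  | base =>
    have h1 := h.radius_succ_ge hs
    exact ⟨hK₀ _ (by omega) h1, h1⟩
  | succ k hk ih =>
    have h1 := h.radius_succ_ge ih.1
    exact ⟨hK₀ _ (by omega) h1, h1⟩

end LocalAssumptions

end Acceptance

end TRSSN

/-! ### Assembly of the theorem. -/

theorem mainTheorem4 {n : ℕ} (f : Vec n → ℝ) (φ : Vec n → EReal) (Λ : Mat n)
    (P : Params) (T : Trace n)
    -- standing assumptions
    (hf : ContDiff ℝ 1 f) (hφ : IsConvexLscProper φ) (hΛ : IsSPD Λ) (hP : P.Admissible)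
    -- the method does not terminate, and `Δmin > 0`
    (hrun : IsRun f φ Λ P T) (hΔmin : 0 < P.Δmin)
    -- `∇f` is Lipschitz on `dom φ`, `f + φ` is bounded below on `dom ∂φ`
    (L : ℝ≥0) (hLip : LipschitzOnWith L (gradient f) (effDom φ))
    (hbdd : ∃ m : ℝ, ∀ x ∈ subdiffDom φ, (m : EReal) ≤ (f x : EReal) + φ x)
    -- choice of `ν_k` and `τ`, with `‖Λ⁻¹‖⁻¹ = λ_min(Λ)`
    (ν : ℝ) (hν₀ : 0 ≤ ν) (hν₁ : ν < 1) (hνk : ∀ k, 0 ≤ T.ν k ∧ T.ν k ≤ ν)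
    (hτ : P.τ * ((L : ℝ) ^ 2 + 2 * ‖Λ.inverse‖⁻¹ ^ 2) < 2 * ‖Λ.inverse‖⁻¹ ^ 2 * (1 - ν))
    -- boundedness of `B_k`
    (hB : ∃ κB : ℝ, ∀ k, ‖T.B k‖ ≤ κB)
    -- convergence of the iterates
    (zbar : Vec n) (hconv : Tendsto T.z atTop (𝓝 zbar))
    -- `f` is twice continuously differentiable on `dom φ`
    (hC2 : (∀ x ∈ effDom φ, DifferentiableAt ℝ (gradient f) x) ∧
      ContinuousOn (hess f) (effDom φ))
    -- semismoothness of the proximity operator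
    (hsemi : SemismoothAt (prox φ Λ) zbar)
    -- curvature and bounded invertibility
    (hM : ∃ κM : ℝ, 0 < κM ∧ ∃ K : ℕ, ∀ k ≥ K,
      (∀ h : Vec n, 0 ≤ inner ℝ h (ContinuousLinearMap.adjoint (T.D k) (T.M Λ k h))) ∧
      (T.M Λ k).IsInvertible ∧ ‖(T.M Λ k).inverse‖ ≤ κM)
    -- the Dennis-Moré-type condition
    (hDM : Tendsto (fun k => ‖(T.B k - hess f (T.x φ Λ k)) (T.x φ Λ k - prox φ Λ zbar)‖ /
      ‖T.z k - zbar‖) atTop (𝓝 0))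
    -- CG tolerances
    (E : Vec n → ℝ) (hE_cont : Continuous E) (hE_nonneg : ∀ h, 0 ≤ E h) (hE_zero : E 0 = 0)
    (hE_o : E =o[𝓝 0] fun h : Vec n => ‖h‖)
    (hε : ∀ k, T.ε k ≤ E (normalMap f φ Λ (T.z k)))
    -- upper bound on `ν_k`
    (p : ℝ) (hp : 0 < p) (a : ℕ → ℝ) (ha_pos : ∀ k, 0 < a k)
    (ha_growth : limsup (fun k : ℕ => ((a k ^ 2 / (k : ℝ) ^ (1 + p) : ℝ) : EReal)) atTop < ⊤)
    (ha_ratio : limsup (fun k : ℕ => ((a (k + 1) / a k : ℝ) : EReal)) atTop < ⊤)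
    (hν_upper : ∀ k, T.ν k ≤ a (T.nSucc f φ Λ P k) ^ 2 *
      wnorm Λ (prox φ Λ (T.z k + T.s f φ Λ k) - T.x φ Λ k) ^ (2 * p)) :
    -- all steps are eventually successful
    (∃ Kbar : ℕ, ∀ k ≥ Kbar, k ∈ T.succSet f φ Λ P) ∧
    -- q-superlinear convergence
    (fun k => T.z (k + 1) - zbar) =o[atTop] (fun k => T.z k - zbar) ∧
    -- convergence of order `1 + β`
    (∀ β : ℝ, 0 < β → β ≤ 1 →
      OrderSemismoothAt β (prox φ Λ) zbar →
      (E =O[𝓝 0] fun h : Vec n => ‖h‖ ^ (1 + β)) →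
      (∀ k, T.B k = hess f (T.x φ Λ k)) →
      (∃ K : ℝ≥0, ∃ U ∈ 𝓝 (prox φ Λ zbar), LipschitzOnWith K (hess f) (U ∩ effDom φ)) →
      ∃ C : ℝ, ∀ᶠ k in atTop, ‖T.z (k + 1) - zbar‖ ≤ C * ‖T.z k - zbar‖ ^ (1 + β)) := by
  obtain ⟨κM, hκM, K, hMK⟩ := hM
  have hG : GlobalAssumptions f φ Λ P T L ν :=
    ⟨hf, hφ, hΛ, hP, hrun, hΔmin, hLip, hν₁, hνk, hτ, hB⟩
  have hF0 := hG.normalMap_limit_eq_zero hconv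
  have hFlim : Tendsto (fun k => normalMap f φ Λ (T.z k)) atTop (𝓝 0) := by
    rw [← hF0]
    exact ((continuous_normalMap hf hφ hΛ).tendsto zbar).comp hconv
  have htol : T.ε =o[atTop] fun k => normalMap f φ Λ (T.z k) := by
    have h1 : (fun k => E (normalMap f φ Λ (T.z k)))
        =o[atTop] fun k => ‖normalMap f φ Λ (T.z k)‖ := hE_o.comp_tendsto hFlim
    refine IsBigO.trans_isLittleO (IsBigO.of_bound 1 (Eventually.of_forall fun k => ?_))
      h1.of_norm_right
    rw [one_mul, Real.norm_eq_abs, abs_of_nonneg (hrun.tol_nonneg k)]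
    exact (hε k).trans (le_abs_self _)
  have h : LocalAssumptions f φ Λ P T L ν zbar κM K :=
    ⟨hG, hconv, hC2.1, hC2.2, hsemi, hκM, fun k hk => (hMK k hk).1, fun k hk => (hMK k hk).2.1,
      fun k hk => (hMK k hk).2.2, hDM, htol⟩
  have hsucc := h.eventually_success fun δ hδ => h.eventually_ν_le hp ha_growth hν_upper hδ
  refine ⟨?_, ?_, ?_⟩
  · obtain ⟨Kbar, hKbar⟩ := eventually_atTop.1 hsucc
    exact ⟨Kbar, fun k hk => (hKbar k hk).1⟩
  · refine isLittleO_iff.2 fun c hc => ?_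
    filter_upwards [hsucc, h.eventually_step_eq hc] with k hk hs
    rw [hrun.accept k hk.1]
    exact (hs hk.2).2
  · intro β hβ0 hβ1 hord hE_O hBk hHess
    obtain ⟨C, hC⟩ := h.exists_newton_order hβ0 hβ1 hord hE_O hε hBk hHess
    refine ⟨C, ?_⟩
    filter_upwards [hsucc, hC] with k hk hs
    rw [hrun.accept k hk.1]
    exact hs hk.2
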